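/- Let $F=\mathbb R$ or $\mathbb C$. A k-space is a compactly generated Hausdorff space; products, function spaces, subspaces of these, nerves and geometric realizations are formed in k-spaces. $\mathrm{CG}_G$ denotes the category of $G$-spaces that are k-spaces. *The category $\Gamma$.* Its objects are the finite sets; a morphism $\gamma:S\to T$ is a map from $S$ to the set of subsets of $T$ with pairwise disjoint values; the composite of $\gamma:S\to T$ and $\delta:T\to U$ is $s\mapsto\bigcup_{t\in\gamma(s)}\delta(t)$. Write $\mathbf n=\{1,\dots,n\}$. *The category $\Gamma\text{-Fib}_F$.* An object over $S$ (an $S$-object) is a family $(p_s:E_s\to X)_{s\in S}$ of Hilbert bundles over $F$ (locally trivial, with finite-dimensional fibres of locally constant dimension and structural groups $U_n(F)$) over a locally countable CW-complex $X$. A morphism from a $T$-object $(X,(p_t))$ to an $S$-object $(Y,(q_s))$ over $\gamma:S\to T$ is a continuous map $\bar f:X\to Y$ with, for each $s\in S$, a continuous map $f_s:\bigoplus_{t\in\gamma(s)}E_t\to E'_s$ over $\bar f$ which is a linear bijective isometry on each fibre (orthogonal direct sum). For a $\mathbf 1$-object $p$ over $X$, $n.p$ is the $\mathbf n$-object over $X^n$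 whose $i$-th bundle is the pull-back of $p$ along the $i$-th projection. *Hilbert $\Gamma$-bundles.* A Hilbert $\Gamma$-bundle is a contravariant functor $\varphi:\Gamma\to\Gamma\text{-Fib}_F$ such that $\varphi(S)$ is an $S$-object and $\varphi(\gamma)$ lies over $\gamma$ for all $S,\gamma$; the base of $\varphi(\mathbf 0)$ is a point; and for every $n\ge1$ there is a morphism $n.\varphi(\mathbf 1)\to\varphi(\mathbf n)$ over $\mathrm{id}_{\mathbf n}$. *The spaces.* For an $S$-object $\varphi=(X,(p_s))$, let $\varphi\text{-mod}$ be the topological category with space of objects $X$ whose morphisms $x\to y$ are the families of linear isomorphisms $((E_s)_x\to(E_s)_y)_{s\in S}$. Its space of morphisms is the fibre product over $X\times X$ of the spaces of morphisms of the $p_s\text{-mod}$, the latter being $\coprod_n(\tilde E_n\times\tilde E_n)/\mathrm{GL}_n(F)$ with $\tilde E_n$ the space of $n$-frames of the $n$-dimensional fibres. Define $\varphi\text{-imod}$ similarly with isometries (and orthonormal frames, $U_n(F)$), and $\varphi\text{-smod}$ with families of similarities having a common ratio $r>0$ (and orthogonal frames of vectors of equal positive norm, $F^*U_n(F)$); no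 condition is imposed on zero-dimensional fibres. A morphism $f$ over $\gamma$ induces on these categories the functor $(\varphi_t)_t\mapsto\bigl(f_s\circ\bigoplus_{t\in\gamma(s)}\varphi_t\circ f_s^{-1}\bigr)_s$. For a Lie group $G$, let $\mathcal EG$ be the category with object space $G$ and exactly one morphism between any two objects, with morphism space $G\times G$. Put $$\mathrm{Vec}_G^{\varphi}=|\mathrm{Func}(\mathcal EG,\varphi\text{-mod})|,\quad i\mathrm{Vec}_G^{\varphi}=|\mathrm{Func}(\mathcal EG,\varphi\text{-imod})|,\quad s\mathrm{Vec}_G^{\varphi}=|\mathrm{Func}(\mathcal EG,\varphi\text{-smod})|,$$ where $\mathrm{Func}$ is the topological category of continuous functors and continuous natural transformations, $|\cdot|$ is the thin geometric realization of the nerve, and $G$ acts through right multiplication on the objects of $\mathcal EG$. **Proposition.** Let $\varphi$ be a Hilbert $\Gamma$-bundle and $G$ a Lie group. The constructions above are well defined (the categories $\mathcal EG$, $\varphi(S)\text{-mod}$, $\varphi(S)\text{-imod}$, $\varphi(S)\text{-smod}$ are k-categories, i.e. have k-spaces of objects and morphisms and continuous structural maps, and the functors induced by the $\varphi(\gamma)$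 are continuous), and each of the three assignments $$S\mapsto \mathrm{Vec}_G^{\varphi(S)},\qquad S\mapsto i\mathrm{Vec}_G^{\varphi(S)},\qquad S\mapsto s\mathrm{Vec}_G^{\varphi(S)}$$ is a $\Gamma\text{-}G$-space. That is, it is a contravariant functor $\underline A:\Gamma\to \mathrm{CG}_G$ such that 1. $\underline A(\mathbf 0)$ is equivariantly well-pointed (it has a fixed point whose inclusion is a closed $G$-cofibration) and equivariantly contractible; 2. for every $n\ge1$, the map $\underline A(\mathbf n)\to\prod_{i=1}^n\underline A(\mathbf 1)$ induced by the $n$ morphisms $\mathbf 1\to\mathbf n$, $1\mapsto\{i\}$, is an equivariant homotopy equivalence. -/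

import Mathlib

open Topology
open scoped CompactCoherentification Manifold ContDiff

universe u v w

noncomputable section

/-! ### k-spaces

`𝐤 X` is the k-ification of `X`; for Hausdorff spaces, `CompactlyCoherentSpace` means
"compactly generated". -/

/-- A k-space: a compactly generated Hausdorff space. -/
structure IsKSpace (X : Type u) [TopologicalSpace X] : Prop where
  t2 : T2Space X
  coherent : CompactlyCoherentSpace X

theorem continuous_kify_map {X : Type u} {Y : Type v} [TopologicalSpace X] [TopologicalSpace Y]
    {f : X → Y} (hf : Continuous f) :
    Continuous (fun x : 𝐤 X => (CompactCoherentification.mk Y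
      (f ((CompactCoherentification.mk X).symm x)))) := by
  rw [CompactCoherentification.continuous_dom_iff]
  intro K hK
  rw [CompactCoherentification.continuousOn_rng_of_isCompact hK]
  exact hf.continuousOn

/-! ### Small categories with topologies -/

/-- A small category with a topology on its set of objects and on its set of morphisms.
`comp f g _` is the composite "first `f`, then `g`". -/
structure TCat where
  Ob : Type u
  Mor : Type v
  [topOb : TopologicalSpace Ob]
  [topMor : TopologicalSpace Mor]
  src : Mor → Ob
  tgt : Mor → Ob
  id : Ob → Mor
  comp : ∀ f g : Mor, tgt f = src g → Mor
  src_id : ∀ x, src (id x) = x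
  tgt_id : ∀ x, tgt (id x) = x
  src_comp : ∀ f g h, src (comp f g h) = src f
  tgt_comp : ∀ f g h, tgt (comp f g h) = tgt g
  id_comp : ∀ f, comp (id (src f)) f (tgt_id _) = f
  comp_id : ∀ f, comp f (id (tgt f)) (src_id _).symm = f
  assoc : ∀ (f g k : Mor) (h₁ : tgt f = src g) (h₂ : tgt g = src k),
    comp (comp f g h₁) k ((tgt_comp f g h₁).trans h₂) =
      comp f (comp g k h₂) (h₁.trans (src_comp g k h₂).symm)

attribute [instance] TCat.topOb TCat.topMor

namespace TCat

/-- A k-category: the spaces of objects and of morphisms are k-spaces, and the structural maps are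
continuous, the composition being defined on the fibre product formed in k-spaces. -/
structure IsKCat (C : TCat.{u, v}) : Prop where
  ob : IsKSpace C.Ob
  mor : IsKSpace C.Mor
  continuous_src : Continuous C.src
  continuous_tgt : Continuous C.tgt
  continuous_id : Continuous C.id
  continuous_comp : Continuous (fun p : 𝐤 {p : C.Mor × C.Mor // C.tgt p.1 = C.src p.2} =>
    C.comp ((CompactCoherentification.mk _).symm p).1.1 ((CompactCoherentification.mk _).symm p).1.2
      ((CompactCoherentification.mk _).symm p).2)

theorem comp_congr (C : TCat.{u, v}) {f f' g g' : C.Mor} (hf : f = f') (hg : g = g')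
    (h : C.tgt f = C.src g) :
    C.comp f g h = C.comp f' g' (hf ▸ hg ▸ h) := by
  subst hf; subst hg; rfl

theorem IsKCat.continuous_comp_of {C : TCat.{u, v}} (hC : C.IsKCat) {X : Type w}
    [TopologicalSpace X] [CompactlyCoherentSpace X] {f g : X → C.Mor} (hf : Continuous f)
    (hg : Continuous g) (h : ∀ x, C.tgt (f x) = C.src (g x)) :
    Continuous (fun x => C.comp (f x) (g x) (h x)) := by
  have h1 : Continuous (fun x => (⟨(f x, g x), h x⟩ :
      {p : C.Mor × C.Mor // C.tgt p.1 = C.src p.2})) :=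
    (hf.prodMk hg).subtype_mk _
  exact hC.continuous_comp.comp
    ((continuous_kify_map h1).comp CompactCoherentification.continuous_mk)

/-- Functors between small topologized categories (without continuity). -/
@[ext]
structure Fun (C : TCat.{u, v}) (D : TCat) where
  ob : C.Ob → D.Ob
  mor : C.Mor → D.Mor
  src_mor : ∀ f, D.src (mor f) = ob (C.src f)
  tgt_mor : ∀ f, D.tgt (mor f) = ob (C.tgt f)
  mor_id : ∀ x, mor (C.id x) = D.id (ob x)
  mor_comp : ∀ f g h, mor (C.comp f g h) =
    D.comp (mor f) (mor g) (by rw [tgt_mor, src_mor, h])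

/-- Composition of functors: first `F`, then `H`. -/
def Fun.comp {C D E : TCat} (F : Fun C D) (H : Fun D E) : Fun C E where
  ob := H.ob ∘ F.ob
  mor := H.mor ∘ F.mor
  src_mor f := by simp [H.src_mor, F.src_mor]
  tgt_mor f := by simp [H.tgt_mor, F.tgt_mor]
  mor_id x := by simp [F.mor_id, H.mor_id]
  mor_comp f g h := by simp [F.mor_comp, H.mor_comp]

/-- The identity functor. -/
def Fun.refl (C : TCat) : Fun C C where
  ob := _root_.id
  mor := _root_.id
  src_mor _ := rfl
  tgt_mor _ := rfl
  mor_id _ := rfl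
  mor_comp _ _ _ := rfl

/-- Continuity of a functor, on objects and on morphisms. -/
structure Fun.IsCont {C D : TCat} (F : Fun C D) : Prop where
  ob : Continuous F.ob
  mor : Continuous F.mor

theorem Fun.IsCont.comp {C D E : TCat} {F : Fun C D} {H : Fun D E} (hF : F.IsCont)
    (hH : H.IsCont) : (F.comp H).IsCont :=
  ⟨hH.ob.comp hF.ob, hH.mor.comp hF.mor⟩

/-! ### The topologized category of continuous functors and continuous transformations -/

/-- Continuous functors, topologized as a subspace of the function space of continuous maps
`C.Mor → D.Mor` (the k-ification of the compact-open topology). -/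
@[ext]
structure FuncOb (C D : TCat) where
  toFun : Fun C D
  cont : toFun.IsCont

instance (C D : TCat) : TopologicalSpace (FuncOb C D) :=
  TopologicalSpace.induced
    (fun F => (CompactCoherentification.mk C(C.Mor, D.Mor) ⟨F.toFun.mor, F.cont.mor⟩))
    inferInstance

/-- Continuous natural transformations, together with their source and target. -/
@[ext]
structure FuncMor (C D : TCat) where
  dom : FuncOb C D
  cod : FuncOb C D
  app : C.Ob → D.Mor
  cont : Continuous app
  src_app : ∀ x, D.src (app x) = dom.toFun.ob x
  tgt_app : ∀ x, D.tgt (app x) = cod.toFun.ob x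
  natural : ∀ f, D.comp (dom.toFun.mor f) (app (C.tgt f))
      (by rw [dom.toFun.tgt_mor, src_app]) =
    D.comp (app (C.src f)) (cod.toFun.mor f) (by rw [cod.toFun.src_mor, tgt_app])

/-- Transformations are topologized as a subspace of the k-product of two copies of the space of
continuous functors with the function space of continuous maps `C.Ob → D.Mor`. -/
instance (C D : TCat) : TopologicalSpace (FuncMor C D) :=
  TopologicalSpace.induced
    (fun a => (CompactCoherentification.mk (FuncOb C D × FuncOb C D × 𝐤 C(C.Ob, D.Mor))
      (a.dom, a.cod, CompactCoherentification.mk C(C.Ob, D.Mor) ⟨a.app, a.cont⟩)))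
    inferInstance

/-- `Func(C, D)`, for k-categories `C` and `D`. -/
def Func (C D : TCat) (hC : C.IsKCat) (hD : D.IsKCat) : TCat where
  Ob := FuncOb C D
  Mor := FuncMor C D
  src := FuncMor.dom
  tgt := FuncMor.cod
  id F :=
    { dom := F
      cod := F
      app := fun x => D.id (F.toFun.ob x)
      cont := hD.continuous_id.comp F.cont.ob
      src_app := fun x => D.src_id _
      tgt_app := fun x => D.tgt_id _
      natural := fun f => by
        rw [D.comp_congr rfl (congrArg D.id (F.toFun.tgt_mor f).symm), D.comp_id,
          D.comp_congr (congrArg D.id (F.toFun.src_mor f).symm) rfl, D.id_comp] }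
  comp a b h :=
    { dom := a.dom
      cod := b.cod
      app := fun x => D.comp (a.app x) (b.app x) (by rw [a.tgt_app, b.src_app, h])
      cont := by
        have := hC.ob.coherent
        exact hD.continuous_comp_of a.cont b.cont _
      src_app := fun x => by rw [D.src_comp, a.src_app]
      tgt_app := fun x => by rw [D.tgt_comp, b.tgt_app]
      natural := fun f => by
        obtain ⟨ad, ac, aapp, acont, asrc, atgt, anat⟩ := a
        obtain ⟨bd, bc, bapp, bcont, bsrc, btgt, bnat⟩ := b
        obtain rfl : ac = bd := h
        simp only
        rw [← D.assoc _ _ _ (by rw [ad.toFun.tgt_mor, asrc]) (by rw [atgt, bsrc]),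
          D.comp_congr (anat f) rfl,
          D.assoc _ _ _ (by rw [atgt, ac.toFun.src_mor]) (by rw [ac.toFun.tgt_mor, bsrc]),
          D.comp_congr rfl (bnat f),
          ← D.assoc _ _ _ (by rw [atgt, bsrc]) (by rw [btgt, bc.toFun.src_mor])] }
  src_id _ := rfl
  tgt_id _ := rfl
  src_comp _ _ _ := rfl
  tgt_comp _ _ _ := rfl
  id_comp a := by
    ext1
    · rfl
    · rfl
    · funext x
      change D.comp (D.id (a.dom.toFun.ob x)) (a.app x) _ = a.app x
      rw [D.comp_congr (congrArg D.id (a.src_app x).symm) rfl, D.id_comp]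
  comp_id a := by
    ext1
    · rfl
    · rfl
    · funext x
      change D.comp (a.app x) (D.id (a.cod.toFun.ob x)) _ = a.app x
      rw [D.comp_congr rfl (congrArg D.id (a.tgt_app x).symm), D.comp_id]
  assoc a b c h₁ h₂ := by
    ext1
    · rfl
    · rfl
    · funext x
      exact D.assoc _ _ _ _ _

/-- The functor `Func(C, D) → Func(C', D)` given by precomposition with a continuous functor
`R : C' → C`. -/
def Func.precomp {C C' D : TCat} (hC : C.IsKCat) (hC' : C'.IsKCat) (hD : D.IsKCat)
    (R : Fun C' C) (hR : R.IsCont) : Fun (Func C D hC hD) (Func C' D hC' hD) where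
  ob F := ⟨R.comp F.toFun, hR.comp F.cont⟩
  mor a :=
    { dom := ⟨R.comp a.dom.toFun, hR.comp a.dom.cont⟩
      cod := ⟨R.comp a.cod.toFun, hR.comp a.cod.cont⟩
      app := a.app ∘ R.ob
      cont := a.cont.comp hR.ob
      src_app := fun x => a.src_app _
      tgt_app := fun x => a.tgt_app _
      natural := fun f => by
        have := a.natural (R.mor f)
        rw [D.comp_congr rfl (congrArg a.app (R.tgt_mor f)),
          D.comp_congr (congrArg a.app (R.src_mor f)) rfl] at this
        exact this }
  src_mor _ := rfl
  tgt_mor _ := rfl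
  mor_id _ := rfl
  mor_comp _ _ _ := rfl

/-- The functor `Func(C, D) → Func(C, D')` given by postcomposition with a continuous functor
`H : D → D'`. -/
def Func.postcomp {C D D' : TCat} (hC : C.IsKCat) (hD : D.IsKCat) (hD' : D'.IsKCat)
    (H : Fun D D') (hH : H.IsCont) : Fun (Func C D hC hD) (Func C D' hC hD') where
  ob F := ⟨F.toFun.comp H, F.cont.comp hH⟩
  mor a :=
    { dom := ⟨a.dom.toFun.comp H, a.dom.cont.comp hH⟩
      cod := ⟨a.cod.toFun.comp H, a.cod.cont.comp hH⟩
      app := H.mor ∘ a.app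
      cont := hH.mor.comp a.cont
      src_app := fun x => by
        change D'.src (H.mor (a.app x)) = H.ob (a.dom.toFun.ob x)
        rw [H.src_mor, a.src_app]
      tgt_app := fun x => by
        change D'.tgt (H.mor (a.app x)) = H.ob (a.cod.toFun.ob x)
        rw [H.tgt_mor, a.tgt_app]
      natural := fun f => by
        have := congrArg H.mor (a.natural f)
        rw [H.mor_comp, H.mor_comp] at this
        exact this }
  src_mor _ := rfl
  tgt_mor _ := rfl
  mor_id F := FuncMor.ext rfl rfl (funext fun _ => H.mor_id _)
  mor_comp a b h := FuncMor.ext rfl rfl (funext fun _ => H.mor_comp _ _ _)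

/-! ### Nerve and geometric realization -/

/-- The ordered set `[m] = {0 < ⋯ < m}` as a discrete small category. -/
def ordinal (m : ℕ) : TCat where
  Ob := Fin (m + 1)
  Mor := {p : Fin (m + 1) × Fin (m + 1) // p.1 ≤ p.2}
  topOb := ⊥
  topMor := ⊥
  src p := p.1.1
  tgt p := p.1.2
  id x := ⟨(x, x), le_rfl⟩
  comp f g h := ⟨(f.1.1, g.1.2), f.2.trans (h.le.trans g.2)⟩
  src_id _ := rfl
  tgt_id _ := rfl
  src_comp _ _ _ := rfl
  tgt_comp _ _ _ := rfl
  id_comp _ := rfl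
  comp_id _ := rfl
  assoc _ _ _ _ _ := rfl

/-- The functor `[m] → [k]` given by a nondecreasing map. -/
def ordinalMap {m k : ℕ} (α : Fin (m + 1) →o Fin (k + 1)) : Fun (ordinal m) (ordinal k) where
  ob := α
  mor p := ⟨(α p.1.1, α p.1.2), α.monotone p.2⟩
  src_mor _ := rfl
  tgt_mor _ := rfl
  mor_id _ := rfl
  mor_comp _ _ _ := rfl

/-- The `m`-simplices of the nerve: functors `[m] → A`, that is chains of `m` composable
morphisms (together with all their composites). -/
def Nerve (A : TCat.{u, v}) (m : ℕ) : Type max u v := Fun (ordinal m) A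

/-- The nerve is formed in k-spaces: `Nerve A m` is a subspace of a finite k-product of copies of
`A.Mor`. -/
instance (A : TCat.{u, v}) (m : ℕ) : TopologicalSpace (Nerve A m) :=
  TopologicalSpace.induced
    (fun c : Fun (ordinal m) A => (CompactCoherentification.mk ((ordinal m).Mor → A.Mor) c.mor))
    inferInstance

/-- The disjoint union of the spaces `Nerve A m × Δᵐ`. (As `Δᵐ` is compact, the product is already
a k-space if `Nerve A m` is.) -/
abbrev PreRealization (A : TCat.{u, v}) : Type max u v :=
  Σ m : ℕ, Nerve A m × stdSimplex ℝ (Fin (m + 1))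

/-- The identifications `(α^* c, t) ∼ (c, α_* t)` for every nondecreasing `α : [m] → [k]`. -/
inductive RealizationRel (A : TCat.{u, v}) : PreRealization A → PreRealization A → Prop
  | glue {m k : ℕ} (α : Fin (m + 1) →o Fin (k + 1)) (c : Nerve A k)
      (t : stdSimplex ℝ (Fin (m + 1))) :
      RealizationRel A ⟨m, ((ordinalMap α).comp c, t)⟩ ⟨k, (c, stdSimplex.map α t)⟩

/-- The (thin) geometric realization `|A|` of the nerve of `A`, with the quotient topology. -/
def Realization (A : TCat.{u, v}) : Type max u v := Quot (RealizationRel A)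

instance (A : TCat.{u, v}) : TopologicalSpace (Realization A) :=
  inferInstanceAs (TopologicalSpace (Quot (RealizationRel A)))

/-- The map `|A| → |B|` induced by a functor. -/
def Realization.map {A B : TCat} (F : Fun A B) : Realization A → Realization B :=
  Quot.map (fun p => ⟨p.1, (Fun.comp p.2.1 F, p.2.2)⟩) (by
    rintro _ _ ⟨α, c, t⟩
    exact RealizationRel.glue α (Fun.comp c F) t)

theorem Realization.map_refl {A : TCat} (x : Realization A) :
    Realization.map (Fun.refl A) x = x := by
  induction x using Quot.ind
  rfl

theorem Realization.map_map {A B C : TCat} (F : Fun A B) (H : Fun B C) (x : Realization A) :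
    Realization.map H (Realization.map F x) = Realization.map (F.comp H) x := by
  induction x using Quot.ind
  rfl

/-! ### The category `𝓔 X` -/

/-- `𝓔 X`: the objects are the points of `X`, with exactly one morphism `(x, y)` from `x` to `y`. -/
def perfect (X : Type u) [TopologicalSpace X] : TCat where
  Ob := X
  Mor := 𝐤 (X × X)
  src p := ((CompactCoherentification.mk (X × X)).symm p).1
  tgt p := ((CompactCoherentification.mk (X × X)).symm p).2
  id x := CompactCoherentification.mk (X × X) (x, x)
  comp f g _ := CompactCoherentification.mk (X × X)
    (((CompactCoherentification.mk (X × X)).symm f).1,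
      ((CompactCoherentification.mk (X × X)).symm g).2)
  src_id _ := rfl
  tgt_id _ := rfl
  src_comp _ _ _ := rfl
  tgt_comp _ _ _ := rfl
  id_comp _ := rfl
  comp_id _ := rfl
  assoc _ _ _ _ _ := rfl

/-- The functor `𝓔 X → 𝓔 Y` induced by a map. -/
def perfectMap {X : Type u} {Y : Type v} [TopologicalSpace X] [TopologicalSpace Y] (f : X → Y) :
    Fun (perfect X) (perfect Y) where
  ob := f
  mor p := CompactCoherentification.mk (Y × Y)
    (Prod.map f f ((CompactCoherentification.mk (X × X)).symm p))
  src_mor _ := rfl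
  tgt_mor _ := rfl
  mor_id _ := rfl
  mor_comp _ _ _ := rfl

theorem perfectMap_isCont {X : Type u} {Y : Type v} [TopologicalSpace X] [TopologicalSpace Y]
    {f : X → Y} (hf : Continuous f) : (perfectMap f).IsCont :=
  { ob := hf
    mor := continuous_kify_map (f := Prod.map f f) (hf.prodMap hf) }

/-- The left action of `G` on `|Func(𝓔 G, D)|` induced by right multiplication on the objects of
`𝓔 G`: on functors, `(g • F)(x) = F(x g)`. -/
instance realizationAction (G : Type u) [Group G] [TopologicalSpace G] [IsTopologicalGroup G]
    (D : TCat) (hG : (perfect G).IsKCat) (hD : D.IsKCat) :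
    MulAction G (Realization (Func (perfect G) D hG hD)) where
  smul g := Realization.map
    (Func.precomp hG hG hD (perfectMap (fun x : G => x * g))
      (perfectMap_isCont (continuous_mul_const g)))
  one_smul x := by
    have : (fun x : G => x * 1) = _root_.id := by funext x; simp
    change Realization.map _ x = x
    conv_rhs => rw [← Realization.map_refl x]
    congr 1
    simp only [this]
    rfl
  mul_smul g h x := by
    have : (fun x : G => x * (g * h)) = (fun x => x * h) ∘ (fun x => x * g) := by
      funext x; simp [mul_assoc]
    change Realization.map _ x = Realization.map _ (Realization.map _ x)
    rw [Realization.map_map]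
    congr 1
    simp only [this]
    rfl

end TCat

/-! ### The category `Γ` -/

/-- A morphism `S → T` of `Γ`: a map from `S` to the subsets of `T` with pairwise disjoint values. -/
@[ext]
structure GammaHom (S T : Type) where
  toFun : S → Set T
  disj : ∀ s s', s ≠ s' → Disjoint (toFun s) (toFun s')

namespace GammaHom

/-- The identity morphism. -/
protected def id (S : Type) : GammaHom S S where
  toFun s := {s}
  disj _ _ h := by simpa using h

/-- The composite "first `f`, then `g`". -/
protected def comp {S T U : Type} (f : GammaHom S T) (g : GammaHom T U) : GammaHom S U where
  toFun s := ⋃ t ∈ f.toFun s, g.toFun t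
  disj s s' h := by
    simp only [Set.disjoint_iUnion_left, Set.disjoint_iUnion_right]
    intro t ht t' ht'
    refine g.disj _ _ ?_
    rintro rfl
    exact Set.disjoint_left.1 (f.disj _ _ h) ht' ht

/-- The morphism `𝟏 → 𝐧` which maps the element of `𝟏` to `{i}`. -/
def point {n : ℕ} (i : Fin n) : GammaHom (Fin 1) (Fin n) where
  toFun _ := {i}
  disj _ _ h := (h (Subsingleton.elim _ _)).elim

end GammaHom

/-! ### Hilbert bundles -/

/-- A (finite-dimensional) Hilbert bundle over `X`: a family of inner product spaces with a
topology on the total space, which is locally, by fibrewise linear isometries, isomorphic to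
`U × 𝕜ⁿ` (the dimension `n` may depend on the component). -/
structure HilbertBundle (𝕜 : Type w) [RCLike 𝕜] (X : Type u) [TopologicalSpace X] where
  fiber : X → Type u
  [normed : ∀ x, NormedAddCommGroup (fiber x)]
  [inner : ∀ x, InnerProductSpace 𝕜 (fiber x)]
  [top : TopologicalSpace (Bundle.TotalSpace 𝕜 fiber)]
  continuous_proj : Continuous (fun v : Bundle.TotalSpace 𝕜 fiber => v.proj)
  locally_trivial : ∀ x₀ : X, ∃ (n : ℕ) (U : Set X)
    (e : ∀ x : U, fiber x ≃ₗᵢ[𝕜] EuclideanSpace 𝕜 (Fin n)), IsOpen U ∧ x₀ ∈ U ∧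
      IsHomeomorph (fun v : {v : Bundle.TotalSpace 𝕜 fiber // v.proj ∈ U} =>
        ((⟨v.1.proj, v.2⟩, e ⟨v.1.proj, v.2⟩ v.1.snd) : U × EuclideanSpace 𝕜 (Fin n)))

attribute [instance] HilbertBundle.normed HilbertBundle.inner HilbertBundle.top

namespace HilbertBundle

variable {𝕜 : Type w} [RCLike 𝕜]

/-- The total space (the first argument of `Bundle.TotalSpace` is a phantom). -/
abbrev Total {X : Type u} [TopologicalSpace X] (p : HilbertBundle 𝕜 X) : Type u :=
  Bundle.TotalSpace 𝕜 p.fiber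

/-- The topology on the total space of a pull-back, as a subspace of `Y × E`. -/
@[reducible]
def pullbackTop {X Y : Type u} [TopologicalSpace X] [TopologicalSpace Y]
    (p : HilbertBundle 𝕜 X) (f : Y → X) :
    TopologicalSpace (Bundle.TotalSpace 𝕜 (fun y => p.fiber (f y))) :=
  TopologicalSpace.induced (fun v => ((v.proj, ⟨f v.proj, v.snd⟩) : Y × p.Total)) inferInstance

/-- The pull-back of a Hilbert bundle, topologized as a subspace of `Y × E`. -/
def pullback {X Y : Type u} [TopologicalSpace X] [TopologicalSpace Y]
    (p : HilbertBundle 𝕜 X) (f : Y → X) (hf : Continuous f) : HilbertBundle 𝕜 Y where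
  fiber y := p.fiber (f y)
  top := pullbackTop p f
  continuous_proj := by
    let _ := pullbackTop p f
    have hcont : Continuous (fun v : Bundle.TotalSpace 𝕜 (fun y => p.fiber (f y)) =>
        ((v.proj, ⟨f v.proj, v.snd⟩) : Y × p.Total)) := continuous_induced_dom
    exact continuous_fst.comp hcont
  locally_trivial y₀ := by
    let _ := pullbackTop p f
    obtain ⟨n, U, e, hU, hy, he⟩ := p.locally_trivial (f y₀)
    refine ⟨n, f ⁻¹' U, fun y => e ⟨f y, y.2⟩, hU.preimage hf, hy, ?_⟩
    have hcont : Continuous (fun v : Bundle.TotalSpace 𝕜 (fun y => p.fiber (f y)) =>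
        ((v.proj, ⟨f v.proj, v.snd⟩) : Y × p.Total)) := continuous_induced_dom
    have h2 : Continuous (fun v : {v : Bundle.TotalSpace 𝕜 (fun y => p.fiber (f y)) //
        v.proj ∈ f ⁻¹' U} => (⟨⟨f v.1.proj, v.1.snd⟩, v.2⟩ : {v : p.Total // v.proj ∈ U})) :=
      ((continuous_snd.comp hcont).comp continuous_subtype_val).subtype_mk _
    let E := he.homeomorph
    refine Homeomorph.isHomeomorph (X := {v : Bundle.TotalSpace 𝕜 (fun y => p.fiber (f y)) //
      v.proj ∈ f ⁻¹' U}) (Y := (f ⁻¹' U : Set Y) × EuclideanSpace 𝕜 (Fin n))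
      { toFun := _
        invFun := fun q => ⟨⟨q.1.1, (e ⟨f q.1.1, q.1.2⟩).symm q.2⟩, q.1.2⟩
        left_inv := ?_
        right_inv := ?_
        continuous_toFun := ?_
        continuous_invFun := ?_ }
    · rintro ⟨⟨y, v⟩, hv⟩
      simp
    · rintro ⟨⟨y, hy⟩, v⟩
      simp
    · refine Continuous.prodMk ?_ ?_
      · exact ((continuous_fst.comp hcont).comp continuous_subtype_val).subtype_mk _
      · exact continuous_snd.comp (he.continuous.comp h2)
    · refine Continuous.subtype_mk ?_ _
      refine continuous_induced_rng.2 ?_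
      refine Continuous.prodMk (continuous_subtype_val.comp continuous_fst) ?_
      have h3 : Continuous (fun q : (f ⁻¹' U : Set Y) × EuclideanSpace 𝕜 (Fin n) =>
          E.symm ((⟨f q.1.1, q.1.2⟩ : U), q.2)) :=
        E.symm.continuous.comp (((hf.comp (continuous_subtype_val.comp
          continuous_fst)).subtype_mk _).prodMk continuous_snd)
      have h4 : ∀ q : (f ⁻¹' U : Set Y) × EuclideanSpace 𝕜 (Fin n),
          E.symm ((⟨f q.1.1, q.1.2⟩ : U), q.2) =
            ⟨⟨f q.1.1, (e ⟨f q.1.1, q.1.2⟩).symm q.2⟩, q.1.2⟩ := by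
        intro q
        rw [Homeomorph.symm_apply_eq]
        simp [E]
      have h5 := continuous_subtype_val.comp h3
      refine h5.congr ?_
      intro q
      simp only [Function.comp_apply, h4]

end HilbertBundle

/-! ### Pre-decomposed Hilbert bundles: the category `Γ-Fib` -/

/-- A family of Hilbert bundles `(p_s)_{s ∈ S}` over the same base space. -/
structure FibObj (𝕜 : Type w) [RCLike 𝕜] (S : Type) where
  base : Type u
  [topBase : TopologicalSpace base]
  bundle : S → HilbertBundle 𝕜 base

attribute [instance] FibObj.topBase

namespace FibObj

variable {𝕜 : Type w} [RCLike 𝕜] {S T U : Type}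

/-- The Whitney sum `⊕_{s ∈ A} E_s`. -/
structure WhitneySum (φ : FibObj.{u} 𝕜 S) (A : Set S) where
  pt : φ.base
  vec : ∀ s : A, (φ.bundle s).fiber pt

/-- The Whitney sum is topologized as the fibre product over the base. -/
instance (φ : FibObj.{u} 𝕜 S) (A : Set S) : TopologicalSpace (WhitneySum φ A) :=
  TopologicalSpace.induced
    (fun v => ((v.pt, fun s => ⟨v.pt, v.vec s⟩) : φ.base × ∀ s : A, (φ.bundle s).Total))
    inferInstance

/-- A morphism of `Γ-Fib` from the `T`-object `φ` to the `S`-object `ψ` over `γ : S → T`: a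
continuous map `base` and, for every `s ∈ S`, a strong morphism of Hilbert bundles
`⊕_{t ∈ γ(s)} E_t → E'_s` over it (continuous and, on each fibre, a linear bijective isometry for
the orthogonal direct sum). -/
@[ext]
structure Hom (γ : GammaHom S T) (φ : FibObj.{u} 𝕜 T) (ψ : FibObj.{u} 𝕜 S) where
  base : φ.base → ψ.base
  lin : ∀ s x, (∀ t : γ.toFun s, (φ.bundle t).fiber x) →ₗ[𝕜] (ψ.bundle s).fiber (base x)
  continuous_base : Continuous base
  bijective : ∀ s x, Function.Bijective (lin s x)
  isometry : ∀ s x v, ‖lin s x v‖ ^ 2 = ∑ᶠ t : γ.toFun s, ‖v t‖ ^ 2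
  continuous_total : ∀ s, Continuous (fun v : φ.WhitneySum (γ.toFun s) =>
    (⟨base v.pt, lin s v.pt v.vec⟩ : (ψ.bundle s).Total))

/-- The identity morphism. -/
def Hom.id (φ : FibObj.{u} 𝕜 S) : Hom (GammaHom.id S) φ φ where
  base x := x
  lin s x := LinearMap.proj (R := 𝕜) (φ := fun t : (GammaHom.id S).toFun s =>
    (φ.bundle t).fiber x) ⟨s, rfl⟩
  continuous_base := continuous_id
  bijective s x := by
    constructor
    · intro v w h
      funext ⟨t, ht⟩
      obtain rfl : t = s := ht
      exact h
    · intro v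
      refine ⟨fun t => cast (congrArg (fun t => (φ.bundle t).fiber x)
        (show t.1 = s from t.2).symm) v, rfl⟩
  isometry s x v := by
    rw [finsum_eq_single _ (⟨s, rfl⟩ : (GammaHom.id S).toFun s)]
    · rfl
    · rintro ⟨t, ht⟩ hne
      exact (hne (Subtype.ext ht)).elim
  continuous_total s :=
    ((continuous_apply (⟨s, rfl⟩ : (GammaHom.id S).toFun s)).comp continuous_snd).comp
      (continuous_induced_dom (α := φ.WhitneySum _))

/-- The inclusion of `δ(t)` in `(δ ∘ γ)(s)` for `t ∈ γ(s)`. -/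
def inc (γ : GammaHom S T) (δ : GammaHom T U) (s : S) (t : γ.toFun s) (r : δ.toFun t) :
    (γ.comp δ).toFun s :=
  ⟨r, Set.mem_biUnion t.2 r.2⟩

theorem inc_bijective (γ : GammaHom S T) (δ : GammaHom T U) (s : S) :
    Function.Bijective (fun p : (Σ t : γ.toFun s, δ.toFun t) => inc γ δ s p.1 p.2) := by
  constructor
  · rintro ⟨⟨t, ht⟩, ⟨r, hr⟩⟩ ⟨⟨t', ht'⟩, ⟨r', hr'⟩⟩ h
    obtain rfl : r = r' := congrArg Subtype.val h
    have : t = t' := by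
      by_contra hne
      exact Set.disjoint_left.1 (δ.disj _ _ hne) hr hr'
    subst this
    rfl
  · rintro ⟨r, hr⟩
    obtain ⟨t, ht, hr⟩ := Set.mem_iUnion₂.1 hr
    exact ⟨⟨⟨t, ht⟩, ⟨r, hr⟩⟩, rfl⟩

/-- The composite "first `a`, then `b`". -/
def Hom.comp [Finite T] [Finite U] {γ : GammaHom S T} {δ : GammaHom T U} {φ : FibObj.{u} 𝕜 U}
    {ψ : FibObj.{u} 𝕜 T} {χ : FibObj.{u} 𝕜 S} (a : Hom δ φ ψ) (b : Hom γ ψ χ) :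
    Hom (γ.comp δ) φ χ where
  base x := b.base (a.base x)
  lin s x := (b.lin s (a.base x)).comp (LinearMap.pi fun t : γ.toFun s =>
    (a.lin t x).comp (LinearMap.pi fun r : δ.toFun t => LinearMap.proj (inc γ δ s t r)))
  continuous_base := b.continuous_base.comp a.continuous_base
  bijective s x := by
    rw [LinearMap.coe_comp]
    refine (b.bijective s (a.base x)).comp ⟨?_, ?_⟩
    · intro v w h
      funext r
      obtain ⟨⟨t, r⟩, rfl⟩ := (inc_bijective γ δ s).2 r
      exact congrFun ((a.bijective t x).1 (congrFun h t)) r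
    · intro w
      choose z hz using fun t : γ.toFun s => (a.bijective t x).2 (w t)
      let E := Equiv.ofBijective _ (inc_bijective γ δ s)
      refine ⟨fun r => (E.apply_symm_apply r) ▸ z (E.symm r).1 (E.symm r).2, ?_⟩
      funext t
      rw [← hz t]
      change a.lin t x _ = _
      congr 1
      funext r
      have key : ∀ (q : (Σ t : γ.toFun s, δ.toFun t)) (p : (Σ t : γ.toFun s, δ.toFun t))
          (h : E q = E p), (h ▸ z q.1 q.2 : (φ.bundle (E p)).fiber x) = z p.1 p.2 := by
        intro q p h
        obtain rfl := E.injective h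
        rfl
      exact key _ ⟨t, r⟩ (E.apply_symm_apply (E ⟨t, r⟩))
  isometry s x v := by
    classical
    have := Fintype.ofFinite T
    have := Fintype.ofFinite U
    rw [LinearMap.comp_apply, b.isometry]
    simp only [LinearMap.pi_apply, LinearMap.comp_apply, a.isometry, finsum_eq_sum_of_fintype]
    rw [← (inc_bijective γ δ s).sum_comp (fun r => ‖v r‖ ^ 2), Fintype.sum_sigma]
    rfl
  continuous_total s := by
    have h : Continuous (fun v : φ.WhitneySum ((γ.comp δ).toFun s) =>
        ((v.pt, fun r => ⟨v.pt, v.vec r⟩) :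
          φ.base × ∀ r : (γ.comp δ).toFun s, (φ.bundle r).Total)) := continuous_induced_dom
    have h1 : ∀ t : γ.toFun s, Continuous (fun v : φ.WhitneySum ((γ.comp δ).toFun s) =>
        (⟨v.pt, fun r => v.vec (inc γ δ s t r)⟩ : φ.WhitneySum (δ.toFun t))) := by
      intro t
      refine continuous_induced_rng.2 ?_
      refine (continuous_fst.comp h).prodMk (continuous_pi fun r => ?_)
      exact (continuous_apply (inc γ δ s t r)).comp (continuous_snd.comp h)
    have h2 : Continuous (fun v : φ.WhitneySum ((γ.comp δ).toFun s) =>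
        (⟨a.base v.pt, fun t => a.lin t v.pt fun r => v.vec (inc γ δ s t r)⟩ :
          ψ.WhitneySum (γ.toFun s))) := by
      refine continuous_induced_rng.2 ?_
      refine (a.continuous_base.comp (continuous_fst.comp h)).prodMk (continuous_pi fun t => ?_)
      exact (a.continuous_total t).comp (h1 t)
    exact (b.continuous_total s).comp h2

/-- The linear bijection `⊕_{t ∈ γ(s)} (E_t)_x → (E'_s)_{base x}`. -/
def Hom.linEquiv {γ : GammaHom S T} {φ : FibObj.{u} 𝕜 T} {ψ : FibObj.{u} 𝕜 S}
    (a : Hom γ φ ψ) (s : S) (x : φ.base) :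
    (∀ t : γ.toFun s, (φ.bundle t).fiber x) ≃ₗ[𝕜] (ψ.bundle s).fiber (a.base x) :=
  LinearEquiv.ofBijective (a.lin s x) (a.bijective s x)

/-- The `n`-object `n.p` over the `n`-fold power of the base, for a `1`-object `p`; its `i`-th
bundle is the pull-back of `p` along the `i`-th projection. -/
def nsum (n : ℕ) (p : FibObj.{u} 𝕜 (Fin 1)) : FibObj.{u} 𝕜 (Fin n) where
  base := Fin n → p.base
  bundle i := (p.bundle 0).pullback (fun x => x i) (continuous_apply i)

end FibObj

/-- `X` is a locally countable CW-complex: it has a cell structure for which every point has a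
neighborhood meeting only countably many cells. -/
def IsLocallyCountableCW (X : Type u) [TopologicalSpace X] : Prop :=
  T2Space X ∧ ∃ _ : CWComplex (Set.univ : Set X), ∀ x : X, ∃ V ∈ 𝓝 x,
    {c : Σ n : ℕ, RelCWComplex.cell (Set.univ : Set X) n |
      (RelCWComplex.openCell (C := (Set.univ : Set X)) c.1 c.2 ∩ V).Nonempty}.Countable

/-- A Hilbert `Γ`-bundle: a contravariant functor `φ` from `Γ` to `Γ-Fib` which is the identity on
the underlying finite sets, whose value at `𝟎` lives over a point, and such that there are
morphisms `n.φ(𝟏) → φ(𝐧)` over the identity of `𝐧` for every `n ≥ 1`. -/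
structure HilbertGammaBundle (𝕜 : Type w) [RCLike 𝕜] where
  obj : ∀ (S : Type) [Finite S], FibObj.{u} 𝕜 S
  locallyCountableCW : ∀ (S : Type) [Finite S], IsLocallyCountableCW (obj S).base
  map : ∀ {S T : Type} [Finite S] [Finite T] (γ : GammaHom S T), FibObj.Hom γ (obj T) (obj S)
  map_id : ∀ (S : Type) [Finite S], map (GammaHom.id S) = FibObj.Hom.id (obj S)
  map_comp : ∀ {S T U : Type} [Finite S] [Finite T] [Finite U] (γ : GammaHom S T)
    (δ : GammaHom T U), map (γ.comp δ) = (map δ).comp (map γ)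
  base_zero : Nonempty (obj (Fin 0)).base ∧ Subsingleton (obj (Fin 0)).base
  exists_sum : ∀ n : ℕ, 1 ≤ n →
    Nonempty (FibObj.Hom (GammaHom.id (Fin n)) ((obj (Fin 1)).nsum n) (obj (Fin n)))

/-! ### The categories `φ-mod`, `φ-imod` and `φ-smod` -/

/-- The three variants: linear isomorphisms (`mod`), isometries (`imod`), similarities (`smod`). -/
inductive ModKind
  | mod
  | imod
  | smod

namespace ModKind

variable {𝕜 : Type w} [RCLike 𝕜]

/-- The condition on a family of linear isomorphisms: none for `mod`; they are isometries for
`imod`; they are similarities sharing the same ratio for `smod`. -/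
def Adm (κ : ModKind) {S : Type v} {V W : S → Type u} [∀ s, NormedAddCommGroup (V s)]
    [∀ s, InnerProductSpace 𝕜 (V s)] [∀ s, NormedAddCommGroup (W s)]
    [∀ s, InnerProductSpace 𝕜 (W s)] (f : ∀ s, V s ≃ₗ[𝕜] W s) : Prop :=
  match κ with
  | mod => True
  | imod => ∀ s v, ‖f s v‖ = ‖v‖
  | smod => ∃ r : ℝ, 0 < r ∧ ∀ s v, ‖f s v‖ = r * ‖v‖

/-- The condition on a basis: none for `mod`; orthonormal for `imod`; simi-orthonormal (orthogonal
with vectors of the same positive norm) for `smod`. -/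
def IsFrame (κ : ModKind) {V : Type u} [NormedAddCommGroup V] [InnerProductSpace 𝕜 V] {n : ℕ}
    (b : Module.Basis (Fin n) 𝕜 V) : Prop :=
  match κ with
  | mod => True
  | imod => Orthonormal 𝕜 b
  | smod => (∀ i j, i ≠ j → Inner.inner 𝕜 (b i) (b j) = 0) ∧ ∃ r : ℝ, 0 < r ∧ ∀ i, ‖b i‖ = r

theorem norm_sum_of_orthogonal {V : Type u} [NormedAddCommGroup V]
    [InnerProductSpace 𝕜 V] {n : ℕ} (b : Fin n → V)
    (h : ∀ i j, i ≠ j → Inner.inner 𝕜 (b i) (b j) = 0) {r : ℝ} (hr : ∀ i, ‖b i‖ = r)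
    (c : Fin n → 𝕜) : ‖∑ i, c i • b i‖ ^ 2 = r ^ 2 * ∑ i, ‖c i‖ ^ 2 := by
  have h1 : ((‖∑ i, c i • b i‖ ^ 2 : ℝ) : 𝕜) = ((r ^ 2 * ∑ i, ‖c i‖ ^ 2 : ℝ) : 𝕜) := by
    rw [RCLike.ofReal_pow, ← inner_self_eq_norm_sq_to_K (𝕜 := 𝕜), sum_inner]
    simp only [inner_sum, inner_smul_left, inner_smul_right]
    rw [Finset.sum_congr rfl (fun i _ => Finset.sum_eq_single i
      (fun j _ hj => by rw [h i j hj.symm]; simp) (by simp))]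
    simp only [inner_self_eq_norm_sq_to_K, hr]
    push_cast
    rw [Finset.mul_sum]
    refine Finset.sum_congr rfl fun i _ => ?_
    rw [← RCLike.mul_conj]
    ring
  exact_mod_cast h1

theorem adm_equiv (κ : ModKind) {V W : Type u} [NormedAddCommGroup V]
    [InnerProductSpace 𝕜 V] [NormedAddCommGroup W] [InnerProductSpace 𝕜 W] {n : ℕ}
    {a : Module.Basis (Fin n) 𝕜 V} {b : Module.Basis (Fin n) 𝕜 W} (ha : κ.IsFrame a)
    (hb : κ.IsFrame b) :
    κ.Adm (𝕜 := 𝕜) (S := Unit) (V := fun _ => V) (W := fun _ => W)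
      (fun _ => a.equiv b (Equiv.refl _)) := by
  have key : ∀ {r r' : ℝ}, 0 < r → 0 < r' → (∀ i j, i ≠ j → Inner.inner 𝕜 (a i) (a j) = 0) →
      (∀ i j, i ≠ j → Inner.inner 𝕜 (b i) (b j) = 0) → (∀ i, ‖a i‖ = r) → (∀ i, ‖b i‖ = r') →
      ∀ v, ‖a.equiv b (Equiv.refl _) v‖ = (r' / r) * ‖v‖ := by
    intro r r' hr hr' hao hbo han hbn v
    have h1 := norm_sum_of_orthogonal a hao han (a.repr v)
    have h2 := norm_sum_of_orthogonal b hbo hbn (a.repr v)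
    rw [a.sum_repr] at h1
    have h3 : a.equiv b (Equiv.refl _) v = ∑ i, a.repr v i • b i := by
      conv_lhs => rw [← a.sum_repr v, map_sum]
      refine Finset.sum_congr rfl fun i _ => ?_
      rw [map_smul, Module.Basis.equiv_apply, Equiv.refl_apply]
    rw [← h3] at h2
    have h4 : ‖a.equiv b (Equiv.refl _) v‖ ^ 2 = ((r' / r) * ‖v‖) ^ 2 := by
      rw [h2, mul_pow, h1]
      field_simp
    exact (pow_left_inj₀ (norm_nonneg _) (by positivity) two_ne_zero).1 h4
  cases κ with
  | mod => trivial
  | imod =>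
    intro _ v
    have := key one_pos one_pos (fun i j h => ha.2 h) (fun i j h => hb.2 h) ha.1 hb.1 v
    simpa using this
  | smod =>
    obtain ⟨hao, r, hr, han⟩ := ha
    obtain ⟨hbo, r', hr', hbn⟩ := hb
    exact ⟨r' / r, div_pos hr' hr, fun _ => key hr hr' hao hbo han hbn⟩

end ModKind

namespace HilbertBundle

variable {𝕜 : Type w} [RCLike 𝕜] {X : Type u} [TopologicalSpace X]

/-- The `n`-frames of the fibres of dimension `n` (all bases, the orthonormal bases or the
simi-orthonormal bases, according to `κ`). -/
structure Frame (κ : ModKind) (p : HilbertBundle 𝕜 X) (n : ℕ) where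
  pt : X
  basis : Module.Basis (Fin n) 𝕜 (p.fiber pt)
  isFrame : κ.IsFrame basis

/-- Frames are topologized as a subspace of the `n`-fold Whitney sum. -/
instance (κ : ModKind) (p : HilbertBundle 𝕜 X) (n : ℕ) : TopologicalSpace (p.Frame κ n) :=
  TopologicalSpace.induced
    (fun a => ((a.pt, fun i => ⟨a.pt, a.basis i⟩) : X × (Fin n → p.Total))) inferInstance

/-- The morphisms of `p-mod`, `p-imod`, `p-smod`: linear isomorphisms (isometries, similarities)
from the fibre at `src` to the fibre at `tgt`. -/
structure Arr (κ : ModKind) (p : HilbertBundle 𝕜 X) where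
  src : X
  tgt : X
  iso : p.fiber src ≃ₗ[𝕜] p.fiber tgt
  adm : κ.Adm (𝕜 := 𝕜) (S := Unit) (V := fun _ => p.fiber src) (W := fun _ => p.fiber tgt)
    (fun _ => iso)

/-- The isomorphism which maps the frame `a` to the frame `b`. Two pairs of frames give the same
isomorphism iff they are in the same orbit of the diagonal right action of the structural group. -/
def arrOfFrames (κ : ModKind) (p : HilbertBundle 𝕜 X) (n : ℕ)
    (q : 𝐤 (p.Frame κ n × p.Frame κ n)) : p.Arr κ :=
  let q' := (CompactCoherentification.mk _).symm q
  { src := q'.1.pt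
    tgt := q'.2.pt
    iso := q'.1.basis.equiv q'.2.basis (Equiv.refl _)
    adm := κ.adm_equiv q'.1.isFrame q'.2.isFrame }

/-- The space of morphisms is the disjoint union over `n` of the quotients of the k-products
`Frame n × Frame n` by the diagonal action of the structural group. -/
instance (κ : ModKind) (p : HilbertBundle 𝕜 X) : TopologicalSpace (p.Arr κ) :=
  ⨆ n : ℕ, TopologicalSpace.coinduced (arrOfFrames κ p n) inferInstance

end HilbertBundle

namespace FibObj

variable {𝕜 : Type w} [RCLike 𝕜] {S T : Type}

/-- The morphisms of `φ-mod`, `φ-imod`, `φ-smod`: families of isomorphisms indexed by `S`. -/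
structure Arr (κ : ModKind) (φ : FibObj.{u} 𝕜 S) where
  src : φ.base
  tgt : φ.base
  iso : ∀ s, (φ.bundle s).fiber src ≃ₗ[𝕜] (φ.bundle s).fiber tgt
  adm : κ.Adm (𝕜 := 𝕜) iso

theorem Arr.ext_iso {κ : ModKind} {φ : FibObj.{u} 𝕜 S} {x y : φ.base}
    {f g : ∀ s, (φ.bundle s).fiber x ≃ₗ[𝕜] (φ.bundle s).fiber y} {hf : κ.Adm (𝕜 := 𝕜) f}
    {hg : κ.Adm (𝕜 := 𝕜) g} (h : ∀ s v, f s v = g s v) :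
    (⟨x, y, f, hf⟩ : φ.Arr κ) = ⟨x, y, g, hg⟩ := by
  obtain rfl : f = g := funext fun s => LinearEquiv.ext (h s)
  rfl

/-- The `s`-component of a morphism. -/
def Arr.component {κ : ModKind} {φ : FibObj.{u} 𝕜 S} (m : φ.Arr κ) (s : S) :
    (φ.bundle s).Arr κ where
  src := m.src
  tgt := m.tgt
  iso := m.iso s
  adm := by
    have h := m.adm
    cases κ with
    | mod => trivial
    | imod => exact fun _ v => h s v
    | smod => exact ⟨h.choose, h.choose_spec.1, fun _ v => h.choose_spec.2 s v⟩

/-- The space of morphisms is a subspace of the k-product of two copies of the base and of the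
spaces of morphisms of the categories associated to the bundles (a fibre product in k-spaces). -/
instance (κ : ModKind) (φ : FibObj.{u} 𝕜 S) : TopologicalSpace (φ.Arr κ) :=
  TopologicalSpace.induced
    (fun m => (CompactCoherentification.mk
      (φ.base × φ.base × ∀ s, (φ.bundle s).Arr κ) (m.src, m.tgt, m.component)))
    inferInstance

/-- Composition of morphisms: first `f`, then `g`. -/
def Arr.comp {κ : ModKind} {φ : FibObj.{u} 𝕜 S} :
    ∀ f g : φ.Arr κ, f.tgt = g.src → φ.Arr κ
  | ⟨x, _, f, hf⟩, ⟨_, z, g, hg⟩, rfl =>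
    { src := x
      tgt := z
      iso := fun s => (f s).trans (g s)
      adm := by
        cases κ with
        | mod => trivial
        | imod => exact fun s v => (hg s _).trans (hf s v)
        | smod =>
          obtain ⟨r, hr, hf⟩ := hf
          obtain ⟨r', hr', hg⟩ := hg
          refine ⟨r' * r, mul_pos hr' hr, fun s v => ?_⟩
          rw [LinearEquiv.trans_apply, hg, hf, mul_assoc] }

/-- The identity morphism of `x`. -/
def Arr.id (κ : ModKind) (φ : FibObj.{u} 𝕜 S) (x : φ.base) : φ.Arr κ where
  src := x
  tgt := x
  iso s := LinearEquiv.refl 𝕜 _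
  adm := by
    cases κ with
    | mod => trivial
    | imod => exact fun s v => rfl
    | smod => exact ⟨1, one_pos, fun s v => by simp⟩

/-- The categories `φ-mod`, `φ-imod` and `φ-smod`. -/
def cat (κ : ModKind) (φ : FibObj.{u} 𝕜 S) : TCat where
  Ob := φ.base
  Mor := φ.Arr κ
  src := Arr.src
  tgt := Arr.tgt
  id := Arr.id κ φ
  comp := Arr.comp
  src_id _ := rfl
  tgt_id _ := rfl
  src_comp := by rintro ⟨x, y, f, hf⟩ ⟨y', z, g, hg⟩ h; cases h; rfl
  tgt_comp := by rintro ⟨x, y, f, hf⟩ ⟨y', z, g, hg⟩ h; cases h; rfl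
  id_comp _ := rfl
  comp_id _ := rfl
  assoc := by
    rintro ⟨x, y, f, hf⟩ ⟨y', z, g, hg⟩ ⟨z', t, k, hk⟩ h₁ h₂
    cases h₁
    cases h₂
    rfl

/-- The map `φ-mod → ψ-mod` (resp. `imod`, `smod`) on morphisms induced by a morphism of `Γ-Fib`:
it maps `(φ_t)_t` to the family of the isomorphisms `a_s ∘ (⊕_{t ∈ γ(s)} φ_t) ∘ a_s⁻¹`. -/
def Hom.mapArr [Finite T] (κ : ModKind) {γ : GammaHom S T} {φ : FibObj.{u} 𝕜 T}
    {ψ : FibObj.{u} 𝕜 S} (a : Hom γ φ ψ) (m : φ.Arr κ) : ψ.Arr κ where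
  src := a.base m.src
  tgt := a.base m.tgt
  iso s := ((a.linEquiv s m.src).symm.trans
    (LinearEquiv.piCongrRight fun t : γ.toFun s => m.iso t)).trans (a.linEquiv s m.tgt)
  adm := by
    classical
    have := Fintype.ofFinite T
    have key : ∀ r : ℝ, 0 ≤ r → (∀ t v, ‖m.iso t v‖ = r * ‖v‖) → ∀ s v,
        ‖((a.linEquiv s m.src).symm.trans
          (LinearEquiv.piCongrRight fun t : γ.toFun s => m.iso t)).trans
            (a.linEquiv s m.tgt) v‖ = r * ‖v‖ := by
      intro r hr h s v
      obtain ⟨w, rfl⟩ := (a.linEquiv s m.src).surjective v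
      have h1 := a.isometry s m.src w
      have h2 := a.isometry s m.tgt (fun t => m.iso t (w t))
      simp only [h, mul_pow, finsum_eq_sum_of_fintype] at h1 h2
      rw [← Finset.mul_sum, ← h1, ← mul_pow] at h2
      have h3 := (pow_left_inj₀ (norm_nonneg _) (by positivity) two_ne_zero).1 h2
      simp only [LinearEquiv.trans_apply, LinearEquiv.symm_apply_apply]
      exact h3
    have hm := m.adm
    cases κ with
    | mod => trivial
    | imod =>
      intro s v
      have := key 1 zero_le_one (fun t v => by rw [one_mul]; exact hm t v) s v
      rwa [one_mul] at this
    | smod =>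
      obtain ⟨r, hr, h⟩ := hm
      exact ⟨r, hr, key r hr.le h⟩

/-- The functor `φ-mod → ψ-mod` (resp. `imod`, `smod`) induced by a morphism of `Γ-Fib`. -/
def Hom.functor [Finite T] (κ : ModKind) {γ : GammaHom S T} {φ : FibObj.{u} 𝕜 T}
    {ψ : FibObj.{u} 𝕜 S} (a : Hom γ φ ψ) : TCat.Fun (φ.cat κ) (ψ.cat κ) where
  ob := a.base
  mor := a.mapArr κ
  src_mor _ := rfl
  tgt_mor _ := rfl
  mor_id := fun (x : φ.base) => by
    refine Arr.ext_iso fun s v => ?_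
    exact (a.linEquiv s x).apply_symm_apply v
  mor_comp := by
    rintro ⟨x, y, f, hf⟩ ⟨y', z, g, hg⟩ h
    cases h
    refine Arr.ext_iso fun s v => ?_
    change a.linEquiv s z (fun t => g t (f t ((a.linEquiv s x).symm v t))) =
      a.linEquiv s z (fun t => g t ((a.linEquiv s y).symm
        (a.linEquiv s y (fun t => f t ((a.linEquiv s x).symm v t))) t))
    rw [LinearEquiv.symm_apply_apply]

end FibObj

/-! ### `Γ-G`-spaces -/

/-- A contravariant assignment on `Γ` with values in sets with a topology and a `G`-action. -/
structure GammaDiagram (G : Type v) [Group G] where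
  space : ∀ (S : Type) [Finite S], Type w
  top : ∀ (S : Type) [Finite S], TopologicalSpace (space S)
  act : ∀ (S : Type) [Finite S], MulAction G (space S)
  map : ∀ {S T : Type} [Finite S] [Finite T], GammaHom S T → space T → space S

attribute [instance] GammaDiagram.top GammaDiagram.act

section Equivariant

variable (G : Type v) [Group G]

/-- Two `G`-maps are equivariantly homotopic. -/
def EquivariantlyHomotopic {X : Type u} {Y : Type w} [TopologicalSpace X] [TopologicalSpace Y]
    [MulAction G X] [MulAction G Y] (f₀ f₁ : X → Y) : Prop :=
  ∃ H : X × unitInterval → Y, Continuous H ∧ (∀ (g : G) x t, H (g • x, t) = g • H (x, t)) ∧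
    (∀ x, H (x, 0) = f₀ x) ∧ ∀ x, H (x, 1) = f₁ x

/-- `f` is an equivariant homotopy equivalence. -/
def IsEquivariantHomotopyEquiv {X : Type u} {Y : Type w} [TopologicalSpace X] [TopologicalSpace Y]
    [MulAction G X] [MulAction G Y] (f : X → Y) : Prop :=
  Continuous f ∧ (∀ (g : G) x, f (g • x) = g • f x) ∧
    ∃ h : Y → X, Continuous h ∧ (∀ (g : G) y, h (g • y) = g • h y) ∧
      EquivariantlyHomotopic G (h ∘ f) _root_.id ∧ EquivariantlyHomotopic G (f ∘ h) _root_.id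

/-- `X` is equivariantly contractible: the map to a point is an equivariant homotopy
equivalence. -/
def IsEquivariantlyContractible (X : Type u) [TopologicalSpace X] [MulAction G X] : Prop :=
  ∃ x₀ : X, (∀ g : G, g • x₀ = x₀) ∧
    EquivariantlyHomotopic G (_root_.id : X → X) (fun _ => x₀)

/-- `X` is equivariantly well-pointed: it has a closed fixed point `x₀` for which the inclusion of
`{x₀}` has the equivariant homotopy extension property (it is a closed `G`-cofibration). -/
def IsEquivariantlyWellPointed [TopologicalSpace G] (X : Type u) [TopologicalSpace X]
    [MulAction G X] : Prop :=
  ∃ x₀ : X, IsClosed {x₀} ∧ (∀ g : G, g • x₀ = x₀) ∧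
    ∀ (Y : Type u) [TopologicalSpace Y] [MulAction G Y] [ContinuousSMul G Y] (f : X → Y)
      (h : unitInterval → Y), Continuous f → (∀ (g : G) x, f (g • x) = g • f x) →
      Continuous h → (∀ (g : G) t, g • h t = h t) → h 0 = f x₀ →
      ∃ H : X × unitInterval → Y, Continuous H ∧
        (∀ (g : G) x t, H (g • x, t) = g • H (x, t)) ∧
        (∀ x, H (x, 0) = f x) ∧ ∀ t, H (x₀, t) = h t

/-- The diagonal action on the k-ification of a product. -/
instance kifyAction (X : Type u) [MulAction G X] : MulAction G (𝐤 X) :=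
  inferInstanceAs (MulAction G X)

end Equivariant

namespace GammaDiagram

variable {G : Type v} [Group G]

/-- The Segal map `A(𝐧) → A(𝟏)ⁿ` (product in k-spaces) induced by the `n` morphisms `𝟏 → 𝐧` which
map `1` to `{i}`. -/
def segal (A : GammaDiagram.{v, w} G) (n : ℕ) (a : A.space (Fin n)) :
    𝐤 (Fin n → A.space (Fin 1)) :=
  CompactCoherentification.mk _ (fun i => A.map (GammaHom.point i) a)

/-- `A` is a `Γ-G`-space: a contravariant functor from `Γ` to the category of `G`-spaces that are
k-spaces, whose value at `𝟎` is equivariantly well-pointed and equivariantly contractible, and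
whose Segal maps are equivariant homotopy equivalences. -/
structure IsGammaGSpace [TopologicalSpace G] (A : GammaDiagram.{v, w} G) : Prop where
  isKSpace : ∀ (S : Type) [Finite S], IsKSpace (A.space S)
  continuous_smul : ∀ (S : Type) [Finite S], ContinuousSMul G (A.space S)
  continuous_map : ∀ {S T : Type} [Finite S] [Finite T] (γ : GammaHom S T), Continuous (A.map γ)
  map_smul : ∀ {S T : Type} [Finite S] [Finite T] (γ : GammaHom S T) (g : G) (a : A.space T),
    A.map γ (g • a) = g • A.map γ a
  map_id : ∀ (S : Type) [Finite S] (a : A.space S), A.map (GammaHom.id S) a = a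
  map_comp : ∀ {S T U : Type} [Finite S] [Finite T] [Finite U] (γ : GammaHom S T)
    (δ : GammaHom T U) (a : A.space U), A.map (γ.comp δ) a = A.map γ (A.map δ a)
  wellPointed_zero : IsEquivariantlyWellPointed G (A.space (Fin 0))
  contractible_zero : IsEquivariantlyContractible G (A.space (Fin 0))
  segal_equiv : ∀ n : ℕ, 1 ≤ n → IsEquivariantHomotopyEquiv G (A.segal n)

end GammaDiagram

/-- The assignment `S ↦ |Func(𝓔 G, φ(S)-mod)|` (resp. `imod`, `smod`). The three proofs say that
`𝓔 G` and `φ(S)-mod` are k-categories and that the functors `φ(γ)-mod` are continuous. -/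
def HilbertGammaBundle.vec {𝕜 : Type w} [RCLike 𝕜] (φ : HilbertGammaBundle.{u} 𝕜) (κ : ModKind)
    (G : Type v) [Group G] [TopologicalSpace G] [IsTopologicalGroup G]
    (hG : (TCat.perfect G).IsKCat) (hob : ∀ (S : Type) [Finite S], ((φ.obj S).cat κ).IsKCat)
    (hmap : ∀ {S T : Type} [Finite S] [Finite T] (γ : GammaHom S T),
      ((φ.map γ).functor κ).IsCont) : GammaDiagram G where
  space S _ := TCat.Realization (TCat.Func (TCat.perfect G) ((φ.obj S).cat κ) hG (hob S))
  top S _ := inferInstance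
  act S _ := TCat.realizationAction G ((φ.obj S).cat κ) hG (hob S)
  map {S T} _ _ γ := TCat.Realization.map
    (TCat.Func.postcomp hG (hob T) (hob S) ((φ.map γ).functor κ) (hmap γ))

end

/-!
The proof combines a study of thin realizations of k-categories with a study of the topologies on
spaces of isomorphisms between the fibres of Hilbert bundles.

*Realizations.* A point of `|A|` is a chain together with a point of a simplex. A point of a simplex
is a subdivision of `[0, 1)` into intervals, so a point of `|A|` may be regarded as a step functor
from the ordered set `[0, 1)` to `A`; it is determined by that functor
(`Realization.step_injective`), since two subdivisions have a common refinement
(`stdSimplex.exists_subdivision`). In this picture the properties of thin realization become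
accessible for arbitrary k-categories, without any cofibration condition. The time which the step
functor spends in an open set of morphisms is lower semicontinuous, and two disjoint open sets
cannot both be occupied for more than half of a given interval; hence `|A|` is Hausdorff
(`Realization.t2Space`), and it is compactly generated as a quotient of a disjoint union of
k-spaces. Step functors into a product are families of step functors, so `|∏ Eᵢ| → ∏ |Eᵢ|` is
bijective, and it is a homeomorphism for the product formed in k-spaces because common refinements
depend continuously on the subdivisions, on each set of a finite closed covering
(`Realization.continuous_prodMk`). Applied to the product with `{0 < 1}`, this turns continuous
natural transformations into homotopies (`Realization.exists_homotopy`). As a Lie group is locally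
compact, `Func(𝓔 G, D)` satisfies the exponential law (`FuncOb.continuous_iff`), so transformations
and continuous families of functors `D → D'` induce homotopies after application of
`|Func(𝓔 G, -)|`, and these are equivariant because `G` acts by precomposition
(`equivariantlyHomotopic_of_family`, `equivariantlyHomotopic_of_funcMor`).

*Bundles.* The topology on the morphisms of `φ-mod`, a quotient of a space of pairs of frames, is
made manageable by local orthonormal frames: a family of isomorphisms is continuous iff it maps
continuous sections to continuous sections (`FibObj.Arr.contSec`,
`FibObj.Arr.continuous_of_contSec`). This gives the k-categories (`FibObj.isKCat_cat`) and the
continuity of the functors induced by morphisms of `Γ-Fib` (`FibObj.Hom.functor_isCont`), whose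
fibrewise inverses are adjoints.

For the Segal map, the functors induced by the `n` morphisms `𝟏 → 𝐧` split an object of `φ(𝐧)` into
`n` objects of `φ(𝟏)`, and a morphism `n.φ(𝟏) → φ(𝐧)` joins `n` objects. All bundles involved being
identified by canonical unitary isomorphisms, the two composites are naturally isomorphic to the
identity functors for `mod` and `imod`. For `smod`, a family of `n` similarities has in general no
common ratio and cannot be joined. Therefore each similarity, of ratio `r`, is first multiplied by
`r⁻¹`; the functors which multiply by `r ^ (-t)`, for `t ∈ [0, 1]`, connect this operation to the
identity (`FibObj.scaleFun`). The composites are then related to the identity functors by this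
family followed by a unitary transformation (`FibObj.joinSplit`, `FibObj.splitJoin`), and
`TCat.isEquivariantHomotopyEquiv_of_funcMor` applies. At `𝟎`, all categories have exactly one
morphism, and the realization is a point.
-/

/-! ### Compactly coherent spaces -/

section KSpace

variable {X Y Z : Type*} [TopologicalSpace X] [TopologicalSpace Y] [TopologicalSpace Z]

theorem CompactlyCoherentSpace.continuous_of_continuousOn_isCompact [CompactlyCoherentSpace X]
    {f : X → Y} (h : ∀ K : Set X, IsCompact K → ContinuousOn f K) : Continuous f := by
  rw [CompactlyCoherentSpace.isCoherentWith.continuous_iff]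
  exact h

/-- The universal property of `𝐤 Y`: for maps from compactly coherent spaces, continuity into `𝐤 Y`
and into `Y` are the same. -/
theorem CompactlyCoherentSpace.continuous_toKify [CompactlyCoherentSpace X] {f : X → 𝐤 Y}
    (h : Continuous fun x => (CompactCoherentification.mk Y).symm (f x)) : Continuous f :=
  CompactlyCoherentSpace.continuous_of_continuousOn_isCompact fun _ hK =>
    (CompactCoherentification.continuousOn_rng_of_isCompact hK).2 h.continuousOn

/-- A space is compactly coherent as soon as every subset whose indicator is continuous on all
compact subsets is open. -/
theorem CompactlyCoherentSpace.of_continuous_prop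
    (h : ∀ f : X → Prop, (∀ K : Set X, IsCompact K → ContinuousOn f K) → Continuous f) :
    CompactlyCoherentSpace X := by
  refine .of_isOpen fun A hA => ?_
  have := h (fun x => x ∈ A) fun K hK => by
    rw [continuousOn_iff_continuous_domRestrict]
    exact continuous_Prop.2 (hA K hK)
  simpa using continuous_Prop.1 this

theorem CompactlyCoherentSpace.of_isQuotientMap [CompactlyCoherentSpace X] {q : X → Y}
    (hq : IsQuotientMap q) : CompactlyCoherentSpace Y := by
  refine .of_continuous_prop fun f hf => ?_
  rw [hq.continuous_iff]
  refine CompactlyCoherentSpace.continuous_of_continuousOn_isCompact fun K hK => ?_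
  exact (hf _ (hK.image hq.continuous)).comp hq.continuous.continuousOn (Set.mapsTo_image q K)

theorem CompactlyCoherentSpace.coinduced {Z : Type*} [CompactlyCoherentSpace X] (f : X → Z) :
    @CompactlyCoherentSpace Z (TopologicalSpace.coinduced f inferInstance) := by
  let _ : TopologicalSpace Z := TopologicalSpace.coinduced f inferInstance
  refine .of_continuous_prop fun g hg => ?_
  rw [continuous_coinduced_dom]
  refine CompactlyCoherentSpace.continuous_of_continuousOn_isCompact fun K hK => ?_
  exact (hg _ (hK.image continuous_coinduced_rng)).comp continuous_coinduced_rng.continuousOn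
    (Set.mapsTo_image f K)

/-- A supremum of topologies carries the final topology with respect to the identity maps, hence is
compactly coherent if all of them are. -/
theorem CompactlyCoherentSpace.iSup {Z : Type*} {ι : Sort*} {t : ι → TopologicalSpace Z}
    (h : ∀ i, @CompactlyCoherentSpace Z (t i)) : @CompactlyCoherentSpace Z (⨆ i, t i) := by
  let _ : TopologicalSpace Z := ⨆ i, t i
  refine .of_continuous_prop fun g hg => ?_
  rw [continuous_iSup_dom]
  intro i
  have hi : Continuous[t i, ⨆ i, t i] (id : Z → Z) := continuous_id_iff_le.2 (le_iSup t i)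
  refine @CompactlyCoherentSpace.continuous_of_continuousOn_isCompact Z Prop (t i) _ (h i) _
    fun K hK => ?_
  have hK' : IsCompact (id '' K) := @IsCompact.image Z Z (t i) _ K id hK hi
  exact @ContinuousOn.comp Z Z Prop (t i) _ _ id K g (id '' K) (hg _ hK')
    (@Continuous.continuousOn Z Z (t i) _ _ _ hi) (Set.mapsTo_image id K)

instance CompactlyCoherentSpace.sigma {ι : Type*} {E : ι → Type*} [∀ i, TopologicalSpace (E i)]
    [∀ i, CompactlyCoherentSpace (E i)] : CompactlyCoherentSpace (Σ i, E i) :=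
  CompactlyCoherentSpace.iSup fun i => CompactlyCoherentSpace.coinduced (Sigma.mk i)

theorem Topology.IsClosedEmbedding.compactlyCoherentSpace [CompactlyCoherentSpace Y] {f : X → Y}
    (hf : IsClosedEmbedding f) : CompactlyCoherentSpace X := by
  refine .of_isClosed fun A hA => ?_
  rw [hf.isClosed_iff_image_isClosed, CompactlyCoherentSpace.isClosed_iff]
  intro K hK
  have h1 := (hf.restrictPreimage K).isClosedMap _ (hA _ (hf.isCompact_preimage hK))
  convert h1
  ext ⟨y, hy⟩
  simp only [Set.mem_preimage, Set.mem_image]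
  constructor
  · rintro ⟨x, hx, rfl⟩
    exact ⟨⟨x, hy⟩, hx, rfl⟩
  · rintro ⟨x, hx, h⟩
    exact ⟨x, hx, congrArg Subtype.val h⟩

theorem IsClosed.compactlyCoherentSpace [CompactlyCoherentSpace X] {A : Set X} (hA : IsClosed A) :
    CompactlyCoherentSpace A :=
  hA.isClosedEmbedding_subtypeVal.compactlyCoherentSpace

/-- Open subspaces need the Hausdorff condition: a compact set, being locally compact, contains
small compact neighbourhoods of its points, which lie in the open subspace. -/
theorem IsOpen.compactlyCoherentSpace [CompactlyCoherentSpace X] [T2Space X] {W : Set X}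
    (hW : IsOpen W) : CompactlyCoherentSpace W := by
  refine .of_isOpen fun A hA => ?_
  rw [hW.isOpenEmbedding_subtypeVal.isOpen_iff_image_isOpen, CompactlyCoherentSpace.isOpen_iff]
  intro L hL
  have : CompactSpace L := isCompact_iff_compactSpace.1 hL
  rw [isOpen_iff_mem_nhds]
  rintro ⟨x, hxL⟩ ⟨⟨x', hxW⟩, hxA, rfl⟩
  -- a compact neighbourhood of `x` in `L` contained in `W`
  have hWL : (Subtype.val ⁻¹' W : Set L) ∈ 𝓝 (⟨x', hxL⟩ : L) :=
    (hW.preimage continuous_subtype_val).mem_nhds hxW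
  obtain ⟨K, hK, hKW, hKc⟩ := local_compact_nhds hWL
  have hK1 : IsCompact (Subtype.val '' K : Set X) := hKc.image continuous_subtype_val
  have hKsub : Subtype.val '' K ⊆ W := by rintro _ ⟨y, hy, rfl⟩; exact hKW hy
  have hK2 : IsCompact (Subtype.val ⁻¹' (Subtype.val '' K) : Set W) := by
    rw [Subtype.isCompact_iff, Subtype.image_preimage_coe, Set.inter_eq_right.2 hKsub]
    exact hK1
  obtain ⟨O, hO, hOA⟩ := isOpen_induced_iff.1 (hA _ hK2)
  obtain ⟨O', hO', rfl⟩ := isOpen_induced_iff.1 hO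
  have hxO : x' ∈ O' := by
    have : (⟨⟨x', hxW⟩, ⟨_, mem_of_mem_nhds hK, rfl⟩⟩ :
        (Subtype.val ⁻¹' (Subtype.val '' K) : Set W)) ∈ Subtype.val ⁻¹' A := hxA
    rw [← hOA] at this
    exact this
  filter_upwards [hK, (hO'.preimage continuous_subtype_val).mem_nhds
    (show (⟨x', hxL⟩ : L) ∈ Subtype.val ⁻¹' O' from hxO)] with y hyK hyO
  have : (⟨⟨y.1, hKW hyK⟩, ⟨_, hyK, rfl⟩⟩ :
      (Subtype.val ⁻¹' (Subtype.val '' K) : Set W)) ∈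
      (Subtype.val ⁻¹' (Subtype.val ⁻¹' O') : Set (Subtype.val ⁻¹' (Subtype.val '' K) : Set W)) :=
    hyO
  rw [hOA] at this
  exact ⟨_, this, rfl⟩

/-- The product of a compactly coherent space and a locally compact space is compactly coherent:
by currying, a map on it which is continuous on the compact subsets is continuous. -/
instance CompactlyCoherentSpace.prod [CompactlyCoherentSpace X] [LocallyCompactSpace Y] :
    CompactlyCoherentSpace (X × Y) := by
  refine .of_continuous_prop fun f hf => ?_
  have hcont : ∀ L : Set X, IsCompact L → Continuous (fun p : L × Y => f (p.1.1, p.2)) := by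
    intro L hL
    have : CompactSpace L := isCompact_iff_compactSpace.1 hL
    refine CompactlyCoherentSpace.continuous_of_continuousOn_isCompact fun K hK => ?_
    have hi : Continuous (fun p : L × Y => (p.1.1, p.2)) := by fun_prop
    exact (hf _ (hK.image hi)).comp hi.continuousOn (Set.mapsTo_image _ K)
  have hslice : ∀ x, Continuous (fun y => f (x, y)) := fun x => by
    exact (hcont {x} isCompact_singleton).comp
      (Continuous.prodMk_right (⟨x, rfl⟩ : ({x} : Set X)))
  let g : X → C(Y, Prop) := fun x => ⟨fun y => f (x, y), hslice x⟩
  have hg : Continuous g := by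
    refine CompactlyCoherentSpace.continuous_of_continuousOn_isCompact fun L hL => ?_
    rw [continuousOn_iff_continuous_domRestrict]
    exact ContinuousMap.continuous_of_continuous_uncurry _ (hcont L hL)
  exact ContinuousMap.continuous_uncurry_of_continuous ⟨g, hg⟩

theorem CompactlyCoherentSpace.continuous_of_forall_compact_prod [CompactlyCoherentSpace X]
    [LocallyCompactSpace Y] {f : X × Y → Z}
    (h : ∀ L : Set X, IsCompact L → Continuous (fun p : L × Y => f (p.1.1, p.2))) :
    Continuous f := by
  refine CompactlyCoherentSpace.continuous_of_continuousOn_isCompact fun K hK => ?_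
  have h1 := hK.image continuous_fst
  have h2 : Continuous (fun p : K => ((⟨p.1.1, p.1, p.2, rfl⟩ : (Prod.fst '' K)), p.1.2)) := by
    fun_prop
  rw [continuousOn_iff_continuous_domRestrict]
  exact (h _ h1).comp h2

theorem IsKSpace.of_isClosedEmbedding (hY : IsKSpace Y) {f : X → Y} (hf : IsClosedEmbedding f) :
    IsKSpace X := by
  have := hY.t2
  have := hY.coherent
  exact ⟨hf.isEmbedding.t2Space, hf.compactlyCoherentSpace⟩

theorem isKSpace_kify [T2Space X] : IsKSpace (𝐤 X) :=
  ⟨inferInstance, inferInstance⟩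

/-- A Hausdorff CW-complex is compactly generated, since its closed cells are compact. -/
theorem IsLocallyCountableCW.isKSpace {X : Type u} [TopologicalSpace X]
    (h : IsLocallyCountableCW X) : IsKSpace X := by
  obtain ⟨_, cw, -⟩ := h
  refine ⟨‹_›, .of_isClosed fun A hA => ?_⟩
  refine CWComplex.closed' (C := (Set.univ : Set X)) A (Set.subset_univ A) fun n j => ?_
  have hc : IsCompact
      (Topology.CWComplex.map (C := (Set.univ : Set X)) n j '' Metric.closedBall 0 1) :=
    (isCompact_closedBall _ _).image_of_continuousOn (CWComplex.continuousOn n j)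
  have := (hA _ hc)
  have h2 := hc.isClosed.isClosedEmbedding_subtypeVal.isClosedMap _ this
  rwa [Subtype.image_preimage_coe, Set.inter_comm] at h2

end KSpace

namespace TCat

/-! ### Functors between k-categories -/

section Functors

variable {C D D' A B : TCat}

theorem Fun.ob_eq (F : Fun C D) (x : C.Ob) : F.ob x = D.src (F.mor (C.id x)) := by
  rw [F.src_mor, C.src_id]

theorem Fun.ext_mor {F H : Fun C D} (h : F.mor = H.mor) : F = H :=
  Fun.ext (funext fun x => by rw [F.ob_eq, H.ob_eq, h]) h

/-- A map on morphisms which is the morphism part of a functor. The functor is then unique, as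
objects are determined by their identities. -/
def IsFunctorial (f : C.Mor → D.Mor) : Prop := ∃ F : Fun C D, F.mor = f

/-- Functoriality as a family of equations between values of the map, which define closed conditions
if the values are taken in a k-category. -/
theorem isFunctorial_iff {f : C.Mor → D.Mor} :
    IsFunctorial f ↔ (∀ m, D.src (f m) = D.src (f (C.id (C.src m)))) ∧
      (∀ m, D.tgt (f m) = D.src (f (C.id (C.tgt m)))) ∧
      (∀ x, f (C.id x) = D.id (D.src (f (C.id x)))) ∧
      ∀ m m' (h : C.tgt m = C.src m'), ∃ h' : D.tgt (f m) = D.src (f m'),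
        D.comp (f m) (f m') h' = f (C.comp m m' h) := by
  constructor
  · rintro ⟨F, rfl⟩
    refine ⟨fun m => ?_, fun m => ?_, fun x => ?_, fun m m' h => ?_⟩
    · rw [← F.ob_eq, F.src_mor]
    · rw [← F.ob_eq, F.tgt_mor]
    · rw [← F.ob_eq, F.mor_id]
    · exact ⟨by rw [F.tgt_mor, F.src_mor, h], (F.mor_comp m m' h).symm⟩
  · rintro ⟨h1, h2, h3, h4⟩
    exact ⟨⟨fun x => D.src (f (C.id x)), f, h1, h2, h3, fun m m' h => (h4 m m' h).choose_spec.symm⟩,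
      rfl⟩

variable {X : Type*} [TopologicalSpace X] [CompactlyCoherentSpace X]

/-- Commutation of a square is a closed condition: on the closed subset where both composites make
sense they are continuous, as this subset is compactly coherent. -/
theorem IsKCat.isClosed_comp_eq_comp (hD : D.IsKCat) {a b c d : X → D.Mor} (ha : Continuous a)
    (hb : Continuous b) (hc : Continuous c) (hd : Continuous d) :
    IsClosed {x | ∃ (h : D.tgt (a x) = D.src (b x)) (h' : D.tgt (c x) = D.src (d x)),
      D.comp (a x) (b x) h = D.comp (c x) (d x) h'} := by
  have := hD.ob.t2
  have := hD.mor.t2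
  let S : Set X := {x | D.tgt (a x) = D.src (b x) ∧ D.tgt (c x) = D.src (d x)}
  have hS : IsClosed S :=
    (isClosed_eq (hD.continuous_tgt.comp ha) (hD.continuous_src.comp hb)).inter
      (isClosed_eq (hD.continuous_tgt.comp hc) (hD.continuous_src.comp hd))
  have := hS.compactlyCoherentSpace
  have h1 : Continuous (fun x : S => D.comp (a x) (b x) x.2.1) :=
    hD.continuous_comp_of (ha.comp continuous_subtype_val) (hb.comp continuous_subtype_val) _
  have h2 : Continuous (fun x : S => D.comp (c x) (d x) x.2.2) :=
    hD.continuous_comp_of (hc.comp continuous_subtype_val) (hd.comp continuous_subtype_val) _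
  convert hS.isClosedEmbedding_subtypeVal.isClosedMap _ (isClosed_eq h1 h2)
  ext x
  constructor
  · rintro ⟨h, h', e⟩
    exact ⟨⟨x, h, h'⟩, e, rfl⟩
  · rintro ⟨x, e, rfl⟩
    exact ⟨x.2.1, x.2.2, e⟩

theorem IsKCat.isClosed_isFunctorial (hD : D.IsKCat) {f : X → C.Mor → D.Mor}
    (hf : ∀ m, Continuous fun x => f x m) : IsClosed {x | IsFunctorial (f x)} := by
  have := hD.ob.t2
  have := hD.mor.t2
  simp only [isFunctorial_iff, Set.ofPred_and, Set.ofPred_forall]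
  refine ((isClosed_iInter fun m => ?_).inter ((isClosed_iInter fun m => ?_).inter
    ((isClosed_iInter fun x => ?_).inter (isClosed_iInter fun m => isClosed_iInter fun m' =>
      isClosed_iInter fun h => ?_))))
  · exact isClosed_eq (hD.continuous_src.comp (hf _)) (hD.continuous_src.comp (hf _))
  · exact isClosed_eq (hD.continuous_tgt.comp (hf _)) (hD.continuous_src.comp (hf _))
  · exact isClosed_eq (hf _) (hD.continuous_id.comp (hD.continuous_src.comp (hf _)))
  · have h1 := hD.isClosed_comp_eq_comp (hf m) (hf m')
      (hD.continuous_id.comp (hD.continuous_src.comp (hf (C.comp m m' h)))) (hf (C.comp m m' h))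
    convert h1 using 3 with x
    simp only [Function.comp_apply, D.id_comp]
    constructor
    · rintro ⟨h, e⟩; exact ⟨h, D.tgt_id _, e⟩
    · rintro ⟨h, _, e⟩; exact ⟨h, e⟩

/-! ### The topologies of the spaces of functors and of transformations -/

theorem FuncOb.ext_mor {F H : FuncOb C D} (h : F.toFun.mor = H.toFun.mor) : F = H :=
  FuncOb.ext (Fun.ext_mor h)

/-- The exponential law. Local compactness of `C.Mor` makes evaluation continuous on the
compact-open topology, and k-ification does not affect maps from compactly coherent spaces. -/
theorem FuncOb.continuous_iff [LocallyCompactSpace C.Mor] {f : X → FuncOb C D} :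
    Continuous f ↔ Continuous fun p : X × C.Mor => (f p.1).toFun.mor p.2 := by
  constructor
  · intro hf
    have h1 : Continuous (fun x => (⟨(f x).toFun.mor, (f x).cont.mor⟩ : C(C.Mor, D.Mor))) :=
      CompactCoherentification.continuous_mk_symm.comp (continuous_induced_dom.comp hf)
    exact ContinuousMap.continuous_uncurry_of_continuous ⟨_, h1⟩
  · intro hf
    refine continuous_induced_rng.2 (CompactlyCoherentSpace.continuous_toKify ?_)
    exact ContinuousMap.continuous_of_continuous_uncurry
      (fun x => (⟨(f x).toFun.mor, (f x).cont.mor⟩ : C(C.Mor, D.Mor))) hf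

theorem FuncMor.continuous_iff [LocallyCompactSpace C.Ob] {f : X → FuncMor C D} :
    Continuous f ↔ Continuous (fun x => (f x).dom) ∧ Continuous (fun x => (f x).cod) ∧
      Continuous fun p : X × C.Ob => (f p.1).app p.2 := by
  constructor
  · intro hf
    have h0 := CompactCoherentification.continuous_mk_symm.comp (continuous_induced_dom.comp hf)
    have h1 : Continuous (fun x => (⟨(f x).app, (f x).cont⟩ : C(C.Ob, D.Mor))) :=
      CompactCoherentification.continuous_mk_symm.comp
        (continuous_snd.comp (continuous_snd.comp h0))
    exact ⟨continuous_fst.comp h0, continuous_fst.comp (continuous_snd.comp h0),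
      ContinuousMap.continuous_uncurry_of_continuous ⟨_, h1⟩⟩
  · rintro ⟨h1, h2, h3⟩
    refine continuous_induced_rng.2 (CompactlyCoherentSpace.continuous_toKify ?_)
    refine h1.prodMk (h2.prodMk (CompactlyCoherentSpace.continuous_toKify ?_))
    exact ContinuousMap.continuous_of_continuous_uncurry
      (fun x => (⟨(f x).app, (f x).cont⟩ : C(C.Ob, D.Mor))) h3

/-- Functoriality is a closed condition on a continuous map `C.Mor → D.Mor`. -/
theorem FuncOb.isClosedEmbedding (hD : D.IsKCat) (hC : C.IsKCat) :
    IsClosedEmbedding (fun F : FuncOb C D =>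
      CompactCoherentification.mk C(C.Mor, D.Mor) ⟨F.toFun.mor, F.cont.mor⟩) := by
  have hr : ∀ m, Continuous (fun f : 𝐤 C(C.Mor, D.Mor) =>
      (CompactCoherentification.mk C(C.Mor, D.Mor)).symm f m) := fun m =>
    (continuous_eval_const m).comp CompactCoherentification.continuous_mk_symm
  refine ⟨⟨⟨rfl⟩, fun F H h => ?_⟩, ?_⟩
  · exact FuncOb.ext_mor (congrArg (fun f : C(C.Mor, D.Mor) => (f : C.Mor → D.Mor)) h)
  · convert hD.isClosed_isFunctorial hr
    ext f
    constructor
    · rintro ⟨F, rfl⟩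
      exact ⟨F.toFun, rfl⟩
    · rintro ⟨F, hF⟩
      have hmor : Continuous F.mor := by
        rw [hF]
        exact ((CompactCoherentification.mk C(C.Mor, D.Mor)).symm f).continuous
      refine ⟨⟨F, ?_, hmor⟩, ?_⟩
      · rw [show F.ob = fun x => D.src (F.mor (C.id x)) from funext F.ob_eq]
        exact hD.continuous_src.comp (hmor.comp hC.continuous_id)
      · exact ContinuousMap.ext fun m => congrFun hF m

theorem FuncOb.isKSpace (hC : C.IsKCat) (hD : D.IsKCat) : IsKSpace (FuncOb C D) := by
  have := hD.mor.t2
  exact isKSpace_kify.of_isClosedEmbedding (FuncOb.isClosedEmbedding hD hC)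

theorem FuncOb.continuous_mor (m : C.Mor) :
    Continuous (fun F : FuncOb C D => F.toFun.mor m) := by
  have h : Continuous (fun F : FuncOb C D =>
      CompactCoherentification.mk C(C.Mor, D.Mor) ⟨F.toFun.mor, F.cont.mor⟩) :=
    continuous_induced_dom
  exact (continuous_eval_const m).comp (CompactCoherentification.continuous_mk_symm.comp h)

theorem FuncOb.continuous_ob (hD : D.IsKCat) (x : C.Ob) :
    Continuous (fun F : FuncOb C D => F.toFun.ob x) := by
  simp only [Fun.ob_eq]
  exact hD.continuous_src.comp (FuncOb.continuous_mor _)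

/-- Source, target and naturality of a transformation are closed conditions. -/
theorem FuncMor.isClosedEmbedding (hD : D.IsKCat) :
    IsClosedEmbedding (fun a : FuncMor C D =>
      CompactCoherentification.mk (FuncOb C D × FuncOb C D × 𝐤 C(C.Ob, D.Mor))
        (a.dom, a.cod, CompactCoherentification.mk C(C.Ob, D.Mor) ⟨a.app, a.cont⟩)) := by
  have := hD.ob.t2
  let Y := FuncOb C D × FuncOb C D × 𝐤 C(C.Ob, D.Mor)
  let ev : 𝐤 Y → C.Ob → D.Mor := fun q x => (CompactCoherentification.mk C(C.Ob, D.Mor)).symm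
    ((CompactCoherentification.mk Y).symm q).2.2 x
  let d : 𝐤 Y → FuncOb C D := fun q => ((CompactCoherentification.mk Y).symm q).1
  let c : 𝐤 Y → FuncOb C D := fun q => ((CompactCoherentification.mk Y).symm q).2.1
  have hd : Continuous d := continuous_fst.comp CompactCoherentification.continuous_mk_symm
  have hc : Continuous c :=
    (continuous_fst.comp continuous_snd).comp CompactCoherentification.continuous_mk_symm
  have hev : ∀ x, Continuous (fun q => ev q x) := fun x =>
    (continuous_eval_const x).comp (CompactCoherentification.continuous_mk_symm.comp
      ((continuous_snd.comp continuous_snd).comp CompactCoherentification.continuous_mk_symm))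
  refine ⟨⟨⟨rfl⟩, fun a b h => ?_⟩, ?_⟩
  · refine FuncMor.ext (congrArg d h) (congrArg c h) (congrArg ev h)
  · have hcl : IsClosed ((⋂ x, {q | D.src (ev q x) = (d q).toFun.ob x}) ∩
        ((⋂ x, {q | D.tgt (ev q x) = (c q).toFun.ob x}) ∩
        ⋂ f : C.Mor, {q | ∃ (h : D.tgt ((d q).toFun.mor f) = D.src (ev q (C.tgt f)))
          (h' : D.tgt (ev q (C.src f)) = D.src ((c q).toFun.mor f)),
          D.comp ((d q).toFun.mor f) (ev q (C.tgt f)) h =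
            D.comp (ev q (C.src f)) ((c q).toFun.mor f) h'})) := by
      refine (isClosed_iInter fun x => ?_).inter ((isClosed_iInter fun x => ?_).inter
        (isClosed_iInter fun f => ?_))
      · exact isClosed_eq (hD.continuous_src.comp (hev x)) ((FuncOb.continuous_ob hD x).comp hd)
      · exact isClosed_eq (hD.continuous_tgt.comp (hev x)) ((FuncOb.continuous_ob hD x).comp hc)
      · exact hD.isClosed_comp_eq_comp ((FuncOb.continuous_mor f).comp hd) (hev _) (hev _)
          ((FuncOb.continuous_mor f).comp hc)
    convert hcl
    ext q
    constructor
    · rintro ⟨a, rfl⟩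
      refine ⟨Set.mem_iInter.2 a.src_app, Set.mem_iInter.2 a.tgt_app, Set.mem_iInter.2 fun f => ?_⟩
      exact ⟨_, _, a.natural f⟩
    · rintro ⟨h1, h2, h3⟩
      refine ⟨⟨d q, c q, ev q, ?_, Set.mem_iInter.1 h1, Set.mem_iInter.1 h2, fun f => ?_⟩, rfl⟩
      · exact ((CompactCoherentification.mk C(C.Ob, D.Mor)).symm _).continuous
      · exact (Set.mem_iInter.1 h3 f).choose_spec.choose_spec

theorem FuncMor.isKSpace (hC : C.IsKCat) (hD : D.IsKCat) : IsKSpace (FuncMor C D) := by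
  have := hD.mor.t2
  have := (FuncOb.isKSpace hC hD).t2
  exact isKSpace_kify.of_isClosedEmbedding (FuncMor.isClosedEmbedding hD)

/-- `Func(C, D)` is a k-category, if `C` is locally compact: by the exponential law, its structural
maps are continuous because those of `D` are. -/
theorem Func.isKCat [LocallyCompactSpace C.Mor] [LocallyCompactSpace C.Ob] (hC : C.IsKCat)
    (hD : D.IsKCat) : (Func C D hC hD).IsKCat := by
  have hO := FuncOb.isKSpace hC hD
  have hM := FuncMor.isKSpace hC hD
  have : CompactlyCoherentSpace (Func C D hC hD).Ob := hO.coherent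
  have : CompactlyCoherentSpace (Func C D hC hD).Mor := hM.coherent
  have := hO.coherent
  have := hM.coherent
  have hid := FuncMor.continuous_iff.1 (continuous_id (X := FuncMor C D))
  refine ⟨hO, hM, hid.1, hid.2.1, ?_, ?_⟩
  · refine FuncMor.continuous_iff.2 ⟨continuous_id, continuous_id, ?_⟩
    have h1 := FuncOb.continuous_iff.1 (continuous_id (X := FuncOb C D))
    have h2 : Continuous (fun p : FuncOb C D × C.Ob => p.1.toFun.ob p.2) := by
      simp only [Fun.ob_eq]
      exact hD.continuous_src.comp (h1.comp (continuous_fst.prodMk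
        (hC.continuous_id.comp continuous_snd)))
    exact hD.continuous_id.comp h2
  · let Y := {p : FuncMor C D × FuncMor C D // p.1.cod = p.2.dom}
    have hs : Continuous (CompactCoherentification.mk Y).symm :=
      CompactCoherentification.continuous_mk_symm
    have h1 : Continuous (fun p : 𝐤 Y => ((CompactCoherentification.mk Y).symm p).1.1) :=
      continuous_fst.comp (continuous_subtype_val.comp hs)
    have h2 : Continuous (fun p : 𝐤 Y => ((CompactCoherentification.mk Y).symm p).1.2) :=
      continuous_snd.comp (continuous_subtype_val.comp hs)
    have h1' := FuncMor.continuous_iff.1 h1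
    have h2' := FuncMor.continuous_iff.1 h2
    refine FuncMor.continuous_iff.2 ⟨h1'.1, h2'.2.1, ?_⟩
    exact hD.continuous_comp_of h1'.2.2 h2'.2.2 _

theorem Func.postcomp_isCont [LocallyCompactSpace C.Mor] [LocallyCompactSpace C.Ob]
    (hC : C.IsKCat) (hD : D.IsKCat) (hD' : D'.IsKCat) (H : Fun D D') (hH : H.IsCont) :
    (Func.postcomp hC hD hD' H hH).IsCont := by
  have := (FuncOb.isKSpace hC hD).coherent
  have := (FuncMor.isKSpace hC hD).coherent
  have : CompactlyCoherentSpace (Func C D hC hD).Ob := (FuncOb.isKSpace hC hD).coherent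
  have : CompactlyCoherentSpace (Func C D hC hD).Mor := (FuncMor.isKSpace hC hD).coherent
  have h1 : Continuous (Func.postcomp hC hD hD' H hH).ob := by
    refine FuncOb.continuous_iff.2 ?_
    exact hH.mor.comp (FuncOb.continuous_iff.1 continuous_id)
  have hid := FuncMor.continuous_iff.1 (continuous_id (X := FuncMor C D))
  exact ⟨h1, FuncMor.continuous_iff.2 ⟨h1.comp hid.1, h1.comp hid.2.1, hH.mor.comp hid.2.2⟩⟩

/-! ### The nerve -/

theorem Nerve.continuous_iff {m : ℕ} {f : X → Nerve A m} :
    Continuous f ↔ ∀ p, Continuous fun x => Fun.mor (f x) p := by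
  constructor
  · intro hf p
    exact (continuous_apply p).comp (CompactCoherentification.continuous_mk_symm.comp
      (continuous_induced_dom.comp hf))
  · intro hf
    exact continuous_induced_rng.2 (CompactlyCoherentSpace.continuous_toKify
      (continuous_pi hf))

theorem Nerve.continuous_mor {m : ℕ} (p : (ordinal m).Mor) :
    Continuous fun c : Nerve A m => Fun.mor c p :=
  (continuous_apply p).comp (CompactCoherentification.continuous_mk_symm.comp
    continuous_induced_dom)

/-- The nerve is a closed subspace of a finite k-product of copies of `A.Mor`. -/
theorem Nerve.isKSpace (hA : A.IsKCat) (m : ℕ) : IsKSpace (Nerve A m) := by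
  have := hA.mor.t2
  refine (isKSpace_kify (X := (ordinal m).Mor → A.Mor)).of_isClosedEmbedding
    (f := fun c : Fun (ordinal m) A => (CompactCoherentification.mk _ c.mor))
    ⟨⟨⟨rfl⟩, fun F H h => Fun.ext_mor h⟩, ?_⟩
  have hp : ∀ p, Continuous (fun f : 𝐤 ((ordinal m).Mor → A.Mor) =>
      (CompactCoherentification.mk _).symm f p) := fun p =>
    (continuous_apply p).comp CompactCoherentification.continuous_mk_symm
  exact hA.isClosed_isFunctorial hp

/-! ### Products of categories -/

/-- The product of a family of topologized categories, formed in k-spaces. -/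
noncomputable def pi {ι : Type w} (E : ι → TCat.{u, v}) : TCat.{max w u, max w v} where
  Ob := 𝐤 (∀ i, (E i).Ob)
  Mor := 𝐤 (∀ i, (E i).Mor)
  src f := CompactCoherentification.mk (∀ i, (E i).Ob) fun i =>
    (E i).src ((CompactCoherentification.mk (∀ i, (E i).Mor)).symm f i)
  tgt f := CompactCoherentification.mk (∀ i, (E i).Ob) fun i =>
    (E i).tgt ((CompactCoherentification.mk (∀ i, (E i).Mor)).symm f i)
  id x := CompactCoherentification.mk (∀ i, (E i).Mor) fun i =>
    (E i).id ((CompactCoherentification.mk (∀ i, (E i).Ob)).symm x i)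
  comp f g h := CompactCoherentification.mk (∀ i, (E i).Mor) fun i =>
    (E i).comp ((CompactCoherentification.mk (∀ i, (E i).Mor)).symm f i)
      ((CompactCoherentification.mk (∀ i, (E i).Mor)).symm g i) (congrFun h i)
  src_id _ := funext fun i => (E i).src_id _
  tgt_id _ := funext fun i => (E i).tgt_id _
  src_comp _ _ _ := funext fun i => (E i).src_comp _ _ _
  tgt_comp _ _ _ := funext fun i => (E i).tgt_comp _ _ _
  id_comp _ := funext fun i => (E i).id_comp _
  comp_id _ := funext fun i => (E i).comp_id _
  assoc _ _ _ _ _ := funext fun i => (E i).assoc _ _ _ _ _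

section Pi

variable {ι : Type w} {E : ι → TCat.{u, v}}

/-- The projections of a product of categories. -/
noncomputable def piProj (E : ι → TCat.{u, v}) (i : ι) : Fun (pi E) (E i) where
  ob x := (CompactCoherentification.mk (∀ i, (E i).Ob)).symm x i
  mor f := (CompactCoherentification.mk (∀ i, (E i).Mor)).symm f i
  src_mor _ := rfl
  tgt_mor _ := rfl
  mor_id _ := rfl
  mor_comp _ _ _ := rfl

theorem pi_mor_ext {x y : (pi E).Mor} (h : ∀ i, (piProj E i).mor x = (piProj E i).mor y) : x = y :=
  funext h

theorem piProj_isCont (i : ι) : (piProj E i).IsCont :=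
  ⟨(continuous_apply i).comp (CompactCoherentification.continuous_mk_symm (X := ∀ i, (E i).Ob)),
    (continuous_apply i).comp (CompactCoherentification.continuous_mk_symm (X := ∀ i, (E i).Mor))⟩

theorem continuous_pi_ob {f : X → (pi E).Ob} (hf : ∀ i, Continuous fun x => (piProj E i).ob (f x)) :
    Continuous f :=
  CompactlyCoherentSpace.continuous_toKify (Y := ∀ i, (E i).Ob) (continuous_pi hf)

theorem continuous_pi_mor {f : X → (pi E).Mor}
    (hf : ∀ i, Continuous fun x => (piProj E i).mor (f x)) : Continuous f :=
  CompactlyCoherentSpace.continuous_toKify (Y := ∀ i, (E i).Mor) (continuous_pi hf)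

instance : CompactlyCoherentSpace (pi E).Ob :=
  CompactCoherentification.instCompactlyCoherentSpace (X := ∀ i, (E i).Ob)

instance : CompactlyCoherentSpace (pi E).Mor :=
  CompactCoherentification.instCompactlyCoherentSpace (X := ∀ i, (E i).Mor)

theorem pi_isKCat (hE : ∀ i, (E i).IsKCat) : (pi E).IsKCat := by
  have := fun i => (hE i).ob.t2
  have := fun i => (hE i).mor.t2
  refine ⟨isKSpace_kify (X := ∀ i, (E i).Ob), isKSpace_kify (X := ∀ i, (E i).Mor), ?_, ?_, ?_, ?_⟩
  · exact continuous_pi_ob fun i => (hE i).continuous_src.comp (piProj_isCont i).mor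
  · exact continuous_pi_ob fun i => (hE i).continuous_tgt.comp (piProj_isCont i).mor
  · exact continuous_pi_mor fun i => (hE i).continuous_id.comp (piProj_isCont i).ob
  · refine continuous_pi_mor fun i => ?_
    have hs := continuous_subtype_val.comp (CompactCoherentification.continuous_mk_symm
      (X := {p : (pi E).Mor × (pi E).Mor // (pi E).tgt p.1 = (pi E).src p.2}))
    exact (hE i).continuous_comp_of ((piProj_isCont i).mor.comp (continuous_fst.comp hs))
      ((piProj_isCont i).mor.comp (continuous_snd.comp hs)) fun p =>
        congrFun ((CompactCoherentification.mk _).symm p).2 i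

/-- The functor into a product with given components. -/
noncomputable def piLift (F : ∀ i, Fun A (E i)) : Fun A (pi E) where
  ob x := CompactCoherentification.mk (∀ i, (E i).Ob) fun i => (F i).ob x
  mor f := CompactCoherentification.mk (∀ i, (E i).Mor) fun i => (F i).mor f
  src_mor _ := funext fun i => (F i).src_mor _
  tgt_mor _ := funext fun i => (F i).tgt_mor _
  mor_id _ := funext fun i => (F i).mor_id _
  mor_comp _ _ _ := funext fun i => (F i).mor_comp _ _ _

theorem piLift_isCont (hA : A.IsKCat) {F : ∀ i, Fun A (E i)} (hF : ∀ i, (F i).IsCont) :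
    (piLift F).IsCont := by
  have := hA.ob.coherent
  have := hA.mor.coherent
  exact ⟨continuous_pi_ob fun i => (hF i).ob, continuous_pi_mor fun i => (hF i).mor⟩

/-- The functor `∏ᵢ Func(C, Eᵢ) → Func(C, ∏ᵢ Eᵢ)`. -/
noncomputable def funcPi (hC : C.IsKCat) (hE : ∀ i, (E i).IsKCat) :
    Fun (pi fun i => Func C (E i) hC (hE i)) (Func C (pi E) hC (pi_isKCat hE)) where
  ob F := ⟨piLift fun i => ((piProj _ i).ob F : FuncOb C (E i)).toFun,
    piLift_isCont hC fun i => ((piProj _ i).ob F : FuncOb C (E i)).cont⟩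
  mor a :=
    { dom := ⟨piLift fun i => ((piProj _ i).mor a : FuncMor C (E i)).dom.toFun,
        piLift_isCont hC fun i => ((piProj _ i).mor a : FuncMor C (E i)).dom.cont⟩
      cod := ⟨piLift fun i => ((piProj _ i).mor a : FuncMor C (E i)).cod.toFun,
        piLift_isCont hC fun i => ((piProj _ i).mor a : FuncMor C (E i)).cod.cont⟩
      app := fun x => CompactCoherentification.mk (∀ i, (E i).Mor) fun i =>
        ((piProj _ i).mor a : FuncMor C (E i)).app x
      cont := by
        have := hC.ob.coherent
        exact continuous_pi_mor fun i => ((piProj _ i).mor a : FuncMor C (E i)).cont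
      src_app := fun x => funext fun i => ((piProj _ i).mor a : FuncMor C (E i)).src_app x
      tgt_app := fun x => funext fun i => ((piProj _ i).mor a : FuncMor C (E i)).tgt_app x
      natural := fun f => funext fun i => ((piProj _ i).mor a : FuncMor C (E i)).natural f }
  src_mor _ := rfl
  tgt_mor _ := rfl
  mor_id _ := rfl
  mor_comp _ _ _ := rfl

theorem funcPi_isCont [LocallyCompactSpace C.Mor] [LocallyCompactSpace C.Ob] (hC : C.IsKCat)
    (hE : ∀ i, (E i).IsKCat) : (funcPi hC hE).IsCont := by
  have hob : Continuous (funcPi hC hE).ob := by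
    refine FuncOb.continuous_iff.2 (continuous_pi_mor fun i => ?_)
    exact FuncOb.continuous_iff.1 (piProj_isCont (E := fun i => Func C (E i) hC (hE i)) i).ob
  have h := fun i => FuncMor.continuous_iff.1
    (piProj_isCont (E := fun i => Func C (E i) hC (hE i)) i).mor
  refine ⟨hob, FuncMor.continuous_iff.2
    ⟨hob.comp (continuous_pi_ob (E := fun i => Func C (E i) hC (hE i)) fun i => (h i).1),
    hob.comp (continuous_pi_ob (E := fun i => Func C (E i) hC (hE i)) fun i => (h i).2.1),
    continuous_pi_mor fun i => (h i).2.2⟩⟩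

end Pi

/-! ### Natural transformations of functors on functor categories -/

/-- A continuous transformation between functors `D → D'` induces one between the functors
`Func(C, D) → Func(C, D')`. -/
def FuncMor.whisker [LocallyCompactSpace C.Mor] [LocallyCompactSpace C.Ob] (hC : C.IsKCat)
    (hD : D.IsKCat) (hD' : D'.IsKCat) (a : FuncMor D D') :
    FuncMor (Func C D hC hD) (Func C D' hC hD') where
  dom := ⟨Func.postcomp hC hD hD' a.dom.toFun a.dom.cont, Func.postcomp_isCont hC hD hD' _ _⟩
  cod := ⟨Func.postcomp hC hD hD' a.cod.toFun a.cod.cont, Func.postcomp_isCont hC hD hD' _ _⟩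
  app F :=
    { dom := ⟨Fun.comp (FuncOb.toFun F) a.dom.toFun, (FuncOb.cont F).comp a.dom.cont⟩
      cod := ⟨Fun.comp (FuncOb.toFun F) a.cod.toFun, (FuncOb.cont F).comp a.cod.cont⟩
      app := a.app ∘ (FuncOb.toFun F).ob
      cont := a.cont.comp (FuncOb.cont F).ob
      src_app := fun _ => a.src_app _
      tgt_app := fun _ => a.tgt_app _
      natural := fun f => by
        have := a.natural ((FuncOb.toFun F).mor f)
        rw [D'.comp_congr rfl (congrArg a.app ((FuncOb.toFun F).tgt_mor f)),
          D'.comp_congr (congrArg a.app ((FuncOb.toFun F).src_mor f)) rfl] at this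
        exact this }
  cont := by
    have : CompactlyCoherentSpace (Func C D hC hD).Ob := (FuncOb.isKSpace hC hD).coherent
    have hO := FuncOb.continuous_iff.1 (continuous_id (X := (Func C D hC hD).Ob))
    refine FuncMor.continuous_iff.2 ⟨(Func.postcomp_isCont hC hD hD' _ a.dom.cont).ob,
      (Func.postcomp_isCont hC hD hD' _ a.cod.cont).ob, a.cont.comp ?_⟩
    simp only [Fun.ob_eq]
    exact hD.continuous_src.comp (hO.comp (continuous_fst.prodMk
      (hC.continuous_id.comp continuous_snd)))
  src_app _ := rfl
  tgt_app _ := rfl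
  natural (f : FuncMor C D) := by
    refine FuncMor.ext rfl rfl (funext fun x => ?_)
    have := a.natural (f.app x)
    rw [D'.comp_congr rfl (congrArg a.app (f.tgt_app x)),
      D'.comp_congr (congrArg a.app (f.src_app x)) rfl] at this
    exact this

end Functors
end TCat

/-! ### Simplices as subdivisions of the unit interval -/

namespace stdSimplex

/-- A lower set in `Fin m` is an initial segment, determined by its cardinality. -/
theorem lt_card_filter_iff {m : ℕ} {p : Fin m → Prop} [DecidablePred p]
    (hp : ∀ a b, a ≤ b → p b → p a) (a : Fin m) :
    (a : ℕ) < (Finset.univ.filter p).card ↔ p a := by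
  constructor
  · intro h
    by_contra hpa
    have : Finset.univ.filter p ⊆ Finset.Iio a := fun b hb => by
      rw [Finset.mem_Iio]
      by_contra hba
      exact hpa (hp a b (not_lt.1 hba) (Finset.mem_filter.1 hb).2)
    have := Finset.card_le_card this
    rw [Fin.card_Iio] at this
    omega
  · intro h
    have : Finset.Iic a ⊆ Finset.univ.filter p := fun b hb => by
      simpa using hp b a (Finset.mem_Iic.1 hb) h
    have := Finset.card_le_card this
    rw [Fin.card_Iic] at this
    omega

variable {m k : ℕ}

/-- The `a`-th inner division point of the subdivision of `[0, 1]` into consecutive intervals of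
lengths `t 0, …, t m`. -/
noncomputable def cut (t : stdSimplex ℝ (Fin (m + 1))) (a : Fin m) : ℝ :=
  ∑ b ∈ Finset.Iic a.castSucc, t b

theorem sum_Iic_mono (t : stdSimplex ℝ (Fin (m + 1))) {i j : Fin (m + 1)} (h : i ≤ j) :
    ∑ b ∈ Finset.Iic i, t b ≤ ∑ b ∈ Finset.Iic j, t b :=
  Finset.sum_le_sum_of_subset_of_nonneg (Finset.Iic_subset_Iic.2 h) fun _ _ _ => zero_le t _

theorem sum_Iic_last (t : stdSimplex ℝ (Fin (m + 1))) : ∑ b ∈ Finset.Iic (Fin.last m), t b = 1 := by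
  rw [← sum_eq_one t]
  congr 1
  ext b
  simp [Fin.le_last]

theorem sum_Iic_nonneg (t : stdSimplex ℝ (Fin (m + 1))) (i : Fin (m + 1)) :
    0 ≤ ∑ b ∈ Finset.Iic i, t b :=
  Finset.sum_nonneg fun _ _ => zero_le t _

theorem sum_Iic_le_one (t : stdSimplex ℝ (Fin (m + 1))) (i : Fin (m + 1)) :
    ∑ b ∈ Finset.Iic i, t b ≤ 1 :=
  (sum_Iic_mono t (Fin.le_last i)).trans_eq (sum_Iic_last t)

theorem cut_mono (t : stdSimplex ℝ (Fin (m + 1))) {a b : Fin m} (h : a ≤ b) : cut t a ≤ cut t b :=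
  sum_Iic_mono t (Fin.castSucc_le_castSucc_iff.2 h)

open Classical in
/-- The index of the interval, in the subdivision of `[0, 1)` with lengths `t 0, …, t m`, in which
`u` lies. The intervals are closed on the left. -/
noncomputable def pos (t : stdSimplex ℝ (Fin (m + 1))) (u : ℝ) : Fin (m + 1) :=
  ⟨(Finset.univ.filter fun a => cut t a ≤ u).card,
    Nat.lt_succ_of_le ((Finset.card_le_univ _).trans_eq (Fintype.card_fin m))⟩

open Classical in
theorem pos_val (t : stdSimplex ℝ (Fin (m + 1))) (u : ℝ) :
    (pos t u : ℕ) = (Finset.univ.filter fun a => cut t a ≤ u).card :=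
  rfl

theorem castSucc_lt_pos_iff (t : stdSimplex ℝ (Fin (m + 1))) (u : ℝ) (a : Fin m) :
    a.castSucc < pos t u ↔ cut t a ≤ u := by
  classical
  exact lt_card_filter_iff (p := fun a => cut t a ≤ u)
    (fun a b hab hb => (cut_mono t hab).trans hb) a

theorem pos_le_iff (t : stdSimplex ℝ (Fin (m + 1))) {u : ℝ} (hu : u < 1) (i : Fin (m + 1)) :
    pos t u ≤ i ↔ u < ∑ b ∈ Finset.Iic i, t b := by
  induction i using Fin.lastCases with
  | last => simp [sum_Iic_last, hu, Fin.le_last]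
  | cast a =>
    rw [← not_lt, castSucc_lt_pos_iff, not_le]
    rfl

theorem pos_mono (t : stdSimplex ℝ (Fin (m + 1))) {u v : ℝ} (h : u ≤ v) : pos t u ≤ pos t v := by
  rw [Fin.le_def, pos_val, pos_val]
  refine Finset.card_le_card fun a ha => ?_
  rw [Finset.mem_filter] at ha ⊢
  exact ⟨ha.1, ha.2.trans h⟩

/-- Right continuity of the step function `pos t`. -/
theorem exists_pos_eq (t : stdSimplex ℝ (Fin (m + 1))) (u : ℝ) :
    ∃ ε > 0, ∀ u', u ≤ u' → u' < u + ε → pos t u' = pos t u := by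
  classical
  have h : ∀ᶠ u' in 𝓝[≥] u, ∀ a, (cut t a ≤ u' ↔ cut t a ≤ u) := by
    rw [Filter.eventually_all]
    intro a
    by_cases ha : cut t a ≤ u
    · filter_upwards [self_mem_nhdsWithin] with u' hu'
      exact ⟨fun _ => ha, fun _ => ha.trans hu'⟩
    · filter_upwards [nhdsWithin_le_nhds (Iio_mem_nhds (not_le.1 ha))] with u' hu'
      exact ⟨fun h => absurd hu' (not_lt.2 h), fun h => absurd h ha⟩
  obtain ⟨w, hw, hs⟩ := mem_nhdsGE_iff_exists_Ico_subset.1 h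
  refine ⟨w - u, sub_pos.2 hw, fun u' h1 h2 => ?_⟩
  have := hs ⟨h1, by linarith⟩
  refine Fin.ext ?_
  simp only [pos]
  congr 1
  ext a
  simp [this a]

theorem sum_Iic_map (α : Fin (m + 1) →o Fin (k + 1)) (t : stdSimplex ℝ (Fin (m + 1)))
    (j : Fin (k + 1)) :
    ∑ b ∈ Finset.Iic j, stdSimplex.map α t b =
      ∑ a ∈ Finset.univ.filter (fun a => α a ≤ j), t a := by
  classical
  simp only [map_coe, FunOnFinite.linearMap_apply_apply]
  rw [← Finset.sum_fiberwise_of_maps_to (s := Finset.univ.filter (fun a => α a ≤ j))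
    (t := Finset.Iic j) (g := α) (by simp)]
  refine Finset.sum_congr rfl fun b hb => Finset.sum_congr ?_ fun _ _ => rfl
  ext a
  simp only [Finset.mem_filter, Finset.mem_univ, true_and]
  exact ⟨fun h => ⟨h ▸ Finset.mem_Iic.1 hb, h⟩, fun h => h.2⟩

/-- The simplicial maps `α` merge or insert empty intervals and relabel the intervals by `α`, so
that the step function is composed with `α`. -/
theorem pos_map (α : Fin (m + 1) →o Fin (k + 1)) (t : stdSimplex ℝ (Fin (m + 1))) {u : ℝ}
    (h0 : 0 ≤ u) (h1 : u < 1) : pos (stdSimplex.map α t) u = α (pos t u) := by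
  classical
  refine eq_of_forall_ge_iff fun j => ?_
  rw [pos_le_iff _ h1, sum_Iic_map]
  by_cases hne : (Finset.univ.filter (fun a => α a ≤ j)).Nonempty
  · set i := (Finset.univ.filter (fun a => α a ≤ j)).max' hne
    have hi : α i ≤ j := (Finset.mem_filter.1 (Finset.max'_mem _ hne)).2
    have hiff : ∀ a, α a ≤ j ↔ a ≤ i := fun a =>
      ⟨fun h => Finset.le_max' _ _ (by simpa using h), fun h => (α.monotone h).trans hi⟩
    have : Finset.univ.filter (fun a => α a ≤ j) = Finset.Iic i := by
      ext a; simp [hiff]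
    rw [this, ← pos_le_iff _ h1, hiff]
  · have hn : ∀ a, ¬ α a ≤ j := fun a h => hne ⟨a, by simpa using h⟩
    rw [Finset.not_nonempty_iff_eq_empty.1 hne, Finset.sum_empty]
    exact ⟨fun h => absurd h (not_lt.2 h0), fun h => absurd h (hn _)⟩

/-- A point of a simplex is determined by its step function. -/
theorem ext_pos {t t' : stdSimplex ℝ (Fin (m + 1))}
    (h : ∀ u : ℝ, 0 ≤ u → u < 1 → pos t u = pos t' u) : t = t' := by
  have key : ∀ t t' : stdSimplex ℝ (Fin (m + 1)), (∀ u : ℝ, 0 ≤ u → u < 1 → pos t u = pos t' u) →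
      ∀ i, ∑ b ∈ Finset.Iic i, t' b ≤ ∑ b ∈ Finset.Iic i, t b := by
    intro t t' h i
    by_contra hlt
    rw [not_le] at hlt
    have h1 := hlt.trans_le (sum_Iic_le_one t' i)
    have h2 := (pos_le_iff t' h1 i).2 hlt
    rw [← h _ (sum_Iic_nonneg t i) h1, pos_le_iff t h1] at h2
    exact lt_irrefl _ h2
  have hS : ∀ i, ∑ b ∈ Finset.Iic i, t b = ∑ b ∈ Finset.Iic i, t' b := fun i =>
    le_antisymm (key t' t (fun u h0 h1 => (h u h0 h1).symm) i) (key t t' h i)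
  have : ∀ i, t i = t' i := by
    intro i
    induction i using WellFoundedLT.induction with
    | ind i ih =>
      have := hS i
      rw [← Finset.Iio_insert, Finset.sum_insert (by simp), Finset.sum_insert (by simp),
        Finset.sum_congr rfl fun b hb => ih b (Finset.mem_Iio.1 hb)] at this
      exact add_right_cancel this
  exact stdSimplex.ext (funext this)

/-- The differences of the consecutive terms of `0, r 0, r 1, …, 1` telescope. -/
theorem sum_Iic_snoc_sub_cons (r : Fin k → ℝ) (i : Fin (k + 1)) :
    ∑ b ∈ Finset.Iic i, ((Fin.snoc r 1 : Fin (k + 1) → ℝ) b - (Fin.cons 0 r : Fin (k + 1) → ℝ) b) =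
      (Fin.snoc r 1 : Fin (k + 1) → ℝ) i := by
  induction i using Fin.induction with
  | zero =>
    have : Finset.Iic (0 : Fin (k + 1)) = {0} := by ext b; simp
    rw [this, Finset.sum_singleton, Fin.cons_zero, sub_zero]
  | succ i ih =>
    have : Finset.Iic i.succ = insert i.succ (Finset.Iic i.castSucc) := by
      ext b; simp [Fin.le_def, Fin.ext_iff]; omega
    rw [this, Finset.sum_insert (by simp [Fin.le_def]), ih, Fin.cons_succ, Fin.snoc_castSucc]
    ring

/-- The point of the simplex with division points `r 0 ≤ r 1 ≤ ⋯`. -/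
noncomputable def ofCuts (r : Fin k → ℝ) (hr : Monotone r) (h0 : ∀ a, 0 ≤ r a) (h1 : ∀ a, r a ≤ 1) :
    stdSimplex ℝ (Fin (k + 1)) :=
  ⟨fun j => (Fin.snoc r 1 : Fin (k + 1) → ℝ) j - (Fin.cons 0 r : Fin (k + 1) → ℝ) j, by
    constructor
    · intro j
      rw [sub_nonneg]
      induction j using Fin.cases with
      | zero =>
        rw [Fin.cons_zero]
        induction (0 : Fin (k + 1)) using Fin.lastCases with
        | last => simp
        | cast a => simpa using h0 a
      | succ a =>
        rw [Fin.cons_succ]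
        induction h : a.succ using Fin.lastCases with
        | last => simpa using h1 a
        | cast b =>
          rw [Fin.snoc_castSucc]
          refine hr ?_
          simp only [Fin.ext_iff, Fin.val_succ, Fin.val_castSucc] at h
          rw [Fin.le_def]
          omega
    · have := sum_Iic_snoc_sub_cons r (Fin.last k)
      rw [Fin.snoc_last] at this
      refine Eq.trans (Finset.sum_congr ?_ fun _ _ => rfl) this
      ext b
      simp [Fin.le_last]⟩

theorem cut_ofCuts (r : Fin k → ℝ) (hr : Monotone r) (h0 : ∀ a, 0 ≤ r a) (h1 : ∀ a, r a ≤ 1)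
    (a : Fin k) : cut (ofCuts r hr h0 h1) a = r a := by
  have := sum_Iic_snoc_sub_cons r a.castSucc
  rw [Fin.snoc_castSucc] at this
  exact this

theorem continuous_ofCuts {X : Type*} [TopologicalSpace X] {r : X → Fin k → ℝ} (hc : Continuous r)
    (hr : ∀ x, Monotone (r x)) (h0 : ∀ x a, 0 ≤ r x a) (h1 : ∀ x a, r x a ≤ 1) :
    Continuous fun x => ofCuts (r x) (hr x) (h0 x) (h1 x) := by
  refine Continuous.subtype_mk (continuous_pi fun j => ?_) _
  have hc' : ∀ a, Continuous fun x => r x a := fun a => (continuous_apply a).comp hc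
  refine Continuous.sub ?_ ?_
  · induction j using Fin.lastCases with
    | last => simpa using continuous_const
    | cast a => simpa only [Fin.snoc_castSucc, Fin.cons_succ] using hc' a
  · induction j using Fin.cases with
    | zero => simpa using continuous_const
    | succ a => simpa only [Fin.snoc_castSucc, Fin.cons_succ] using hc' a

theorem continuous_cut (a : Fin m) :
    Continuous fun t : stdSimplex ℝ (Fin (m + 1)) => cut t a :=
  continuous_finsetSum _ fun b _ => (continuous_apply b).comp continuous_subtype_val

/-- The label, on the `j`-th interval of a common subdivision, of one of several subdivisions with
`m i` division points. The division points of the common subdivision are enumerated by `π`. -/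
def label {ι : Type*} {m : ι → ℕ} (π : Fin k ≃ Σ i, Fin (m i)) (i : ι) :
    Fin (k + 1) →o Fin (m i + 1) where
  toFun j := ⟨(Finset.univ.filter fun a => (π.symm ⟨i, a⟩).castSucc < j).card,
    Nat.lt_succ_of_le ((Finset.card_le_univ _).trans_eq (Fintype.card_fin _))⟩
  monotone' _ _ h := Finset.card_le_card
    (Finset.monotone_filter_right _ fun _ _ ha => lt_of_lt_of_le ha h)

theorem label_val {ι : Type*} {m : ι → ℕ} (π : Fin k ≃ Σ i, Fin (m i)) (i : ι) (j : Fin (k + 1)) :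
    (label π i j : ℕ) = (Finset.univ.filter fun a => (π.symm ⟨i, a⟩).castSucc < j).card :=
  rfl

/-- Finitely many subdivisions of the unit interval have a common refinement, of fixed length, which
depends continuously on them on each set of a finite closed covering: the division points are
ordered in one of finitely many ways. -/
theorem exists_subdivision {ι : Type u} [Finite ι] (m : ι → ℕ) :
    ∃ (k : ℕ) (P : Type u) (_ : Finite P) (Z : P → Set (∀ i, stdSimplex ℝ (Fin (m i + 1))))
      (β : P → ∀ i, Fin (k + 1) →o Fin (m i + 1)) (τ : ∀ p, Z p → stdSimplex ℝ (Fin (k + 1))),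
      (∀ p, IsClosed (Z p)) ∧ (∀ t, ∃ p, t ∈ Z p) ∧ (∀ p, Continuous (τ p)) ∧
      ∀ p t i, stdSimplex.map (β p i) (τ p t) = t.1 i := by
  classical
  have := Fintype.ofFinite ι
  let c : (∀ i, stdSimplex ℝ (Fin (m i + 1))) → (Σ i, Fin (m i)) → ℝ := fun t l => cut (t l.1) l.2
  have hc : ∀ l, Continuous (fun t => c t l) := fun l =>
    (continuous_cut l.2).comp (continuous_apply l.1)
  let k := Fintype.card (Σ i, Fin (m i))
  let Z : (Fin k ≃ Σ i, Fin (m i)) → Set (∀ i, stdSimplex ℝ (Fin (m i + 1))) :=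
    fun π => {t | Monotone fun a => c t (π a)}
  refine ⟨k, Fin k ≃ Σ i, Fin (m i), inferInstance, Z, fun π i => label π i,
    fun π t => ofCuts (fun a => c t.1 (π a)) t.2 (fun a => sum_Iic_nonneg _ _)
      (fun a => sum_Iic_le_one _ _), ?_, ?_, ?_, ?_⟩
  · intro π
    simp only [Z, Monotone, Set.ofPred_forall]
    exact isClosed_iInter fun a => isClosed_iInter fun b => isClosed_iInter fun _ =>
      isClosed_le (hc _) (hc _)
  -- sorting the division points puts any given tuple of subdivisions in some `Z π`
  · intro t
    let e : Fin k ≃ Σ i, Fin (m i) := (Fintype.equivFin _).symm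
    exact ⟨(Tuple.sort (c t ∘ e)).trans e, Tuple.monotone_sort (c t ∘ e)⟩
  · intro π
    exact continuous_ofCuts (continuous_pi fun a => (hc _).comp continuous_subtype_val) _ _ _
  · rintro π ⟨t, ht⟩ i
    refine ext_pos fun u h0 h1 => ?_
    rw [pos_map _ _ h0 h1]
    refine Fin.ext ?_
    rw [label_val, pos_val]
    congr 1
    ext a
    simp only [Finset.mem_filter, Finset.mem_univ, true_and]
    rw [castSucc_lt_pos_iff]
    refine (iff_of_eq (congrArg (· ≤ u) (cut_ofCuts _ _ _ _ _))).trans ?_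
    simp [c]

/-- Every point of a simplex is the image of an interior point under a face map. -/
theorem exists_pos_face {k : ℕ} (t : stdSimplex ℝ (Fin (k + 1))) :
    ∃ (l : ℕ) (δ : Fin (l + 1) →o Fin (k + 1)) (t' : stdSimplex ℝ (Fin (l + 1))),
      (∀ j, 0 < t' j) ∧ stdSimplex.map δ t' = t := by
  classical
  let S : Finset (Fin (k + 1)) := Finset.univ.filter fun i => t i ≠ 0
  have hS : ∑ i ∈ S, t i = 1 := by
    rw [Finset.sum_filter_ne_zero, stdSimplex.sum_eq_one]
  have hne : S.card ≠ 0 := by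
    intro h
    rw [Finset.card_eq_zero.1 h] at hS
    simp at hS
  obtain ⟨l, hl⟩ := Nat.exists_eq_succ_of_ne_zero hne
  let e := S.orderEmbOfFin hl
  have himg : Finset.univ.map e.toEmbedding = S := by
    ext i
    have := Finset.range_orderEmbOfFin S hl
    simp only [Finset.mem_map, Finset.mem_univ, true_and]
    exact (Set.ext_iff.1 this i)
  refine ⟨l, e.toOrderHom, ⟨fun j => t (e j), fun j => stdSimplex.zero_le t _, ?_⟩, fun j => ?_, ?_⟩
  · rw [← hS, ← himg, Finset.sum_map]
    rfl
  · have : e j ∈ S := Finset.orderEmbOfFin_mem S hl j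
    exact lt_of_le_of_ne (stdSimplex.zero_le t _) (Finset.mem_filter.1 this).2.symm
  · refine stdSimplex.ext (funext fun i => ?_)
    rw [stdSimplex.map_coe, FunOnFinite.linearMap_apply_apply]
    change ∑ j ∈ Finset.univ.filter (fun j => e j = i), t (e j) = t i
    rw [Finset.sum_congr rfl (g := fun _ => t i) fun j hj => by rw [(Finset.mem_filter.1 hj).2]]
    by_cases hi : i ∈ S
    · have : i ∈ Finset.univ.map e.toEmbedding := himg ▸ hi
      obtain ⟨j, -, rfl⟩ := Finset.mem_map.1 this
      have : Finset.univ.filter (fun j' => e j' = e j) = {j} := by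
        ext j'; simp
      change ∑ j ∈ Finset.univ.filter (fun j' => e j' = e j), _ = _
      rw [this, Finset.sum_singleton]
    · have : t i = 0 := by simpa [S] using hi
      simp [this]

/-- If no interval is empty, the `i`-th one contains its left end point. -/
theorem pos_sum_Iio {k : ℕ} {t : stdSimplex ℝ (Fin (k + 1))} (ht : ∀ j, 0 < t j)
    (i : Fin (k + 1)) : stdSimplex.pos t (∑ b ∈ Finset.Iio i, t b) = i ∧
      ∑ b ∈ Finset.Iio i, t b < 1 := by
  have h0 : ∑ b ∈ Finset.Iio i, t b < ∑ b ∈ Finset.Iic i, t b := by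
    rw [← Finset.Iio_insert, Finset.sum_insert (by simp)]
    linarith [ht i]
  have h1 := h0.trans_le (sum_Iic_le_one t i)
  refine ⟨le_antisymm ((pos_le_iff t h1 i).2 h0) ?_, h1⟩
  by_contra h
  rw [not_le] at h
  have h2 := (pos_le_iff t h1 _).1 (le_refl (stdSimplex.pos t (∑ b ∈ Finset.Iio i, t b)))
  refine not_lt.2 ?_ h2
  refine Finset.sum_le_sum_of_subset_of_nonneg (fun b hb => ?_) fun _ _ _ => stdSimplex.zero_le t _
  exact Finset.mem_Iio.2 ((Finset.mem_Iic.1 hb).trans_lt h)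

end stdSimplex

namespace TCat

/-! ### Points of a realization as step functors -/

/-- The pairs `u ≤ v` of points of `[0, 1)`. -/
abbrev Triangle : Type := {p : ℝ × ℝ // 0 ≤ p.1 ∧ p.1 ≤ p.2 ∧ p.2 < 1}

namespace Realization

variable {A : TCat.{u, v}} {B : TCat}

/-- The class in `|A|` of a simplex of the nerve with a point of the standard simplex. -/
def mk {m : ℕ} (c : Nerve A m) (t : stdSimplex ℝ (Fin (m + 1))) : Realization A :=
  Quot.mk _ ⟨m, (c, t)⟩

theorem exists_mk (x : Realization A) :
    ∃ (m : ℕ) (c : Nerve A m) (t : stdSimplex ℝ (Fin (m + 1))), mk c t = x := by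
  obtain ⟨⟨m, c, t⟩, rfl⟩ := Quot.exists_rep x
  exact ⟨m, c, t, rfl⟩

theorem mk_comp {m k : ℕ} (α : Fin (m + 1) →o Fin (k + 1)) (c : Nerve A k)
    (t : stdSimplex ℝ (Fin (m + 1))) :
    mk (A := A) ((ordinalMap α).comp c) t = mk c (stdSimplex.map α t) :=
  Quot.sound (RealizationRel.glue α c t)

theorem continuous_mk (m : ℕ) :
    Continuous fun p : Nerve A m × stdSimplex ℝ (Fin (m + 1)) => mk p.1 p.2 :=
  continuous_quot_mk.comp (continuous_sigmaMk (σ := fun m =>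
    Nerve A m × stdSimplex ℝ (Fin (m + 1))))

/-- A point of `|A|`, represented by a chain and by a subdivision of `[0, 1)`, is regarded as a
functor from the ordered set `[0, 1)` to `A`, constant on the intervals of the subdivision. This is
the value of that functor on the morphism `u ≤ v`. -/
noncomputable def step (x : Realization A) (p : Triangle) : A.Mor :=
  Quot.lift (fun z : PreRealization A => Fun.mor z.2.1
    ⟨(stdSimplex.pos z.2.2 p.1.1, stdSimplex.pos z.2.2 p.1.2), stdSimplex.pos_mono _ p.2.2.1⟩) (by
    rintro _ _ ⟨α, c, t⟩
    have h1 := stdSimplex.pos_map α t p.2.1 (p.2.2.1.trans_lt p.2.2.2)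
    have h2 := stdSimplex.pos_map α t (p.2.1.trans p.2.2.1) p.2.2.2
    exact congrArg (Fun.mor c) (Subtype.ext (Prod.ext h1.symm h2.symm))) x

theorem step_mk {m : ℕ} (c : Nerve A m) (t : stdSimplex ℝ (Fin (m + 1))) (p : Triangle) :
    step (mk c t) p = Fun.mor c
      ⟨(stdSimplex.pos t p.1.1, stdSimplex.pos t p.1.2), stdSimplex.pos_mono _ p.2.2.1⟩ :=
  rfl

theorem step_mk_of {m : ℕ} (c : Nerve A m) {t : stdSimplex ℝ (Fin (m + 1))} {p : Triangle}
    {i j : Fin (m + 1)} (hi : stdSimplex.pos t p.1.1 = i) (hj : stdSimplex.pos t p.1.2 = j)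
    (h : i ≤ j) : step (mk c t) p = Fun.mor c ⟨(i, j), h⟩ := by
  subst hi hj
  rfl

theorem step_map (F : Fun A B) (x : Realization A) (p : Triangle) :
    step (map F x) p = F.mor (step x p) := by
  obtain ⟨m, c, t, rfl⟩ := exists_mk x
  rfl

/-- Over an interior point of a simplex, the step functor takes all values of the chain. -/
theorem eq_of_step_mk_eq {l : ℕ} {s : stdSimplex ℝ (Fin (l + 1))} (hs : ∀ j, 0 < s j)
    {c c' : Nerve A l} (h : step (mk c s) = step (mk c' s)) : c = c' := by
  refine Fun.ext_mor (funext ?_)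
  rintro ⟨⟨i, j⟩, hij⟩
  obtain ⟨hi, -⟩ := stdSimplex.pos_sum_Iio hs i
  obtain ⟨hj, hj1⟩ := stdSimplex.pos_sum_Iio hs j
  have h0 : 0 ≤ ∑ b ∈ Finset.Iio i, s b := Finset.sum_nonneg fun _ _ => stdSimplex.zero_le s _
  obtain ⟨u, hu⟩ : ∃ u, u = ∑ b ∈ Finset.Iio i, s b := ⟨_, rfl⟩
  obtain ⟨v, hv⟩ : ∃ v, v = ∑ b ∈ Finset.Iio j, s b := ⟨_, rfl⟩
  have huv : u ≤ v := by
    rw [hu, hv]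
    exact Finset.sum_le_sum_of_subset_of_nonneg (Finset.Iio_subset_Iio hij)
      fun _ _ _ => stdSimplex.zero_le s _
  rw [← hu] at hi h0
  rw [← hv] at hj hj1
  let p : Triangle := ⟨(u, v), h0, huv, hj1⟩
  have e1 : step (mk c s) p = _ := step_mk_of c (p := p) hi hj hij
  have e2 : step (mk c' s) p = _ := step_mk_of c' (p := p) hi hj hij
  exact e1.symm.trans ((congrFun h p).trans e2)

/-- A point of `|A|` is determined by its step functor: by subdivision, two points are represented
by chains of the same length and by the same interior point of a simplex. -/
theorem step_injective : Function.Injective (step (A := A)) := by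
  intro x y h
  obtain ⟨m, c, t, rfl⟩ := exists_mk x
  obtain ⟨m', c', t', rfl⟩ := exists_mk y
  obtain ⟨k, P, _, Z, β, τ, -, hZ, -, hβ⟩ :=
    stdSimplex.exists_subdivision (fun b : Bool => cond b m m')
  let T : ∀ b : Bool, stdSimplex ℝ (Fin (cond b m m' + 1)) := fun b =>
    match b with
    | true => t
    | false => t'
  obtain ⟨p, hp⟩ := hZ T
  obtain ⟨l, δ, s, hs, hδ⟩ := stdSimplex.exists_pos_face (τ p ⟨T, hp⟩)
  let β₁ : Fin (l + 1) →o Fin (m + 1) := (β p true).comp δ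
  let β₂ : Fin (l + 1) →o Fin (m' + 1) := (β p false).comp δ
  have h1 : stdSimplex.map β₁ s = t := by
    have := hβ p ⟨T, hp⟩ true
    rw [← hδ, stdSimplex.map_comp_apply] at this
    exact this
  have h2 : stdSimplex.map β₂ s = t' := by
    have := hβ p ⟨T, hp⟩ false
    rw [← hδ, stdSimplex.map_comp_apply] at this
    exact this
  rw [← h1, ← h2, ← mk_comp, ← mk_comp] at h ⊢
  rw [eq_of_step_mk_eq hs h]

/-! ### Realizations are k-spaces -/

/-- The set of the `u ∈ [u₀, u₁)` for which the step functor of `x` maps `u ≤ u + a` into `W`. -/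
def occupation (u₀ u₁ a : ℝ) (W : Set A.Mor) (x : Realization A) : Set ℝ :=
  {u | ∃ h : 0 ≤ u ∧ u ≤ u + a ∧ u + a < 1, u ∈ Set.Ico u₀ u₁ ∧ step x ⟨(u, u + a), h⟩ ∈ W}

theorem ordConnected_pos {m : ℕ} (t : stdSimplex ℝ (Fin (m + 1))) (a : ℝ) (i : Fin (m + 1)) :
    {u | stdSimplex.pos t (u + a) = i}.OrdConnected := by
  refine ⟨fun u hu v hv w hw => le_antisymm ?_ ?_⟩
  · exact (stdSimplex.pos_mono t (by linarith [hw.2])).trans_eq hv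
  · exact hu.symm.trans_le (stdSimplex.pos_mono t (by linarith [hw.1]))

theorem measurableSet_pos {m : ℕ} (t : stdSimplex ℝ (Fin (m + 1))) (u₀ u₁ a : ℝ)
    (T : Set (Fin (m + 1) × Fin (m + 1))) :
    MeasurableSet {u | u ∈ Set.Ico u₀ u₁ ∧ (stdSimplex.pos t u, stdSimplex.pos t (u + a)) ∈ T} := by
  have : {u | u ∈ Set.Ico u₀ u₁ ∧ (stdSimplex.pos t u, stdSimplex.pos t (u + a)) ∈ T} =
      Set.Ico u₀ u₁ ∩ ⋃ q ∈ T, {u | stdSimplex.pos t (u + 0) = q.1} ∩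
        {u | stdSimplex.pos t (u + a) = q.2} := by
    ext u
    simp
  rw [this]
  refine measurableSet_Ico.inter (MeasurableSet.biUnion T.to_countable fun q _ => ?_)
  exact (ordConnected_pos t 0 q.1).measurableSet.inter (ordConnected_pos t a q.2).measurableSet

theorem occupation_mk {m : ℕ} (c : Nerve A m) (t : stdSimplex ℝ (Fin (m + 1))) {u₀ u₁ a : ℝ}
    (h0 : 0 ≤ u₀) (ha : 0 ≤ a) (h1 : u₁ + a ≤ 1) (W : Set A.Mor) :
    occupation u₀ u₁ a W (mk c t) = {u | u ∈ Set.Ico u₀ u₁ ∧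
      (stdSimplex.pos t u, stdSimplex.pos t (u + a)) ∈
        {q : Fin (m + 1) × Fin (m + 1) | ∃ h : q.1 ≤ q.2, Fun.mor c ⟨q, h⟩ ∈ W}} := by
  ext u
  constructor
  · rintro ⟨h, hu, hW⟩
    exact ⟨hu, stdSimplex.pos_mono t h.2.1, hW⟩
  · rintro ⟨hu, h, hW⟩
    exact ⟨⟨h0.trans hu.1, by linarith, by linarith [hu.2]⟩, hu, hW⟩

/-- The label of `u` is locally constant in the subdivision, unless `u` is a division point. -/
theorem eventually_pos_eq {m : ℕ} (t₀ : stdSimplex ℝ (Fin (m + 1))) {u : ℝ}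
    (hu : ∀ a, stdSimplex.cut t₀ a ≠ u) :
    ∀ᶠ t in 𝓝 t₀, stdSimplex.pos t u = stdSimplex.pos t₀ u := by
  have h : ∀ᶠ t in 𝓝 t₀, ∀ a, (stdSimplex.cut t a ≤ u ↔ stdSimplex.cut t₀ a ≤ u) := by
    rw [Filter.eventually_all]
    intro a
    rcases lt_or_gt_of_ne (hu a) with h | h
    · filter_upwards [(stdSimplex.continuous_cut a).continuousAt.eventually_lt_const h] with t ht
      exact ⟨fun _ => h.le, fun _ => ht.le⟩
    · filter_upwards [(stdSimplex.continuous_cut a).continuousAt.eventually_const_lt h] with t ht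
      exact ⟨fun h' => absurd ht (not_lt.2 h'), fun h' => absurd h (not_lt.2 h')⟩
  filter_upwards [h] with t ht
  refine Fin.ext ?_
  rw [stdSimplex.pos_val, stdSimplex.pos_val]
  congr 1
  ext a
  simp [ht a]

/-- The measure of the set of times at which the step function and its translate have labels in `T`
depends continuously on the subdivision, by dominated convergence. -/
theorem tendsto_volume_pos {m : ℕ} (t₀ : stdSimplex ℝ (Fin (m + 1))) (u₀ u₁ a : ℝ)
    (T : Set (Fin (m + 1) × Fin (m + 1))) :
    Filter.Tendsto (fun t : stdSimplex ℝ (Fin (m + 1)) => MeasureTheory.volume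
      {u | u ∈ Set.Ico u₀ u₁ ∧ (stdSimplex.pos t u, stdSimplex.pos t (u + a)) ∈ T}) (𝓝 t₀)
      (𝓝 (MeasureTheory.volume
        {u | u ∈ Set.Ico u₀ u₁ ∧ (stdSimplex.pos t₀ u, stdSimplex.pos t₀ (u + a)) ∈ T})) := by
  refine MeasureTheory.tendsto_measure_of_ae_tendsto_indicator (𝓝 t₀) (measurableSet_pos _ _ _ _ _)
    (fun t => measurableSet_pos _ _ _ _ _) (measurableSet_Ico (a := u₀) (b := u₁)) (by simp)
    (Filter.Eventually.of_forall fun t u hu => hu.1) ?_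
  -- away from the division points of `t₀`, the step functions of nearby points agree
  have h1 : ∀ᵐ u : ℝ, ∀ b, stdSimplex.cut t₀ b ≠ u := by
    rw [MeasureTheory.ae_all_iff]
    intro b
    filter_upwards [MeasureTheory.Measure.ae_ne MeasureTheory.volume (stdSimplex.cut t₀ b)]
      with u hu using hu.symm
  have h2 : ∀ᵐ u : ℝ, ∀ b, stdSimplex.cut t₀ b ≠ u + a := by
    rw [MeasureTheory.ae_all_iff]
    intro b
    filter_upwards [MeasureTheory.Measure.ae_ne MeasureTheory.volume (stdSimplex.cut t₀ b - a)]
      with u hu h using hu (by linarith)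
  filter_upwards [h1, h2] with u hu hua
  filter_upwards [eventually_pos_eq t₀ hu, eventually_pos_eq t₀ hua] with t ht hta
  simp [ht, hta]

/-- The length of the occupation set of an open set is a lower semicontinuous function on `|A|`. -/
theorem isOpen_lt_occupation {u₀ u₁ a : ℝ} (h0 : 0 ≤ u₀) (ha : 0 ≤ a) (h1 : u₁ + a ≤ 1)
    {W : Set A.Mor} (hW : IsOpen W) (r : ENNReal) :
    IsOpen {x : Realization A | r < MeasureTheory.volume (occupation u₀ u₁ a W x)} := by
  refine isOpen_coinduced.2 (isOpen_sigma_iff.2 fun m => isOpen_iff_mem_nhds.2 ?_)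
  rintro ⟨c₀, t₀⟩ hr
  change r < MeasureTheory.volume (occupation u₀ u₁ a W (mk c₀ t₀)) at hr
  change {p : Nerve A m × stdSimplex ℝ (Fin (m + 1)) |
    r < MeasureTheory.volume (occupation u₀ u₁ a W (mk p.1 p.2))} ∈ _
  rw [occupation_mk _ _ h0 ha h1] at hr
  have hc : ∀ᶠ c : Nerve A m in 𝓝 c₀, ∀ q : (ordinal m).Mor,
      Fun.mor c₀ q ∈ W → Fun.mor c q ∈ W := by
    have : Finite (ordinal m).Mor :=
      inferInstanceAs (Finite {p : Fin (m + 1) × Fin (m + 1) // p.1 ≤ p.2})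
    rw [Filter.eventually_all]
    intro q
    by_cases hq : Fun.mor c₀ q ∈ W
    · filter_upwards [(Nerve.continuous_mor q).continuousAt.preimage_mem_nhds (hW.mem_nhds hq)]
        with c hc _ using hc
    · exact Filter.Eventually.of_forall fun c h => absurd h hq
  filter_upwards [prod_mem_nhds hc ((tendsto_volume_pos t₀ u₀ u₁ a _).eventually_const_lt hr)]
    with ⟨c, t⟩ ⟨hct, htr⟩
  refine htr.trans_le (MeasureTheory.measure_mono ?_)
  rw [occupation_mk _ _ h0 ha h1]
  rintro u ⟨hu, h, hq⟩
  exact ⟨hu, h, hct _ hq⟩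

/-- The realization is Hausdorff if the space of morphisms is: distinct step functors take distinct
values on a small interval, and disjoint open sets around these two values cannot both be occupied
more than half of the time. -/
theorem t2Space [T2Space A.Mor] : T2Space (Realization A) := by
  refine ⟨fun x y hxy => ?_⟩
  have hne : ∃ p, step x p ≠ step y p := by
    by_contra h
    push Not at h
    exact hxy (step_injective (funext h))
  obtain ⟨⟨⟨u, v⟩, h0, h1, h2⟩, hp⟩ := hne
  simp only at h0 h1 h2
  have hx : ∀ x : Realization A, ∃ ε > 0, ∀ u' (hu : 0 ≤ u' ∧ u' ≤ u' + (v - u) ∧ u' + (v - u) < 1),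
      u ≤ u' → u' < u + ε → step x ⟨(u', u' + (v - u)), hu⟩ = step x ⟨(u, v), h0, h1, h2⟩ := by
    intro x
    obtain ⟨m, c, t, rfl⟩ := exists_mk x
    obtain ⟨ε₁, hε₁, H₁⟩ := stdSimplex.exists_pos_eq t u
    obtain ⟨ε₂, hε₂, H₂⟩ := stdSimplex.exists_pos_eq t v
    refine ⟨min ε₁ ε₂, lt_min hε₁ hε₂, fun u' hu h3 h4 => ?_⟩
    have e1 := H₁ u' h3 (h4.trans_le (by gcongr; exact min_le_left _ _))
    have e2 := H₂ (u' + (v - u)) (by linarith) (by linarith [min_le_right ε₁ ε₂])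
    simp only [step_mk, e1, e2]
  obtain ⟨ε₁, hε₁, H₁⟩ := hx x
  obtain ⟨ε₂, hε₂, H₂⟩ := hx y
  obtain ⟨W, W', hW, hW', hxW, hyW, hd⟩ := t2_separation hp
  let ε := min (min ε₁ ε₂) (1 - v)
  have hε : 0 < ε := lt_min (lt_min hε₁ hε₂) (by linarith)
  have hε1 : ε ≤ ε₁ := (min_le_left _ _).trans (min_le_left _ _)
  have hε2 : ε ≤ ε₂ := (min_le_left _ _).trans (min_le_right _ _)
  have hε3 : u + ε + (v - u) ≤ 1 := by linarith [min_le_right (min ε₁ ε₂) (1 - v)]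
  have hvol : MeasureTheory.volume (Set.Ico u (u + ε)) = ENNReal.ofReal ε := by
    rw [Real.volume_Ico, add_sub_cancel_left]
  have hlt : ENNReal.ofReal (ε / 2) < ENNReal.ofReal ε :=
    (ENNReal.ofReal_lt_ofReal_iff hε).2 (by linarith)
  have ha : 0 ≤ v - u := by linarith
  refine ⟨_, _, isOpen_lt_occupation h0 ha hε3 hW (ENNReal.ofReal (ε / 2)),
    isOpen_lt_occupation h0 ha hε3 hW' (ENNReal.ofReal (ε / 2)), ?_, ?_, ?_⟩
  · refine hlt.trans_le (hvol.symm.trans_le (MeasureTheory.measure_mono fun u' hu => ?_))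
    have hu' : 0 ≤ u' ∧ u' ≤ u' + (v - u) ∧ u' + (v - u) < 1 :=
      ⟨h0.trans hu.1, by linarith, by linarith [hu.2]⟩
    refine ⟨hu', hu, ?_⟩
    rw [H₁ u' hu' hu.1 (by linarith [hu.2])]
    exact hxW
  · refine hlt.trans_le (hvol.symm.trans_le (MeasureTheory.measure_mono fun u' hu => ?_))
    have hu' : 0 ≤ u' ∧ u' ≤ u' + (v - u) ∧ u' + (v - u) < 1 :=
      ⟨h0.trans hu.1, by linarith, by linarith [hu.2]⟩
    refine ⟨hu', hu, ?_⟩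
    rw [H₂ u' hu' hu.1 (by linarith [hu.2])]
    exact hyW
  · rw [Set.disjoint_left]
    intro z hz hz'
    rw [Set.mem_ofPred_eq] at hz hz'
    obtain ⟨m, c, t, rfl⟩ := exists_mk z
    have hdis : Disjoint (occupation u (u + ε) (v - u) W (mk c t))
        (occupation u (u + ε) (v - u) W' (mk c t)) := by
      rw [Set.disjoint_left]
      rintro u' ⟨h, -, hw⟩ ⟨h', -, hw'⟩
      exact Set.disjoint_left.1 hd hw hw'
    have hm : MeasurableSet (occupation u (u + ε) (v - u) W' (mk c t)) := by
      rw [occupation_mk _ _ h0 ha hε3]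
      exact measurableSet_pos _ _ _ _ _
    have hle : MeasureTheory.volume (occupation u (u + ε) (v - u) W (mk c t) ∪
        occupation u (u + ε) (v - u) W' (mk c t)) ≤ ENNReal.ofReal ε := by
      rw [← hvol]
      refine MeasureTheory.measure_mono (Set.union_subset ?_ ?_) <;>
      · rintro u' ⟨-, hu, -⟩
        exact hu
    rw [MeasureTheory.measure_union hdis hm] at hle
    have := (ENNReal.add_lt_add hz hz').trans_le hle
    rw [← ENNReal.ofReal_add (by linarith) (by linarith), add_halves] at this
    exact lt_irrefl _ this

/-- A quotient of a disjoint union of k-spaces is compactly coherent; the Hausdorff property is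
`t2Space`. -/
theorem isKSpace (hA : A.IsKCat) : IsKSpace (Realization A) := by
  have := hA.mor.t2
  have := fun m => (Nerve.isKSpace hA m).coherent
  refine ⟨t2Space, ?_⟩
  exact CompactlyCoherentSpace.of_isQuotientMap (isQuotientMap_quot_mk (r := RealizationRel A))

/-! ### Continuity of maps defined on realizations -/

/-- The product of a quotient map with a locally compact space is a quotient map, so continuity on
`|A| × X` can be tested on simplices. -/
theorem continuous_prod_of_mk {X Y : Type*} [TopologicalSpace X] [TopologicalSpace Y]
    [LocallyCompactSpace X] {f : Realization A × X → Y}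
    (h : ∀ m, Continuous fun p : (Nerve A m × stdSimplex ℝ (Fin (m + 1))) × X =>
      f (mk p.1.1 p.1.2, p.2)) : Continuous f := by
  refine (isQuotientMap_quot_mk (r := RealizationRel A)).continuous_lift_prod_left ?_
  have h1 : Continuous (fun q : Σ m, (Nerve A m × stdSimplex ℝ (Fin (m + 1))) × X =>
      f (mk q.2.1.1 q.2.1.2, q.2.2)) := continuous_sigma h
  exact h1.comp Homeomorph.sigmaProdDistrib.continuous

/-- A continuous family of functors, parametrized by a locally compact space, induces a continuous
family of maps of realizations. -/
theorem continuous_map_family {X : Type*} [TopologicalSpace X] [LocallyCompactSpace X]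
    (hA : A.IsKCat) {F : X → Fun A B} (hF : Continuous fun p : X × A.Mor => (F p.1).mor p.2) :
    Continuous fun p : Realization A × X => map (F p.2) p.1 := by
  refine continuous_prod_of_mk fun m => ?_
  have := (Nerve.isKSpace hA m).coherent
  have h : Continuous (fun p : (Nerve A m × stdSimplex ℝ (Fin (m + 1))) × X =>
      ((show Nerve B m from Fun.comp p.1.1 (F p.2)), p.1.2)) := by
    refine Continuous.prodMk (Nerve.continuous_iff.2 fun q => ?_) (by fun_prop)
    exact hF.comp (continuous_snd.prodMk
      ((Nerve.continuous_mor q).comp (continuous_fst.comp continuous_fst)))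
  exact (continuous_mk m).comp h

theorem continuous_map (hA : A.IsKCat) {F : Fun A B} (hF : F.IsCont) : Continuous (map F) := by
  have := continuous_map_family (X := Unit) hA (F := fun _ => F) (hF.mor.comp continuous_snd)
  exact this.comp (Continuous.prodMk_left ())

end Realization

end TCat

namespace TCat.Realization

/-! ### Realizations and products -/

section Pi

variable {ι : Type} {E : ι → TCat.{u, v}}

/-- The map `|∏ᵢ Eᵢ| → ∏ᵢ |Eᵢ|` is injective, since a step functor into a product is determined by
its components. -/
theorem ext_piProj {y y' : Realization (pi E)}
    (h : ∀ i, map (piProj E i) y = map (piProj E i) y') : y = y' := by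
  refine step_injective (funext fun p => pi_mor_ext fun i => ?_)
  rw [← step_map, ← step_map, h]

variable [Finite ι]

/-- `|∏ᵢ Eᵢ| → ∏ᵢ |Eᵢ|` is surjective: points of the `|Eᵢ|` are represented by chains and a common
subdivision. -/
theorem exists_map_piProj_eq (x : ∀ i, Realization (E i)) :
    ∃ y : Realization (pi E), ∀ i, map (piProj E i) y = x i := by
  choose m c t hx using fun i => exists_mk (x i)
  obtain ⟨k, P, _, Z, β, τ, -, hZ, -, hβ⟩ := stdSimplex.exists_subdivision m
  obtain ⟨p, hp⟩ := hZ t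
  refine ⟨mk (A := pi E) (piLift fun i => (ordinalMap (β p i)).comp (c i)) (τ p ⟨t, hp⟩),
    fun i => ?_⟩
  exact (mk_comp (β p i) (c i) (τ p ⟨t, hp⟩)).trans
    ((congrArg (mk (c i)) (hβ p ⟨t, hp⟩ i)).trans (hx i))

/-- The inverse `∏ᵢ |Eᵢ| → |∏ᵢ Eᵢ|` of the map induced by the projections. -/
noncomputable def prodMk (x : ∀ i, Realization (E i)) : Realization (pi E) :=
  (exists_map_piProj_eq x).choose

theorem map_piProj_prodMk (x : ∀ i, Realization (E i)) (i : ι) :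
    map (piProj E i) (prodMk x) = x i :=
  (exists_map_piProj_eq x).choose_spec i

theorem step_prodMk (x : ∀ i, Realization (E i)) (p : Triangle) (i : ι) :
    (piProj E i).mor (step (prodMk x) p) = step (x i) p := by
  rw [← step_map, map_piProj_prodMk]

/-- If all components are given by continuous families of chains and of points of simplices, then
`prodMk` is given by such a family on each set of a finite closed covering. -/
theorem continuous_prodMk_of_mk {X : Type*} [TopologicalSpace X] [CompactlyCoherentSpace X]
    {m : ι → ℕ} {c : ∀ i, X → Nerve (E i) (m i)} {t : ∀ i, X → stdSimplex ℝ (Fin (m i + 1))}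
    (hc : ∀ i, Continuous (c i)) (ht : ∀ i, Continuous (t i)) :
    Continuous fun x => prodMk fun i => mk (c i x) (t i x) := by
  obtain ⟨k, P, _, Z, β, τ, hZc, hZ, hτ, hβ⟩ := stdSimplex.exists_subdivision m
  let T : X → ∀ i, stdSimplex ℝ (Fin (m i + 1)) := fun x i => t i x
  have hT : Continuous T := continuous_pi ht
  refine (locallyFinite_of_finite fun p => T ⁻¹' Z p).continuous ?_
    (fun p => (hZc p).preimage hT) fun p => ?_
  · exact Set.eq_univ_of_forall fun x => Set.mem_iUnion.2 (hZ (T x))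
  · have := ((hZc p).preimage hT).compactlyCoherentSpace
    rw [continuousOn_iff_continuous_domRestrict]
    let d : (T ⁻¹' Z p) → Nerve (pi E) k := fun x =>
      piLift fun i => (ordinalMap (β p i)).comp (c i x)
    have hd : Continuous d := by
      refine Nerve.continuous_iff.2 fun q => continuous_pi_mor fun i => ?_
      exact (Nerve.continuous_mor ((ordinalMap (β p i)).mor q)).comp
        ((hc i).comp continuous_subtype_val)
    have hs : Continuous (fun x : (T ⁻¹' Z p) => τ p ⟨T x, x.2⟩) :=
      (hτ p).comp ((hT.comp continuous_subtype_val).subtype_mk _)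
    refine ((continuous_mk k).comp (hd.prodMk hs)).congr fun x => ext_piProj fun i => ?_
    change mk ((ordinalMap (β p i)).comp (c i x)) (τ p ⟨T x, x.2⟩) =
      map (piProj E i) (prodMk fun i => mk (c i x) (t i x))
    rw [mk_comp, hβ, map_piProj_prodMk]

/-- Continuity of `prodMk` on compact spaces: one component after the other is lifted to the nerve,
using that the product of the quotient map onto `|Eⱼ|` with a locally compact space is a quotient
map. -/
theorem continuous_prodMk_of_compact (hE : ∀ i, (E i).IsKCat) (s : Finset ι) :
    ∀ (X : Type (max u v)) [TopologicalSpace X] [CompactSpace X] [T2Space X]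
      (f : ∀ i, X → Realization (E i)), (∀ i, Continuous (f i)) →
      (∀ i, i ∉ s → ∃ (m : ℕ) (c : X → Nerve (E i) m) (t : X → stdSimplex ℝ (Fin (m + 1))),
        Continuous c ∧ Continuous t ∧ ∀ x, f i x = mk (c x) (t x)) →
      Continuous fun x => prodMk fun i => f i x := by
  classical
  induction s using Finset.induction with
  | empty =>
    intro X _ _ _ f hf h
    choose m c t hc ht hft using fun i => h i (Finset.notMem_empty i)
    simp only [hft]
    exact continuous_prodMk_of_mk hc ht
  | insert j s hj ih =>
    intro X _ _ _ f hf h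
    have := fun m => (Nerve.isKSpace (hE j) m).coherent
    have := fun m => (Nerve.isKSpace (hE j) m).t2
    have key : Continuous fun p : Realization (E j) × X =>
        prodMk (Function.update (fun i => f i p.2) j p.1) := by
      refine continuous_prod_of_mk fun m => ?_
      refine CompactlyCoherentSpace.continuous_of_forall_compact_prod fun L hL => ?_
      have : CompactSpace L := isCompact_iff_compactSpace.1 hL
      refine ih (L × X) (fun i p => Function.update (fun i => f i p.2) j (mk p.1.1.1 p.1.1.2) i)
        (fun i => ?_) fun i hi => ?_
      · by_cases hij : i = j
        · subst hij
          simp only [Function.update_self]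
          exact (continuous_mk m).comp (continuous_subtype_val.comp continuous_fst)
        · simp only [Function.update_of_ne hij]
          exact (hf i).comp continuous_snd
      · by_cases hij : i = j
        · subst hij
          exact ⟨m, fun p => p.1.1.1, fun p => p.1.1.2, by fun_prop, by fun_prop,
            fun p => by simp only [Function.update_self]⟩
        · obtain ⟨m', c, t, hc, ht, hft⟩ := h i (by simp [hij, hi])
          exact ⟨m', fun p => c p.2, fun p => t p.2, hc.comp continuous_snd,
            ht.comp continuous_snd, fun p => by simp only [Function.update_of_ne hij, hft]⟩
    have := key.comp ((hf j).prodMk continuous_id)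
    refine this.congr fun x => ?_
    simp [Function.update_eq_self]

/-- The bijection `∏ᵢ |Eᵢ| → |∏ᵢ Eᵢ|` is continuous for the product formed in k-spaces. -/
theorem continuous_prodMk (hE : ∀ i, (E i).IsKCat) :
    Continuous fun x : 𝐤 (∀ i, Realization (E i)) =>
      prodMk ((CompactCoherentification.mk (∀ i, Realization (E i))).symm x) := by
  have := fun i => (isKSpace (hE i)).t2
  rw [CompactCoherentification.continuous_dom_iff]
  intro K hK
  have : CompactSpace K := isCompact_iff_compactSpace.1 hK
  rw [continuousOn_iff_continuous_domRestrict]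
  classical
  have := Fintype.ofFinite ι
  exact continuous_prodMk_of_compact hE Finset.univ K (fun i x => x.1 i)
    (fun i => (continuous_apply i).comp continuous_subtype_val)
    fun i hi => absurd (Finset.mem_univ i) hi

theorem continuous_prodMk_comp (hE : ∀ i, (E i).IsKCat) {X : Type*} [TopologicalSpace X]
    [CompactlyCoherentSpace X] {f : ∀ i, X → Realization (E i)} (hf : ∀ i, Continuous (f i)) :
    Continuous fun x => prodMk fun i => f i x :=
  (continuous_prodMk hE).comp (CompactlyCoherentSpace.continuous_toKify
    (f := fun x => CompactCoherentification.mk (∀ i, Realization (E i)) fun i => f i x)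
    (continuous_pi hf))

end Pi

end TCat.Realization

namespace TCat

/-! ### Homotopies induced by transformations -/

/-- The ordered set `{0 < 1}` as a discrete small category, in arbitrary universes. -/
def interval : TCat.{u, v} where
  Ob := ULift (Fin 2)
  Mor := ULift {p : Fin 2 × Fin 2 // p.1 ≤ p.2}
  topOb := ⊥
  topMor := ⊥
  src p := ⟨p.down.1.1⟩
  tgt p := ⟨p.down.1.2⟩
  id x := ⟨⟨(x.down, x.down), le_rfl⟩⟩
  comp f g h := ⟨⟨(f.down.1.1, g.down.1.2),
    f.down.2.trans ((congrArg ULift.down h).le.trans g.down.2)⟩⟩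
  src_id _ := rfl
  tgt_id _ := rfl
  src_comp _ _ _ := rfl
  tgt_comp _ _ _ := rfl
  id_comp _ := rfl
  comp_id _ := rfl
  assoc _ _ _ _ _ := rfl

instance : DiscreteTopology interval.{u, v}.Ob := ⟨rfl⟩

instance : DiscreteTopology interval.{u, v}.Mor := ⟨rfl⟩

theorem interval_isKCat : interval.{u, v}.IsKCat := by
  refine ⟨⟨inferInstance, inferInstance⟩, ⟨inferInstance, inferInstance⟩,
    continuous_of_discreteTopology, continuous_of_discreteTopology,
    continuous_of_discreteTopology, ?_⟩
  rw [CompactCoherentification.continuous_dom_iff]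
  exact fun K _ => continuous_of_discreteTopology.continuousOn

/-- The factors of the cylinder `A × {0 < 1}`, which is encoded as a product over `Bool` with the
factor `A` at `true`. -/
def cylinder (A : TCat.{u, v}) (b : Bool) : TCat.{u, v} := cond b A interval

theorem cylinder_isKCat {A : TCat.{u, v}} (hA : A.IsKCat) (b : Bool) : (cylinder A b).IsKCat := by
  cases b
  · exact interval_isKCat
  · exact hA

/-- The projection of the cylinder to `A`. -/
noncomputable def cylinderFst (A : TCat.{u, v}) : Fun (pi (cylinder A)) A :=
  piProj (cylinder A) true

/-- The projection of the cylinder to `{0 < 1}`. -/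
noncomputable def cylinderSnd (A : TCat.{u, v}) : Fun (pi (cylinder A)) interval.{u, v} :=
  piProj (cylinder A) false

variable {A : TCat.{u, v}}

/-- The image of `(m, i ≤ j)` under the functor `A × {0 < 1} → B` associated to a transformation of
functors `A → B`. -/
def FuncMor.cylinderMor {B : TCat} (a : FuncMor A B) (m : A.Mor) (q : interval.{u, v}.Mor) :
    B.Mor :=
  if q.down.1.2 = 0 then a.dom.toFun.mor m
  else if q.down.1.1 = 0 then
    B.comp (a.dom.toFun.mor m) (a.app (A.tgt m)) (by rw [a.dom.toFun.tgt_mor, a.src_app])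
  else a.cod.toFun.mor m

theorem fin_two_le_cases (q : interval.{u, v}.Mor) : q = ⟨⟨(0, 0), le_rfl⟩⟩ ∨
    q = ⟨⟨(0, 1), by decide⟩⟩ ∨ q = ⟨⟨(1, 1), le_rfl⟩⟩ := by
  obtain ⟨⟨⟨i, j⟩, h⟩⟩ := q
  fin_cases i <;> fin_cases j
  · exact Or.inl rfl
  · exact Or.inr (Or.inl rfl)
  · exact absurd h (by decide)
  · exact Or.inr (Or.inr rfl)

theorem FuncMor.src_cylinderMor {B : TCat} (a : FuncMor A B) (m : A.Mor) (q : interval.{u, v}.Mor) :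
    B.src (a.cylinderMor m q) = if (interval.src q).down = 0 then a.dom.toFun.ob (A.src m)
      else a.cod.toFun.ob (A.src m) := by
  rcases fin_two_le_cases q with rfl | rfl | rfl <;>
    simp [cylinderMor, interval, Fun.src_mor, B.src_comp]

theorem FuncMor.tgt_cylinderMor {B : TCat} (a : FuncMor A B) (m : A.Mor) (q : interval.{u, v}.Mor) :
    B.tgt (a.cylinderMor m q) = if (interval.tgt q).down = 0 then a.dom.toFun.ob (A.tgt m)
      else a.cod.toFun.ob (A.tgt m) := by
  rcases fin_two_le_cases q with rfl | rfl | rfl <;>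
    simp [cylinderMor, interval, Fun.tgt_mor, B.tgt_comp, a.tgt_app]

theorem FuncMor.cylinderMor_comp {B : TCat} (a : FuncMor A B) (m m' : A.Mor)
    (q q' : interval.{u, v}.Mor) (h : A.tgt m = A.src m') (h' : interval.tgt q = interval.src q') :
    a.cylinderMor (A.comp m m' h) (interval.comp q q' h') =
      B.comp (a.cylinderMor m q) (a.cylinderMor m' q')
        (by rw [tgt_cylinderMor, src_cylinderMor, h, h']) := by
  have e1 : B.tgt (a.dom.toFun.mor m) = B.src (a.dom.toFun.mor m') := by
    rw [Fun.tgt_mor, Fun.src_mor, h]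
  have e2 : B.tgt (a.dom.toFun.mor m') = B.src (a.app (A.tgt m')) := by
    rw [a.dom.toFun.tgt_mor, a.src_app]
  have e3 : B.tgt (a.dom.toFun.mor m) = B.src (a.app (A.src m')) := by
    rw [a.dom.toFun.tgt_mor, a.src_app, h]
  have e4 : B.tgt (a.app (A.src m')) = B.src (a.cod.toFun.mor m') := by
    rw [a.cod.toFun.src_mor, a.tgt_app]
  rcases fin_two_le_cases q with rfl | rfl | rfl <;>
    rcases fin_two_le_cases q' with rfl | rfl | rfl
  · exact a.dom.toFun.mor_comp m m' h
  · change B.comp (a.dom.toFun.mor (A.comp m m' h)) (a.app (A.tgt (A.comp m m' h))) _ =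
      B.comp (a.dom.toFun.mor m) (B.comp (a.dom.toFun.mor m') (a.app (A.tgt m')) e2) _
    rw [← B.assoc _ _ _ e1 e2]
    exact B.comp_congr (a.dom.toFun.mor_comp m m' h) (congrArg a.app (A.tgt_comp m m' h)) _
  · exact absurd (congrArg ULift.down h') (by decide)
  · exact absurd (congrArg ULift.down h') (by decide)
  · exact absurd (congrArg ULift.down h') (by decide)
  · change B.comp (a.dom.toFun.mor (A.comp m m' h)) (a.app (A.tgt (A.comp m m' h))) _ =
      B.comp (B.comp (a.dom.toFun.mor m) (a.app (A.tgt m)) _) (a.cod.toFun.mor m') _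
    refine Eq.trans ?_ (Eq.trans (B.assoc _ _ _ e3 e4).symm
      (B.comp_congr (B.comp_congr rfl (congrArg a.app h.symm) _) rfl _))
    refine (B.comp_congr (a.dom.toFun.mor_comp m m' h)
      (congrArg a.app (A.tgt_comp m m' h)) _).trans ?_
    exact (B.assoc _ _ _ e1 e2).trans (B.comp_congr rfl (a.natural m') _)
  · exact absurd (congrArg ULift.down h') (by decide)
  · exact absurd (congrArg ULift.down h') (by decide)
  · exact a.cod.toFun.mor_comp m m' h

/-- The functor `A × {0 < 1} → B` associated to a transformation of functors `A → B`. -/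
noncomputable def FuncMor.cylinderFun {B : TCat} (a : FuncMor A B) : Fun (pi (cylinder A)) B where
  ob x := if ((cylinderSnd A).ob x).down = 0 then a.dom.toFun.ob ((cylinderFst A).ob x)
    else a.cod.toFun.ob ((cylinderFst A).ob x)
  mor f := a.cylinderMor ((cylinderFst A).mor f) ((cylinderSnd A).mor f)
  src_mor f := by rw [src_cylinderMor, Fun.src_mor, Fun.src_mor]
  tgt_mor f := by rw [tgt_cylinderMor, Fun.tgt_mor, Fun.tgt_mor]
  mor_id x := by
    rw [(cylinderFst A).mor_id, (cylinderSnd A).mor_id]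
    generalize (cylinderSnd A).ob x = q
    generalize (cylinderFst A).ob x = y
    obtain ⟨q⟩ := q
    fin_cases q <;> simp [cylinderMor, interval, Fun.mor_id]
  mor_comp f g h := by
    simp only [Fun.mor_comp]
    exact a.cylinderMor_comp _ _ _ _ _ _

theorem FuncMor.cylinderFun_isCont {B : TCat} (hA : A.IsKCat) (hB : B.IsKCat) (a : FuncMor A B) :
    a.cylinderFun.IsCont := by
  have hf : (cylinderFst A).IsCont := piProj_isCont true
  have hs : (cylinderSnd A).IsCont := piProj_isCont false
  have hmor : ∀ q, Continuous fun m => a.cylinderMor m q := by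
    intro q
    rcases fin_two_le_cases q with rfl | rfl | rfl
    · exact a.dom.cont.mor
    · have := hA.mor.coherent
      exact hB.continuous_comp_of a.dom.cont.mor (a.cont.comp hA.continuous_tgt) _
    · exact a.cod.cont.mor
  have h : Continuous fun p : A.Mor × interval.{u, v}.Mor => a.cylinderMor p.1 p.2 :=
    continuous_prod_of_discrete_right.2 hmor
  have hm : Continuous a.cylinderFun.mor := h.comp (hf.mor.prodMk hs.mor)
  refine ⟨?_, hm⟩
  have hk : (pi (cylinder A)).IsKCat := pi_isKCat (cylinder_isKCat hA)
  refine ((hB.continuous_src.comp hm).comp hk.continuous_id).congr fun x => ?_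
  exact (a.cylinderFun.ob_eq x).symm

/-- The nondegenerate `1`-simplex of the nerve of `{0 < 1}`. -/
def intervalChain : Nerve interval.{u, v} 1 where
  ob x := ⟨x⟩
  mor p := ⟨p⟩
  src_mor _ := rfl
  tgt_mor _ := rfl
  mor_id _ := rfl
  mor_comp _ _ _ := rfl

/-- The point `(1 - s, s)` of the `1`-simplex. -/
noncomputable def segmentPoint (s : unitInterval) : stdSimplex ℝ (Fin 2) :=
  ⟨![1 - s, s], by
    refine ⟨fun i => ?_, by simp⟩
    fin_cases i
    · exact sub_nonneg.2 s.2.2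
    · exact s.2.1⟩

theorem continuous_segmentPoint : Continuous segmentPoint := by
  refine Continuous.subtype_mk (continuous_pi fun i => ?_) _
  fin_cases i
  · exact continuous_const.sub continuous_subtype_val
  · exact continuous_subtype_val

theorem FuncMor.cylinderMor_equivariant {B : TCat} (a : FuncMor A B) {R : Fun A A} {R' : Fun B B}
    (hd : ∀ m, a.dom.toFun.mor (R.mor m) = R'.mor (a.dom.toFun.mor m))
    (hc : ∀ m, a.cod.toFun.mor (R.mor m) = R'.mor (a.cod.toFun.mor m))
    (ha : ∀ x, a.app (R.ob x) = R'.mor (a.app x)) (m : A.Mor) (q : interval.{u, v}.Mor) :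
    a.cylinderMor (R.mor m) q = R'.mor (a.cylinderMor m q) := by
  rcases fin_two_le_cases q with rfl | rfl | rfl
  · exact hd m
  · refine Eq.trans ?_ (R'.mor_comp (a.dom.toFun.mor m) (a.app (A.tgt m)) ?_).symm
    · exact B.comp_congr (hd m) ((congrArg a.app (R.tgt_mor m)).trans (ha _)) _
    · rw [a.dom.toFun.tgt_mor, a.src_app]
  · exact hc m

namespace Realization

/-- A continuous natural transformation of functors `A → B` induces a homotopy of maps `|A| → |B|`,
which commutes with the maps induced by endofunctors that are compatible with the
transformation. It is the composite of `|A| × |{0 < 1}| → |A × {0 < 1}|` with the map induced by the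
functor `A × {0 < 1} → B`. -/
theorem exists_homotopy {B : TCat} (hA : A.IsKCat) (hB : B.IsKCat) (a : FuncMor A B) :
    ∃ H : Realization A × unitInterval → Realization B, Continuous H ∧
      (∀ x, H (x, 0) = map a.dom.toFun x) ∧ (∀ x, H (x, 1) = map a.cod.toFun x) ∧
      ∀ (R : Fun A A) (R' : Fun B B),
        (∀ m, a.dom.toFun.mor (R.mor m) = R'.mor (a.dom.toFun.mor m)) →
        (∀ m, a.cod.toFun.mor (R.mor m) = R'.mor (a.cod.toFun.mor m)) →
        (∀ x, a.app (R.ob x) = R'.mor (a.app x)) →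
        ∀ x s, H (map R x, s) = map R' (H (x, s)) := by
  let pt : unitInterval → Realization interval.{u, v} := fun s => mk intervalChain (segmentPoint s)
  let f : ∀ b, Realization A × unitInterval → Realization (cylinder A b) := fun b p =>
    match b with
    | true => p.1
    | false => pt p.2
  have hf : ∀ b, Continuous (f b) := by
    rintro (_ | _)
    · exact (continuous_mk 1).comp
        (continuous_const.prodMk (continuous_segmentPoint.comp continuous_snd))
    · exact continuous_fst
  have hstep : ∀ x s p, step (map a.cylinderFun (prodMk fun b => f b (x, s))) p =
      a.cylinderMor (step x p) (step (pt s) p) := by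
    intro x s p
    refine (step_map _ _ _).trans ?_
    exact congrArg₂ a.cylinderMor (step_prodMk (fun b => f b (x, s)) p true)
      (step_prodMk (fun b => f b (x, s)) p false)
  have hk := cylinder_isKCat hA
  have := (isKSpace hA).coherent
  -- the three identities are verified on the step functors, which are known by `hstep`
  refine ⟨fun p => map a.cylinderFun (prodMk fun b => f b p),
    (continuous_map (pi_isKCat hk) (a.cylinderFun_isCont hA hB)).comp
      (continuous_prodMk_comp hk hf),
    fun x => step_injective (funext fun p => ?_), fun x => step_injective (funext fun p => ?_),
    fun R R' hd hc ha x s => step_injective (funext fun p => ?_)⟩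
  · rw [hstep, step_map]
    have h0 : ∀ u : ℝ, u < 1 → stdSimplex.pos (segmentPoint 0) u = 0 := fun u hu => by
      refine Fin.le_zero_iff.1 ((stdSimplex.pos_le_iff _ hu 0).2 ?_)
      rw [show Finset.Iic (0 : Fin 2) = {0} from rfl, Finset.sum_singleton]
      exact hu.trans_eq (sub_zero (1 : ℝ)).symm
    rw [show step (pt 0) p = ⟨⟨(0, 0), le_rfl⟩⟩ from
      step_mk_of _ (h0 _ (p.2.2.1.trans_lt p.2.2.2)) (h0 _ p.2.2.2) le_rfl]
    rfl
  · rw [hstep, step_map]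
    have h1 : ∀ u : ℝ, 0 ≤ u → stdSimplex.pos (segmentPoint 1) u = 1 := fun u hu => by
      refine Fin.eq_one_of_ne_zero _ (Fin.pos_iff_ne_zero.1
        ((stdSimplex.castSucc_lt_pos_iff (segmentPoint 1) u 0).2 ?_))
      rw [stdSimplex.cut, show Finset.Iic (Fin.castSucc (0 : Fin 1)) = {0} from rfl,
        Finset.sum_singleton]
      exact (sub_self (1 : ℝ)).trans_le hu
    rw [show step (pt 1) p = ⟨⟨(1, 1), le_rfl⟩⟩ from
      step_mk_of _ (h1 _ p.2.1) (h1 _ (p.2.1.trans p.2.2.1)) le_rfl]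
    rfl
  · rw [hstep, step_map, step_map, hstep, a.cylinderMor_equivariant hd hc ha]

end Realization

end TCat

/-! ### Continuous sections of Hilbert bundles -/

open scoped InnerProductSpace

theorem continuous_of_forall_exists_isOpen {Y Z : Type*} [TopologicalSpace Y] [TopologicalSpace Z]
    {f : Y → Z} (h : ∀ y, ∃ W : Set Y, IsOpen W ∧ y ∈ W ∧ Continuous fun y : W => f y) :
    Continuous f := by
  refine continuous_iff_continuousAt.2 fun y => ?_
  obtain ⟨W, hW, hy, hf⟩ := h y
  exact (continuousOn_iff_continuous_domRestrict.2 hf).continuousAt (hW.mem_nhds hy)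

namespace HilbertBundle

variable {𝕜 : Type w} [RCLike 𝕜] {X : Type u} [TopologicalSpace X] {p : HilbertBundle 𝕜 X}
variable {Y Z : Type*} [TopologicalSpace Y] [TopologicalSpace Z]

/-- A local orthonormal frame of `p` over the open set `U`, with arbitrary values outside of `U`.
The last two fields say that the coordinates and the linear combinations are continuous, so that the
frame is a local trivialization. -/
structure LocalFrame (p : HilbertBundle 𝕜 X) where
  n : ℕ
  U : Set X
  sec : ∀ x, Fin n → p.fiber x
  isOpen : IsOpen U
  orthonormal : ∀ x ∈ U, Orthonormal 𝕜 (sec x)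
  sum_inner : ∀ x ∈ U, ∀ v : p.fiber x, ∑ k, ⟪sec x k, v⟫_𝕜 • sec x k = v
  continuous_coord : ∀ k, Continuous fun v : {v : p.Total // v.proj ∈ U} =>
    ⟪sec v.1.proj k, v.1.snd⟫_𝕜
  continuous_mk : Continuous fun q : U × EuclideanSpace 𝕜 (Fin n) =>
    (⟨q.1, ∑ k, q.2 k • sec q.1 k⟩ : p.Total)

theorem exists_localFrame (p : HilbertBundle 𝕜 X) (x₀ : X) : ∃ T : p.LocalFrame, x₀ ∈ T.U := by
  classical
  obtain ⟨n, U, e, hU, hx, he⟩ := p.locally_trivial x₀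
  let s : ∀ x, Fin n → p.fiber x := fun x k =>
    if h : x ∈ U then (e ⟨x, h⟩).symm (EuclideanSpace.single k 1) else 0
  have hs : ∀ x (h : x ∈ U) k, s x k = (e ⟨x, h⟩).symm (EuclideanSpace.single k 1) :=
    fun x h k => dif_pos h
  have hc : ∀ x (h : x ∈ U) k v, ⟪s x k, v⟫_𝕜 = e ⟨x, h⟩ v k := by
    intro x h k v
    rw [hs x h, ← (e ⟨x, h⟩).inner_map_map, LinearIsometryEquiv.apply_symm_apply]
    simp [EuclideanSpace.inner_single_left]
  have hsum : ∀ x (h : x ∈ U) (c : EuclideanSpace 𝕜 (Fin n)),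
      ∑ k, c k • s x k = (e ⟨x, h⟩).symm c := by
    intro x h c
    apply (e ⟨x, h⟩).injective
    rw [LinearIsometryEquiv.apply_symm_apply, map_sum]
    ext j
    simp [hs x h, Pi.single_apply]
  refine ⟨⟨n, U, s, hU, fun x h => ?_, fun x h v => ?_, fun k => ?_, ?_⟩, hx⟩
  · have h1 : (s x) = fun k => (e ⟨x, h⟩).symm (EuclideanSpace.single k (1 : 𝕜)) := funext (hs x h)
    rw [h1]
    exact EuclideanSpace.orthonormal_single.comp_linearIsometry (e ⟨x, h⟩).symm.toLinearIsometry
  · simp only [hc x h]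
    rw [hsum x h (e ⟨x, h⟩ v), LinearIsometryEquiv.symm_apply_apply]
  · have h1 : Continuous fun c : EuclideanSpace 𝕜 (Fin n) => c k := by fun_prop
    exact (h1.comp (continuous_snd.comp he.continuous)).congr fun v => (hc _ v.2 k _).symm
  · refine (continuous_subtype_val.comp he.homeomorph.symm.continuous).congr fun q => ?_
    have : he.homeomorph.symm q = ⟨⟨q.1, (e q.1).symm q.2⟩, q.1.2⟩ := by
      rw [Homeomorph.symm_apply_eq]
      simp
    rw [Function.comp_apply, this, hsum _ q.1.2]

/-- The frame at a point, as an orthonormal basis. -/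
noncomputable def LocalFrame.basis (T : p.LocalFrame) {x : X} (hx : x ∈ T.U) :
    OrthonormalBasis (Fin T.n) 𝕜 (p.fiber x) :=
  OrthonormalBasis.mk (T.orthonormal x hx) fun v _ => by
    rw [← T.sum_inner x hx v]
    exact Submodule.sum_smul_mem _ _ fun k _ => Submodule.subset_span ⟨k, rfl⟩

@[simp]
theorem LocalFrame.basis_apply (T : p.LocalFrame) {x : X} (hx : x ∈ T.U) (k : Fin T.n) :
    T.basis hx k = T.sec x k := by
  simp [basis]

/-- `v` is a continuous section of `p` along the map `b`. -/
def ContSec (p : HilbertBundle 𝕜 X) (b : Y → X) (v : ∀ y, p.fiber (b y)) : Prop :=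
  Continuous fun y => (⟨b y, v y⟩ : p.Total)

variable {b : Y → X} {v v' : ∀ y, p.fiber (b y)}

theorem ContSec.continuous_base (hv : p.ContSec b v) : Continuous b :=
  p.continuous_proj.comp hv

theorem ContSec.comp (hv : p.ContSec b v) {g : Z → Y} (hg : Continuous g) :
    p.ContSec (fun z => b (g z)) (fun z => v (g z)) :=
  Continuous.comp hv hg

theorem ContSec.of_local (h : ∀ y, ∃ W : Set Y, IsOpen W ∧ y ∈ W ∧
    p.ContSec (fun y : W => b y) (fun y => v y)) : p.ContSec b v :=
  continuous_of_forall_exists_isOpen h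

theorem ContSec.coord (hv : p.ContSec b v) (T : p.LocalFrame) (h : ∀ y, b y ∈ T.U) (k : Fin T.n) :
    Continuous fun y => ⟪T.sec (b y) k, v y⟫_𝕜 :=
  (T.continuous_coord k).comp (Continuous.subtype_mk (p := fun v : p.Total => v.proj ∈ T.U) hv h)

theorem ContSec.of_coord (hb : Continuous b) (T : p.LocalFrame) (h : ∀ y, b y ∈ T.U)
    (hv : ∀ k, Continuous fun y => ⟪T.sec (b y) k, v y⟫_𝕜) : p.ContSec b v := by
  have h1 : Continuous fun y => ((⟨b y, h y⟩ : T.U),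
      (WithLp.toLp 2 fun k => ⟪T.sec (b y) k, v y⟫_𝕜 : EuclideanSpace 𝕜 (Fin T.n))) :=
    (hb.subtype_mk h).prodMk ((PiLp.continuous_toLp 2 _).comp (continuous_pi hv))
  refine (T.continuous_mk.comp h1).congr fun y => ?_
  have := T.sum_inner (b y) (h y) (v y)
  exact congrArg (Bundle.TotalSpace.mk (b y)) this

/-- A section is continuous iff its coordinates in all local orthonormal frames are. -/
theorem contSec_iff : p.ContSec b v ↔ Continuous b ∧
    ∀ (T : p.LocalFrame) (k : Fin T.n), Continuous fun y : b ⁻¹' T.U => ⟪T.sec (b y) k, v y⟫_𝕜 := by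
  refine ⟨fun hv => ⟨hv.continuous_base, fun T k =>
    (hv.comp continuous_subtype_val).coord T (fun y => y.2) k⟩, fun ⟨hb, h⟩ =>
    .of_local fun y => ?_⟩
  obtain ⟨T, hT⟩ := p.exists_localFrame (b y)
  exact ⟨b ⁻¹' T.U, T.isOpen.preimage hb, hT,
    .of_coord (hb.comp continuous_subtype_val) T (fun y => y.2) (h T)⟩

theorem contSec_zero (hb : Continuous b) : p.ContSec b fun _ => 0 :=
  contSec_iff.2 ⟨hb, fun T k => by simpa using continuous_const⟩

theorem ContSec.smul {c : Y → 𝕜} (hc : Continuous c) (hv : p.ContSec b v) :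
    p.ContSec b fun y => c y • v y :=
  contSec_iff.2 ⟨hv.continuous_base, fun T k => by
    simp only [inner_smul_right]
    exact (hc.comp continuous_subtype_val).mul ((contSec_iff.1 hv).2 T k)⟩

theorem contSec_sum (hb : Continuous b) {ι : Type*} (s : Finset ι) {v : ι → ∀ y, p.fiber (b y)}
    (hv : ∀ i ∈ s, p.ContSec b (v i)) : p.ContSec b fun y => ∑ i ∈ s, v i y :=
  contSec_iff.2 ⟨hb, fun T k => by
    simp only [inner_sum]
    exact continuous_finsetSum _ fun i hi => (contSec_iff.1 (hv i hi)).2 T k⟩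

theorem LocalFrame.inner_eq (T : p.LocalFrame) {x : X} (hx : x ∈ T.U) (v v' : p.fiber x) :
    ⟪v, v'⟫_𝕜 = ∑ k, (starRingEnd 𝕜) ⟪T.sec x k, v⟫_𝕜 * ⟪T.sec x k, v'⟫_𝕜 := by
  conv_lhs => rw [← T.sum_inner x hx v]
  simp only [_root_.sum_inner, inner_smul_left]

theorem LocalFrame.contSec (T : p.LocalFrame) (hb : Continuous b) (h : ∀ y, b y ∈ T.U)
    (k : Fin T.n) : p.ContSec b fun y => T.sec (b y) k := by
  classical
  refine .of_coord hb T h fun j => ?_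
  simp only [orthonormal_iff_ite.1 (T.orthonormal _ (h _))]
  exact continuous_const

theorem ContSec.inner (hv : p.ContSec b v) (hv' : p.ContSec b v') :
    Continuous fun y => ⟪v y, v' y⟫_𝕜 := by
  refine continuous_of_forall_exists_isOpen fun y => ?_
  obtain ⟨T, hT⟩ := p.exists_localFrame (b y)
  refine ⟨b ⁻¹' T.U, T.isOpen.preimage hv.continuous_base, hT, ?_⟩
  refine Continuous.congr ?_ fun y => (T.inner_eq y.2 (v y) (v' y)).symm
  exact continuous_finsetSum _ fun k _ =>
    (RCLike.continuous_conj.comp ((contSec_iff.1 hv).2 T k)).mul ((contSec_iff.1 hv').2 T k)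

theorem ContSec.norm (hv : p.ContSec b v) : Continuous fun y => ‖v y‖ := by
  simp only [norm_eq_sqrt_re_inner (𝕜 := 𝕜)]
  exact Real.continuous_sqrt.comp (RCLike.continuous_re.comp (hv.inner hv))

/-- The coordinates of a continuous section with respect to a continuous basis are continuous, since
they are obtained from scalar products through the inverse of the Gram matrix. -/
theorem ContSec.continuous_repr {n : ℕ} {a : ∀ y, Module.Basis (Fin n) 𝕜 (p.fiber (b y))}
    (ha : ∀ i, p.ContSec b fun y => a y i) (hv : p.ContSec b v) (i : Fin n) :
    Continuous fun y => (a y).repr (v y) i := by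
  have hG : ∀ y, (Matrix.gram 𝕜 (a y)).det ≠ 0 := fun y =>
    Matrix.det_gram_ne_zero_iff_linearIndependent.2 (a y).linearIndependent
  have hGc : Continuous fun y => Matrix.gram 𝕜 (a y) :=
    continuous_matrix fun i j => (ha i).inner (ha j)
  have hmul : ∀ y, (Matrix.gram 𝕜 (a y)).mulVec ((a y).repr (v y)) = fun j => ⟪a y j, v y⟫_𝕜 := by
    intro y
    ext j
    conv_rhs => rw [← (a y).sum_repr (v y), inner_sum]
    simp only [inner_smul_right, mul_comm ((a y).repr (v y) _)]
    rfl
  have hc : Continuous fun y => (Matrix.gram 𝕜 (a y)).det⁻¹ •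
      (Matrix.gram 𝕜 (a y)).adjugate.mulVec (fun j => ⟪a y j, v y⟫_𝕜) :=
    (hGc.matrix_det.inv₀ hG).smul
      (hGc.matrix_adjugate.matrix_mulVec (continuous_pi fun j => (ha j).inner hv))
  refine ((continuous_apply i).comp hc).congr fun y => ?_
  have h1 : (Matrix.gram 𝕜 (a y)).det⁻¹ • (Matrix.gram 𝕜 (a y)).adjugate.mulVec
      (fun j => ⟪a y j, v y⟫_𝕜) = (a y).repr (v y) := by
    rw [← hmul, Matrix.mulVec_mulVec, Matrix.adjugate_mul, Matrix.smul_mulVec, Matrix.one_mulVec,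
      inv_smul_smul₀ (hG y)]
  exact congrFun h1 i

end HilbertBundle

/-! ### The space of isomorphisms between fibres of a bundle -/

theorem Module.Basis.equiv_refl_apply {R M M' ι : Type*} [CommSemiring R] [AddCommMonoid M]
    [Module R M] [AddCommMonoid M'] [Module R M'] [Fintype ι] (a : Module.Basis ι R M)
    (b : Module.Basis ι R M') (v : M) :
    a.equiv b (Equiv.refl ι) v = ∑ i, a.repr v i • b i := by
  conv_lhs => rw [← a.sum_repr v, map_sum]
  simp only [map_smul, equiv_apply, Equiv.refl_apply]

theorem ModKind.isFrame_of_orthonormal {𝕜 : Type w} [RCLike 𝕜] {κ : ModKind} {n : ℕ}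
    {V : Type u} [NormedAddCommGroup V] [InnerProductSpace 𝕜 V]
    {a : Module.Basis (Fin n) 𝕜 V} (ha : Orthonormal 𝕜 a) : κ.IsFrame a := by
  cases κ with
  | mod => trivial
  | imod => exact ha
  | smod => exact ⟨fun i j h => ha.2 h, 1, one_pos, ha.1⟩

namespace HilbertBundle

variable {𝕜 : Type w} [RCLike 𝕜] {X : Type u} [TopologicalSpace X] {p : HilbertBundle 𝕜 X}
  {κ : ModKind} {n : ℕ}
variable {Y : Type*} [TopologicalSpace Y]

theorem Frame.continuous_iff {f : Y → p.Frame κ n} : Continuous f ↔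
    Continuous (fun y => (f y).pt) ∧ ∀ i, p.ContSec (fun y => (f y).pt) fun y => (f y).basis i := by
  rw [continuous_induced_rng]
  refine ⟨fun h => ⟨continuous_fst.comp h, fun i =>
    (continuous_apply i).comp (continuous_snd.comp h)⟩, fun h => h.1.prodMk (continuous_pi h.2)⟩

theorem continuous_arrOfFrames : Continuous (p.arrOfFrames κ n) :=
  continuous_iff_coinduced_le.2 (le_iSup (fun n : ℕ =>
    TopologicalSpace.coinduced (p.arrOfFrames κ n) inferInstance) n)

theorem Arr.isOpen_iff {s : Set (p.Arr κ)} :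
    IsOpen s ↔ ∀ n, IsOpen (p.arrOfFrames κ n ⁻¹' s) := by
  refine isOpen_iSup_iff.trans (forall_congr' fun n => ?_)
  exact isOpen_coinduced

theorem Arr.continuous_dom {f : p.Arr κ → Y} (h : ∀ n, Continuous (f ∘ p.arrOfFrames κ n)) :
    Continuous f :=
  continuous_def.2 fun _ hs => Arr.isOpen_iff.2 fun n => hs.preimage (h n)

theorem Arr.continuous_src : Continuous (Arr.src : p.Arr κ → X) :=
  Arr.continuous_dom fun _ => (Frame.continuous_iff.1 continuous_id).1.comp
    (continuous_fst.comp CompactCoherentification.continuous_mk_symm)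

theorem Arr.continuous_tgt : Continuous (Arr.tgt : p.Arr κ → X) :=
  Arr.continuous_dom fun _ => (Frame.continuous_iff.1 continuous_id).1.comp
    (continuous_snd.comp CompactCoherentification.continuous_mk_symm)

/-- The isomorphism which maps the frame `a` to the frame `b` maps `v` to the linear combination
of `b` whose coefficients are the coordinates of `v` with respect to `a`. -/
theorem ContSec.arrOfFrames {f : Y → 𝐤 (p.Frame κ n × p.Frame κ n)} (hf : Continuous f)
    {v : ∀ y, p.fiber (p.arrOfFrames κ n (f y)).src}
    (hv : p.ContSec (fun y => (p.arrOfFrames κ n (f y)).src) v) :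
    p.ContSec (fun y => (p.arrOfFrames κ n (f y)).tgt)
      fun y => (p.arrOfFrames κ n (f y)).iso (v y) := by
  have h := CompactCoherentification.continuous_mk_symm.comp hf
  have h1 := Frame.continuous_iff.1 (continuous_fst.comp h)
  have h2 := Frame.continuous_iff.1 (continuous_snd.comp h)
  have := contSec_sum h2.1 Finset.univ fun i _ => (h2.2 i).smul (hv.continuous_repr h1.2 i)
  refine this.congr fun y => congrArg (Bundle.TotalSpace.mk _) ?_
  exact (Module.Basis.equiv_refl_apply _ _ _).symm

/-- The matrix coefficients of an isomorphism in local orthonormal frames (outside of the domain of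
definition of the frames they have no meaning). -/
noncomputable def Arr.coeff (T T' : p.LocalFrame) (j : Fin T'.n) (k : Fin T.n) (m : p.Arr κ) : 𝕜 :=
  ⟪T'.sec m.tgt j, m.iso (T.sec m.src k)⟫_𝕜

/-- The arrows with source in the domain of `T` and target in the domain of `T'`. -/
def Arr.domain (κ : ModKind) (T T' : p.LocalFrame) : Set (p.Arr κ) :=
  Arr.src ⁻¹' T.U ∩ Arr.tgt ⁻¹' T'.U

theorem Arr.isOpen_domain (T T' : p.LocalFrame) : IsOpen (Arr.domain κ T T') :=
  (T.isOpen.preimage Arr.continuous_src).inter (T'.isOpen.preimage Arr.continuous_tgt)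

/-- Matrix coefficients are continuous, though the topology of the space of arrows is a quotient
topology: they are so after composition with the quotient maps. -/
theorem Arr.continuousOn_coeff (T T' : p.LocalFrame) (j : Fin T'.n) (k : Fin T.n) :
    ContinuousOn (Arr.coeff (κ := κ) T T' j k) (Arr.domain κ T T') := by
  refine (continuousOn_open_iff (Arr.isOpen_domain T T')).2 fun B hB => Arr.isOpen_iff.2 fun n => ?_
  have ho : IsOpen (p.arrOfFrames κ n ⁻¹' Arr.domain κ T T') :=
    (Arr.isOpen_domain T T').preimage continuous_arrOfFrames
  suffices h : ContinuousOn (fun q => Arr.coeff T T' j k (p.arrOfFrames κ n q))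
      (p.arrOfFrames κ n ⁻¹' Arr.domain κ T T') from (continuousOn_open_iff ho).1 h B hB
  rw [continuousOn_iff_continuous_domRestrict]
  have hv : Continuous (Subtype.val : (p.arrOfFrames κ n ⁻¹' Arr.domain κ T T') → _) :=
    continuous_subtype_val
  have hc := continuous_arrOfFrames.comp hv
  have h1 := T.contSec (Arr.continuous_src.comp hc) (fun q => q.2.1) k
  have h2 := T'.contSec (Arr.continuous_tgt.comp hc) (fun q => q.2.2) j
  exact h2.inner (ContSec.arrOfFrames hv h1)

theorem Arr.iso_apply_eq_sum {T T' : p.LocalFrame} {m : p.Arr κ} (hm : m ∈ Arr.domain κ T T')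
    (v : p.fiber m.src) (j : Fin T'.n) : ⟪T'.sec m.tgt j, m.iso v⟫_𝕜 =
      ∑ k, ⟪T.sec m.src k, v⟫_𝕜 * Arr.coeff T T' j k m := by
  conv_lhs => rw [← T.sum_inner m.src hm.1 v, map_sum, inner_sum]
  simp only [map_smul, inner_smul_right]
  rfl

/-- A continuous family of isomorphisms maps continuous sections to continuous sections. -/
theorem ContSec.arr {f : Y → p.Arr κ} (hf : Continuous f) {v : ∀ y, p.fiber (f y).src}
    (hv : p.ContSec (fun y => (f y).src) v) :
    p.ContSec (fun y => (f y).tgt) fun y => (f y).iso (v y) := by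
  refine .of_local fun y => ?_
  obtain ⟨T, hT⟩ := p.exists_localFrame (f y).src
  obtain ⟨T', hT'⟩ := p.exists_localFrame (f y).tgt
  have ho := Arr.isOpen_domain (κ := κ) T T'
  refine ⟨f ⁻¹' Arr.domain κ T T', ho.preimage hf, ⟨hT, hT'⟩, ?_⟩
  have hs : Continuous (Subtype.val : (f ⁻¹' Arr.domain κ T T') → Y) := continuous_subtype_val
  refine .of_coord (Arr.continuous_tgt.comp (hf.comp hs)) T' (fun y => y.2.2) fun j => ?_
  refine Continuous.congr ?_ fun y => (Arr.iso_apply_eq_sum y.2 (v y) j).symm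
  refine continuous_finsetSum _ fun k _ => ((hv.comp hs).coord T (fun y => y.2.1) k).mul ?_
  exact (continuousOn_iff_continuous_domRestrict.1 (Arr.continuousOn_coeff T T' j k)).comp
    ((hf.comp hs).subtype_mk fun y => y.2)

/-- The image of an orthonormal basis under an isomorphism is a frame of the corresponding kind. -/
theorem Arr.isFrame_map (m : p.Arr κ) (a : OrthonormalBasis (Fin n) 𝕜 (p.fiber m.src)) :
    κ.IsFrame (a.toBasis.map m.iso) := by
  obtain ⟨x, y, f, hf⟩ := m
  cases κ with
  | mod => trivial
  | imod =>
    let e : p.fiber x ≃ₗᵢ[𝕜] p.fiber y := ⟨f, fun v => hf () v⟩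
    have := a.orthonormal.comp_linearIsometry e.toLinearIsometry
    refine (congrArg (Orthonormal 𝕜) (funext fun i => ?_)).mp this
    simp [e]
  | smod =>
    obtain ⟨r, hr, hf⟩ := hf
    refine ⟨fun i j hij => ?_, r, hr, fun i => ?_⟩
    · let g : p.fiber x →ₗ[𝕜] p.fiber y := (r⁻¹ : 𝕜) • f.toLinearMap
      have hg : ∀ v, ‖g v‖ = ‖v‖ := fun v => by
        simp only [g, LinearMap.smul_apply, norm_smul, LinearEquiv.coe_coe, hf () v, norm_inv,
          RCLike.norm_ofReal, abs_of_pos hr]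
        field_simp
      have h1 : ⟪g (a i), g (a j)⟫_𝕜 = 0 := by
        rw [(LinearMap.norm_map_iff_inner_map_map g).1 hg]
        exact a.orthonormal.2 hij
      simp only [g, LinearMap.smul_apply, inner_smul_left, inner_smul_right, mul_eq_zero] at h1
      have hr' : (r : 𝕜) ≠ 0 := by exact_mod_cast hr.ne'
      simpa [hr', hr.ne'] using h1
    · simp [hf () (a i)]

/-- A family of isomorphisms is continuous if it maps continuous sections to continuous sections:
locally, it is given by an orthonormal frame at the source and by the image of that frame. -/
theorem Arr.continuous_of_contSec [T2Space Y] [CompactlyCoherentSpace Y] {f : Y → p.Arr κ}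
    (hs : Continuous fun y => (f y).src) (ht : Continuous fun y => (f y).tgt)
    (h : ∀ (W : Set Y) (v : ∀ y : W, p.fiber (f y).src), p.ContSec (fun y : W => (f y).src) v →
      p.ContSec (fun y : W => (f y).tgt) fun y => (f y).iso (v y)) : Continuous f := by
  refine continuous_of_forall_exists_isOpen fun y => ?_
  obtain ⟨T, hT⟩ := p.exists_localFrame (f y).src
  have hW : IsOpen ((fun y => (f y).src) ⁻¹' T.U) := T.isOpen.preimage hs
  refine ⟨_, hW, hT, ?_⟩
  have := hW.compactlyCoherentSpace
  have hv : Continuous (Subtype.val : ((fun y => (f y).src) ⁻¹' T.U) → Y) := continuous_subtype_val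
  let a : ∀ z : ((fun y => (f y).src) ⁻¹' T.U), OrthonormalBasis (Fin T.n) 𝕜 (p.fiber (f z).src) :=
    fun z => T.basis z.2
  have ha : ∀ z i, a z i = T.sec (f z).src i := fun z i => T.basis_apply z.2 i
  let F : ((fun y => (f y).src) ⁻¹' T.U) → p.Frame κ T.n × p.Frame κ T.n := fun z =>
    (⟨(f z).src, (a z).toBasis, ModKind.isFrame_of_orthonormal (by simp [(a z).orthonormal])⟩,
      ⟨(f z).tgt, (a z).toBasis.map (f z).iso, (f z).isFrame_map (a z)⟩)
  have hsec : ∀ i, p.ContSec (fun z : ((fun y => (f y).src) ⁻¹' T.U) => (f z).src)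
      fun z => T.sec (f z).src i := fun i => T.contSec (hs.comp hv) (fun z => z.2) i
  have hF : Continuous F := by
    refine Continuous.prodMk (Frame.continuous_iff.2 ⟨hs.comp hv, fun i => ?_⟩)
      (Frame.continuous_iff.2 ⟨ht.comp hv, fun i => ?_⟩)
    · simpa [F, ha] using hsec i
    · simpa [F, ha] using h _ _ (hsec i)
  have hF' : Continuous fun z => CompactCoherentification.mk _ (F z) :=
    CompactlyCoherentSpace.continuous_toKify hF
  refine (continuous_arrOfFrames.comp hF').congr fun z => ?_
  change (⟨(f z).src, (f z).tgt,
    (a z).toBasis.equiv ((a z).toBasis.map (f z).iso) (Equiv.refl _), _⟩ : p.Arr κ) =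
    ⟨(f z).src, (f z).tgt, (f z).iso, (f z).adm⟩
  congr 1
  ext v
  rw [Module.Basis.equiv_refl_apply]
  simp only [Module.Basis.map_apply, ← map_smul, ← map_sum]
  rw [Module.Basis.sum_repr]

/-- Arrows with the same source and target are separated by a matrix coefficient. -/
instance [T2Space X] : T2Space (p.Arr κ) := by
  refine ⟨fun m m' hne => ?_⟩
  by_cases hs : m.src = m'.src
  swap
  · exact separated_by_continuous Arr.continuous_src hs
  by_cases ht : m.tgt = m'.tgt
  swap
  · exact separated_by_continuous Arr.continuous_tgt ht
  obtain ⟨T, hT⟩ := p.exists_localFrame m.src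
  obtain ⟨T', hT'⟩ := p.exists_localFrame m.tgt
  have hm : m ∈ Arr.domain κ T T' := ⟨hT, hT'⟩
  have hm' : m' ∈ Arr.domain κ T T' := ⟨(hs ▸ hT : m'.src ∈ T.U), (ht ▸ hT' : m'.tgt ∈ T'.U)⟩
  have hex : ∃ j k, Arr.coeff T T' j k m ≠ Arr.coeff T T' j k m' := by
    by_contra! hcoeff
    refine hne ?_
    obtain ⟨x, y, f, hf⟩ := m
    obtain ⟨x', y', f', hf'⟩ := m'
    obtain rfl : x = x' := hs
    obtain rfl : y = y' := ht
    congr 1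
    ext v
    rw [← T'.sum_inner y hT' (f v), ← T'.sum_inner y hT' (f' v)]
    refine Finset.sum_congr rfl fun j _ => congrArg (· • T'.sec y j) ?_
    refine (Arr.iso_apply_eq_sum hm v j).trans (Eq.trans ?_ (Arr.iso_apply_eq_sum hm' v j).symm)
    simp only [hcoeff]
  obtain ⟨j, k, hjk⟩ := hex
  obtain ⟨B, B', hB, hB', hmB, hmB', hd⟩ := t2_separation hjk
  have hc := (continuousOn_open_iff (Arr.isOpen_domain (κ := κ) T T')).1
    (Arr.continuousOn_coeff T T' j k)
  refine ⟨_, _, hc B hB, hc B' hB', ⟨hm, hmB⟩, ⟨hm', hmB'⟩, ?_⟩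
  exact Set.disjoint_left.2 fun z hz hz' => Set.disjoint_left.1 hd hz.2 hz'.2

/-! ### Ratios of similarities -/

open Classical in
/-- The ratio of a similarity. It is `1` for isomorphisms of the other kinds and between
zero-dimensional fibres. -/
noncomputable def Arr.ratio (m : p.Arr κ) : ℝ :=
  if h : κ = .smod ∧ ∃ v : p.fiber m.src, v ≠ 0 then ‖m.iso h.2.choose‖ / ‖h.2.choose‖ else 1

theorem Arr.ratio_of_ne (hκ : κ ≠ .smod) (m : p.Arr κ) : m.ratio = 1 :=
  dif_neg fun h => hκ h.1

theorem Arr.ratio_of_subsingleton (m : p.Arr κ) (h : Subsingleton (p.fiber m.src)) : m.ratio = 1 :=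
  dif_neg fun h' => h'.2.choose_spec (Subsingleton.elim _ _)

theorem Arr.norm_iso (hκ : κ ≠ .mod) (m : p.Arr κ) (v : p.fiber m.src) :
    ‖m.iso v‖ = m.ratio * ‖v‖ := by
  cases κ with
  | mod => exact absurd rfl hκ
  | imod =>
    rw [m.ratio_of_ne (fun h => by cases h), one_mul]
    exact m.adm () v
  | smod =>
    by_cases hv : v = 0
    · simp [hv]
    · have h : ModKind.smod = .smod ∧ ∃ v : p.fiber m.src, v ≠ 0 := ⟨rfl, v, hv⟩
      rw [ratio, dif_pos h]
      obtain ⟨r, -, hr⟩ := m.adm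
      have := norm_ne_zero_iff.2 h.2.choose_spec
      rw [hr () v, hr () h.2.choose, mul_div_cancel_right₀ _ this]

theorem Arr.ratio_pos (m : p.Arr κ) : 0 < m.ratio := by
  rw [ratio]
  split_ifs with h
  · have := h.2.choose_spec
    refine div_pos (norm_pos_iff.2 ?_) (norm_pos_iff.2 this)
    simpa using this
  · exact one_pos

theorem Arr.ratio_eq (hκ : κ = .smod) (m : p.Arr κ) {v : p.fiber m.src} (hv : v ≠ 0) {r : ℝ}
    (h : ‖m.iso v‖ = r * ‖v‖) : m.ratio = r := by
  rw [m.norm_iso (by simp [hκ])] at h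
  exact mul_right_cancel₀ (norm_ne_zero_iff.2 hv) h

theorem LocalFrame.subsingleton_iff (T : p.LocalFrame) {x : X} (hx : x ∈ T.U) :
    Subsingleton (p.fiber x) ↔ T.n = 0 := by
  refine ⟨fun h => ?_, fun h => ⟨fun v v' => ?_⟩⟩
  · by_contra hn
    have := (T.orthonormal x hx).1 ⟨0, Nat.pos_of_ne_zero hn⟩
    rw [Subsingleton.elim (T.sec x _) 0, norm_zero] at this
    exact zero_ne_one this
  · have : IsEmpty (Fin T.n) := by rw [h]; infer_instance
    rw [← T.sum_inner x hx v, ← T.sum_inner x hx v']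
    simp

/-- The dimension of the fibres is locally constant. -/
theorem isClosed_subsingleton (p : HilbertBundle 𝕜 X) :
    IsClosed {x | Subsingleton (p.fiber x)} := by
  refine isOpen_compl_iff.1 (isOpen_iff_forall_mem_open.2 fun x hx => ?_)
  obtain ⟨T, hT⟩ := p.exists_localFrame x
  exact ⟨T.U, fun x' hx' h => hx ((T.subsingleton_iff hT).2 ((T.subsingleton_iff hx').1 h)),
    T.isOpen, hT⟩

/-- Locally, the ratio is the norm of the image of a section of norm `1`, or is `1` since the fibres
are zero-dimensional. -/
theorem Arr.continuous_ratio : Continuous (Arr.ratio : p.Arr κ → ℝ) := by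
  by_cases hκ : κ = .smod
  swap
  · exact continuous_const.congr fun m => (ratio_of_ne hκ m).symm
  refine continuous_of_forall_exists_isOpen fun m => ?_
  obtain ⟨T, hT⟩ := p.exists_localFrame m.src
  refine ⟨Arr.src ⁻¹' T.U, T.isOpen.preimage continuous_src, hT, ?_⟩
  by_cases hn : T.n = 0
  · refine (continuous_const (y := (1 : ℝ))).congr fun m => ?_
    exact (ratio_of_subsingleton m.1 ((T.subsingleton_iff m.2).2 hn)).symm
  · have hs : Continuous (Subtype.val : (Arr.src ⁻¹' T.U : Set (p.Arr κ)) → _) :=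
      continuous_subtype_val
    have h := (T.contSec (Arr.continuous_src.comp hs) (fun m => m.2) ⟨0, Nat.pos_of_ne_zero hn⟩)
    refine (ContSec.arr hs h).norm.congr fun m => ?_
    have h1 := (T.orthonormal m.1.src m.2).1 ⟨0, Nat.pos_of_ne_zero hn⟩
    have h2 := m.1.norm_iso (by simp [hκ]) (T.sec m.1.src ⟨0, Nat.pos_of_ne_zero hn⟩)
    rw [h1, mul_one] at h2
    exact h2

end HilbertBundle

namespace FibObj

/-! ### The categories of a family of bundles -/

variable {𝕜 : Type w} [RCLike 𝕜] {S T U : Type} {κ : ModKind}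
variable {Y : Type*} [TopologicalSpace Y]

section Arr

variable {φ : FibObj.{u} 𝕜 S}

theorem Arr.continuous_src_tgt_component : Continuous fun m : φ.Arr κ =>
    ((m.src, m.tgt, m.component) : φ.base × φ.base × ∀ s, (φ.bundle s).Arr κ) :=
  CompactCoherentification.continuous_mk_symm.comp
    (continuous_induced_dom (f := fun m : φ.Arr κ => (CompactCoherentification.mk
      (φ.base × φ.base × ∀ s, (φ.bundle s).Arr κ) (m.src, m.tgt, m.component))))

theorem Arr.continuous_src : Continuous (Arr.src : φ.Arr κ → φ.base) :=
  continuous_fst.comp continuous_src_tgt_component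

theorem Arr.continuous_tgt : Continuous (Arr.tgt : φ.Arr κ → φ.base) :=
  (continuous_fst.comp continuous_snd).comp continuous_src_tgt_component

theorem Arr.continuous_component (s : S) : Continuous fun m : φ.Arr κ => m.component s :=
  (continuous_apply s).comp ((continuous_snd.comp continuous_snd).comp continuous_src_tgt_component)

theorem Arr.continuous_of_component [CompactlyCoherentSpace Y] {f : Y → φ.Arr κ}
    (hs : Continuous fun y => (f y).src) (ht : Continuous fun y => (f y).tgt)
    (h : ∀ s, Continuous fun y => (f y).component s) : Continuous f :=
  continuous_induced_rng.2 (CompactlyCoherentSpace.continuous_toKify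
    (hs.prodMk (ht.prodMk (continuous_pi h))))

/-- A family of isomorphisms is continuous if it maps continuous sections to continuous
sections. -/
theorem Arr.continuous_of_contSec [T2Space Y] [CompactlyCoherentSpace Y] {f : Y → φ.Arr κ}
    (hs : Continuous fun y => (f y).src) (ht : Continuous fun y => (f y).tgt)
    (h : ∀ (s : S) (W : Set Y) (v : ∀ y : W, (φ.bundle s).fiber (f y).src),
      (φ.bundle s).ContSec (fun y : W => (f y).src) v →
      (φ.bundle s).ContSec (fun y : W => (f y).tgt) fun y => (f y).iso s (v y)) : Continuous f :=
  continuous_of_component hs ht fun s =>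
    HilbertBundle.Arr.continuous_of_contSec (f := fun y => (f y).component s) hs ht (h s)

theorem Arr.contSec {f : Y → φ.Arr κ} (hf : Continuous f) {s : S}
    {v : ∀ y, (φ.bundle s).fiber (f y).src}
    (hv : (φ.bundle s).ContSec (fun y => (f y).src) v) :
    (φ.bundle s).ContSec (fun y => (f y).tgt) fun y => (f y).iso s (v y) :=
  HilbertBundle.ContSec.arr ((continuous_component s).comp hf) hv

theorem Arr.ratio_component_eq (m : φ.Arr κ) (s s' : S)
    (hs : ¬ Subsingleton ((φ.bundle s).fiber m.src))
    (hs' : ¬ Subsingleton ((φ.bundle s').fiber m.src)) :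
    (m.component s).ratio = (m.component s').ratio := by
  by_cases hκ : κ = .smod
  · subst hκ
    have h := m.adm
    obtain ⟨r, hr, h⟩ := h
    rw [not_subsingleton_iff_nontrivial] at hs hs'
    obtain ⟨v, hv⟩ := exists_ne (0 : (φ.bundle s).fiber m.src)
    obtain ⟨v', hv'⟩ := exists_ne (0 : (φ.bundle s').fiber m.src)
    rw [(m.component s).ratio_eq rfl hv (h s v), (m.component s').ratio_eq rfl hv' (h s' v')]
  · rw [HilbertBundle.Arr.ratio_of_ne hκ, HilbertBundle.Arr.ratio_of_ne hκ]

/-- A family of isomorphisms of the same kind is admissible if all ratios are equal (up to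
zero-dimensional fibres). -/
theorem _root_.ModKind.adm_of_ratio_eq {x y : φ.base}
    (f : ∀ s, (φ.bundle s).fiber x ≃ₗ[𝕜] (φ.bundle s).fiber y)
    (hf : ∀ s, κ.Adm (𝕜 := 𝕜) (S := Unit) (V := fun _ => (φ.bundle s).fiber x)
      (W := fun _ => (φ.bundle s).fiber y) (fun _ => f s))
    (h : ∀ s s', ¬ Subsingleton ((φ.bundle s).fiber x) → ¬ Subsingleton ((φ.bundle s').fiber x) →
      HilbertBundle.Arr.ratio (κ := κ) ⟨x, y, f s, hf s⟩ =
        HilbertBundle.Arr.ratio (κ := κ) ⟨x, y, f s', hf s'⟩) : κ.Adm (𝕜 := 𝕜) f := by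
  cases κ with
  | mod => trivial
  | imod => exact fun s v => hf s () v
  | smod =>
    have hn := fun s => HilbertBundle.Arr.norm_iso (κ := .smod) nofun ⟨x, y, f s, hf s⟩
    by_cases hex : ∃ s, ¬ Subsingleton ((φ.bundle s).fiber x)
    · obtain ⟨s, hs⟩ := hex
      refine ⟨_, HilbertBundle.Arr.ratio_pos (κ := .smod) ⟨x, y, f s, hf s⟩, fun s' v => ?_⟩
      by_cases hs' : Subsingleton ((φ.bundle s').fiber x)
      · rw [Subsingleton.elim v 0]
        simp
      · rw [h s s' hs hs']
        exact hn s' v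
    · push Not at hex
      refine ⟨1, one_pos, fun s v => ?_⟩
      have := hex s
      rw [Subsingleton.elim v 0]
      simp

/-- A family of arrows comes from a morphism iff sources and targets agree and, up to
zero-dimensional fibres, all ratios are equal. These are closed conditions. -/
theorem Arr.isClosedEmbedding (hφ : T2Space φ.base) :
    IsClosedEmbedding fun m : φ.Arr κ => (CompactCoherentification.mk
      (φ.base × φ.base × ∀ s, (φ.bundle s).Arr κ) (m.src, m.tgt, m.component)) := by
  refine ⟨⟨⟨rfl⟩, fun m m' h => ?_⟩, ?_⟩
  · obtain ⟨x, y, f, hf⟩ := m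
    obtain ⟨x', y', f', hf'⟩ := m'
    have h' := (CompactCoherentification.mk _).injective h
    obtain rfl : x = x' := congrArg (fun z => z.1) h'
    obtain rfl : y = y' := congrArg (fun z => z.2.1) h'
    refine Arr.ext_iso fun s v => ?_
    have h1 := congrFun (congrArg (fun z => z.2.2) h') s
    have h2 := (HilbertBundle.Arr.mk.injEq ..).mp h1
    have h3 := eq_of_heq h2.2.2
    exact LinearEquiv.congr_fun h3 v
  · let A : Set (φ.base × φ.base × ∀ s, (φ.bundle s).Arr κ) :=
      {z | (∀ s, (z.2.2 s).src = z.1) ∧ (∀ s, (z.2.2 s).tgt = z.2.1) ∧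
        ∀ s s', Subsingleton ((φ.bundle s).fiber z.1) ∨ Subsingleton ((φ.bundle s').fiber z.1) ∨
          (z.2.2 s).ratio = (z.2.2 s').ratio}
    have hc : ∀ s, Continuous fun z : φ.base × φ.base × ∀ s, (φ.bundle s).Arr κ => z.2.2 s :=
      fun s => (continuous_apply s).comp (continuous_snd.comp continuous_snd)
    have hA : IsClosed A := by
      simp only [A, Set.ofPred_and, Set.ofPred_forall, Set.ofPred_or]
      refine IsClosed.inter (isClosed_iInter fun s => ?_) (IsClosed.inter
        (isClosed_iInter fun s => ?_) (isClosed_iInter fun s => isClosed_iInter fun s' =>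
          IsClosed.union ?_ (IsClosed.union ?_ ?_)))
      · exact isClosed_eq (HilbertBundle.Arr.continuous_src.comp (hc s)) continuous_fst
      · exact isClosed_eq (HilbertBundle.Arr.continuous_tgt.comp (hc s))
          (continuous_fst.comp continuous_snd)
      · exact (φ.bundle s).isClosed_subsingleton.preimage continuous_fst
      · exact (φ.bundle s').isClosed_subsingleton.preimage continuous_fst
      · exact isClosed_eq (HilbertBundle.Arr.continuous_ratio.comp (hc s))
          (HilbertBundle.Arr.continuous_ratio.comp (hc s'))
    have := hA.preimage (CompactCoherentification.continuous_mk_symm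
      (X := φ.base × φ.base × ∀ s, (φ.bundle s).Arr κ))
    convert this using 1
    ext z
    constructor
    · rintro ⟨m, rfl⟩
      refine ⟨fun s => rfl, fun s => rfl, fun s s' => ?_⟩
      by_contra! hcon
      obtain ⟨h1, h2, h3⟩ := hcon
      exact h3 (m.ratio_component_eq s s' (not_subsingleton_iff_nontrivial.2 h1)
        (not_subsingleton_iff_nontrivial.2 h2))
    · obtain ⟨⟨x, y, m⟩, rfl⟩ := (CompactCoherentification.mk _).surjective z
      rintro ⟨h1, h2, h3⟩
      choose src tgt iso adm hm using fun s => (⟨_, _, _, _, rfl⟩ : ∃ a b f h,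
        m s = (⟨a, b, f, h⟩ : (φ.bundle s).Arr κ))
      obtain rfl : m = fun s => ⟨src s, tgt s, iso s, adm s⟩ := funext hm
      obtain rfl : src = fun _ => x := funext h1
      obtain rfl : tgt = fun _ => y := funext h2
      refine ⟨⟨x, y, iso, ModKind.adm_of_ratio_eq iso adm fun s s' hs hs' => ?_⟩, rfl⟩
      exact ((h3 s s').resolve_left hs).resolve_left hs'

theorem Arr.isKSpace (hφ : IsKSpace φ.base) : IsKSpace (φ.Arr κ) := by
  have := hφ.t2
  exact isKSpace_kify.of_isClosedEmbedding (Arr.isClosedEmbedding hφ.t2)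

/-- The action of an isomorphism on a vector, as a point of the total space. The base point of the
vector is only required to be equal to the source, which is needed for composable pairs. -/
def Arr.act (m : φ.Arr κ) (s : S) (e : (φ.bundle s).Total) (h : e.proj = m.src) :
    (φ.bundle s).Total :=
  ⟨m.tgt, m.iso s (h ▸ e.snd)⟩

theorem Arr.continuous_act {f : Y → φ.Arr κ} (hf : Continuous f) {s : S}
    {E : Y → (φ.bundle s).Total} (hE : Continuous E) (h : ∀ y, (E y).proj = (f y).src) :
    Continuous fun y => (f y).act s (E y) (h y) := by
  refine Arr.contSec hf (v := fun y => h y ▸ (E y).snd) ?_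
  refine hE.congr fun y => ?_
  have : ∀ (e : (φ.bundle s).Total) (x) (hx : e.proj = x), e = ⟨x, hx ▸ e.snd⟩ := by
    rintro ⟨x, v⟩ _ rfl
    rfl
  exact this _ _ _

theorem Arr.comp_iso (f g : φ.Arr κ) (h : f.tgt = g.src) (s : S)
    (v : (φ.bundle s).fiber (f.comp g h).src) :
    (⟨(f.comp g h).tgt, (f.comp g h).iso s v⟩ : (φ.bundle s).Total) =
      g.act s (f.act s ⟨(f.comp g h).src, v⟩ ((φ.cat κ).src_comp f g h)) h := by
  obtain ⟨x, y, f, hf⟩ := f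
  obtain ⟨y', z, g, hg⟩ := g
  obtain rfl : y = y' := h
  rfl

theorem Arr.comp_eq_comp {x y y' z : φ.base}
    {f : ∀ s, (φ.bundle s).fiber x ≃ₗ[𝕜] (φ.bundle s).fiber y}
    {g : ∀ s, (φ.bundle s).fiber y ≃ₗ[𝕜] (φ.bundle s).fiber z}
    {f' : ∀ s, (φ.bundle s).fiber x ≃ₗ[𝕜] (φ.bundle s).fiber y'}
    {g' : ∀ s, (φ.bundle s).fiber y' ≃ₗ[𝕜] (φ.bundle s).fiber z} {hf : κ.Adm (𝕜 := 𝕜) f}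
    {hg : κ.Adm (𝕜 := 𝕜) g} {hf' : κ.Adm (𝕜 := 𝕜) f'} {hg' : κ.Adm (𝕜 := 𝕜) g'}
    (H : ∀ s v, g s (f s v) = g' s (f' s v)) :
    Arr.comp ⟨x, y, f, hf⟩ ⟨y, z, g, hg⟩ rfl = Arr.comp ⟨x, y', f', hf'⟩ ⟨y', z, g', hg'⟩ rfl :=
  Arr.ext_iso H

/-- Continuity of identities and composites is verified on continuous sections. -/
theorem isKCat_cat (hφ : IsKSpace φ.base) : (φ.cat κ).IsKCat := by
  have hA : IsKSpace (φ.Arr κ) := Arr.isKSpace hφ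
  have := hφ.t2
  have := hφ.coherent
  have := hA.t2
  refine ⟨hφ, hA, Arr.continuous_src, Arr.continuous_tgt, ?_, ?_⟩
  · exact Arr.continuous_of_contSec (Y := φ.base) continuous_id continuous_id fun s W v hv => hv
  · let B := {q : φ.Arr κ × φ.Arr κ // q.1.tgt = q.2.src}
    have hB : Continuous fun q : 𝐤 B => (CompactCoherentification.mk B).symm q :=
      CompactCoherentification.continuous_mk_symm
    have h1 : Continuous fun q : 𝐤 B => ((CompactCoherentification.mk B).symm q).1.1 :=
      continuous_fst.comp (continuous_subtype_val.comp hB)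
    have h2 : Continuous fun q : 𝐤 B => ((CompactCoherentification.mk B).symm q).1.2 :=
      continuous_snd.comp (continuous_subtype_val.comp hB)
    refine Arr.continuous_of_contSec (Y := 𝐤 B) ?_ ?_ fun s W v hv => ?_
    · exact (Arr.continuous_src.comp h1).congr fun q => ((φ.cat κ).src_comp _ _ _).symm
    · exact (Arr.continuous_tgt.comp h2).congr fun q => ((φ.cat κ).tgt_comp _ _ _).symm
    · have hv1 := Arr.continuous_act (h1.comp continuous_subtype_val) hv
        fun y => (φ.cat κ).src_comp _ _ _
      refine (Arr.continuous_act (h2.comp continuous_subtype_val) hv1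
        fun y => ((CompactCoherentification.mk B).symm y.1).2).congr fun y => ?_
      exact (Arr.comp_iso _ _ _ _ _).symm

end Arr

/-! ### Functors induced by morphisms of families of bundles -/

section Hom

variable {γ : GammaHom S T} {φ : FibObj.{u} 𝕜 T} {ψ : FibObj.{u} 𝕜 S} (a : Hom γ φ ψ)

theorem Hom.contSec {x : Y → φ.base} (hx : Continuous x) {s : S}
    {v : ∀ (y) (t : γ.toFun s), (φ.bundle t).fiber (x y)}
    (hv : ∀ t : γ.toFun s, (φ.bundle t).ContSec x fun y => v y t) :
    (ψ.bundle s).ContSec (fun y => a.base (x y)) fun y => a.linEquiv s (x y) (v y) := by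
  have h : Continuous fun y => (⟨x y, v y⟩ : φ.WhitneySum (γ.toFun s)) :=
    continuous_induced_rng.2 (hx.prodMk (continuous_pi hv))
  exact (a.continuous_total s).comp h

theorem Hom.inner_linEquiv (s : S) (x : φ.base) [Fintype (γ.toFun s)]
    (v v' : ∀ t : γ.toFun s, (φ.bundle t).fiber x) :
    ⟪a.linEquiv s x v, a.linEquiv s x v'⟫_𝕜 = ∑ t, ⟪v t, v' t⟫_𝕜 := by
  let L : PiLp 2 (fun t : γ.toFun s => (φ.bundle t).fiber x) →ₗ[𝕜] (ψ.bundle s).fiber (a.base x) :=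
    (a.linEquiv s x).toLinearMap.comp (WithLp.linearEquiv 2 𝕜 _).toLinearMap
  have hL : ∀ w, ‖L w‖ = ‖w‖ := fun w => by
    refine (pow_left_inj₀ (norm_nonneg _) (norm_nonneg _) two_ne_zero).1 ?_
    rw [PiLp.norm_sq_eq_of_L2]
    exact (a.isometry s x _).trans (finsum_eq_sum_of_fintype _)
  have := (LinearMap.norm_map_iff_inner_map_map L).1 hL (WithLp.toLp 2 v) (WithLp.toLp 2 v')
  rw [PiLp.inner_apply] at this
  exact this

/-- The components of the inverse of a morphism on the fibres preserve continuity of sections, since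
they are adjoint to the restrictions of the morphism to the summands. -/
theorem Hom.contSec_symm [Finite T] {x : Y → φ.base} (hx : Continuous x) {s : S}
    {v : ∀ y, (ψ.bundle s).fiber (a.base (x y))}
    (hv : (ψ.bundle s).ContSec (fun y => a.base (x y)) v) (t : γ.toFun s) :
    (φ.bundle t).ContSec x fun y => (a.linEquiv s (x y)).symm (v y) t := by
  classical
  have := Fintype.ofFinite (γ.toFun s)
  refine HilbertBundle.contSec_iff.2 ⟨hx, fun F k => ?_⟩
  have hx' : Continuous fun y : x ⁻¹' F.U => x y := hx.comp continuous_subtype_val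
  let e : ∀ (y : x ⁻¹' F.U) (t' : γ.toFun s), (φ.bundle t').fiber (x y) :=
    fun y => Pi.single t (F.sec (x y) k)
  have he : ∀ t' : γ.toFun s, (φ.bundle t').ContSec (fun y : x ⁻¹' F.U => x y) fun y => e y t' := by
    intro t'
    by_cases h : t' = t
    · subst h
      simp only [e, Pi.single_eq_same]
      exact F.contSec hx' (fun y => y.2) k
    · simp only [e, Pi.single_eq_of_ne h]
      exact HilbertBundle.contSec_zero hx'
  refine ((a.contSec hx' he).inner (hv.comp continuous_subtype_val)).congr fun y => ?_
  obtain ⟨w, hw⟩ := (a.linEquiv s (x y)).surjective (v y)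
  rw [← hw, LinearEquiv.symm_apply_apply, a.inner_linEquiv, Finset.sum_eq_single t]
  · simp [e]
  · intro t' _ h
    simp [e, Pi.single_eq_of_ne h]
  · simp

theorem Hom.continuous_mapArr [Finite T] [T2Space Y] [CompactlyCoherentSpace Y] {f : Y → φ.Arr κ}
    (hf : Continuous f) : Continuous fun y => a.mapArr κ (f y) := by
  refine Arr.continuous_of_contSec
    (show Continuous fun y => a.base (f y).src from
      a.continuous_base.comp (Arr.continuous_src.comp hf))
    (show Continuous fun y => a.base (f y).tgt from
      a.continuous_base.comp (Arr.continuous_tgt.comp hf)) fun s W v hv => ?_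
  have hW : Continuous fun y : W => f y := hf.comp continuous_subtype_val
  exact a.contSec (Arr.continuous_tgt.comp hW) fun t =>
    Arr.contSec hW (a.contSec_symm (Arr.continuous_src.comp hW) hv t)

theorem Hom.functor_isCont [Finite T] (hφ : IsKSpace φ.base) : (a.functor κ).IsCont := by
  have hA : IsKSpace (φ.Arr κ) := Arr.isKSpace hφ
  have := hA.t2
  have := hA.coherent
  exact ⟨a.continuous_base, a.continuous_mapArr (Y := φ.Arr κ) continuous_id⟩

theorem Hom.functor_id [Finite S] (ψ : FibObj.{u} 𝕜 S) :
    (Hom.id ψ).functor κ = TCat.Fun.refl (ψ.cat κ) := by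
  refine TCat.Fun.ext_mor (funext ?_)
  rintro ⟨x, y, f, hf⟩
  refine Arr.ext_iso fun s v => ?_
  exact congrArg (f s) (((Hom.id ψ).linEquiv s x).apply_symm_apply v)

theorem Hom.functor_comp [Finite T] [Finite U] {δ : GammaHom T U} {χ : FibObj.{u} 𝕜 U}
    (b : Hom δ χ φ) :
    (b.comp a).functor κ = (b.functor κ).comp (a.functor κ) := by
  refine TCat.Fun.ext_mor (funext ?_)
  rintro ⟨x, y, f, hf⟩
  refine Arr.ext_iso fun s v => ?_
  obtain ⟨w, rfl⟩ := ((b.comp a).linEquiv s x).surjective v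
  have h1 : (a.linEquiv s (b.base x)).symm ((b.comp a).linEquiv s x w) =
      fun t : γ.toFun s => b.linEquiv t x fun r => w (inc γ δ s t r) :=
    (LinearEquiv.symm_apply_eq _).2 rfl
  change (b.comp a).linEquiv s y (fun r => f r (((b.comp a).linEquiv s x).symm
    ((b.comp a).linEquiv s x w) r)) = a.linEquiv s (b.base y) fun t => b.linEquiv t y fun r =>
      f r ((b.linEquiv t x).symm ((a.linEquiv s (b.base x)).symm
        ((b.comp a).linEquiv s x w) t) r)
  rw [LinearEquiv.symm_apply_apply, h1]
  refine congrArg (a.linEquiv s (b.base y)) (funext fun t => congrArg (b.linEquiv t y)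
    (funext fun r => congrArg (f r) ?_))
  exact (congrFun ((b.linEquiv t x).symm_apply_apply fun r => w (inc γ δ s t r)) r).symm

end Hom

end FibObj

/-! ### Rescaling similarities -/

/-- Families of unitary isomorphisms are admissible for all kinds. -/
theorem ModKind.adm_of_norm_eq {𝕜 : Type w} [RCLike 𝕜] {κ : ModKind} {S : Type v}
    {V W : S → Type u} [∀ s, NormedAddCommGroup (V s)]
    [∀ s, InnerProductSpace 𝕜 (V s)] [∀ s, NormedAddCommGroup (W s)]
    [∀ s, InnerProductSpace 𝕜 (W s)] {f : ∀ s, V s ≃ₗ[𝕜] W s}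
    (h : κ ≠ .mod → ∀ s v, ‖f s v‖ = ‖v‖) : κ.Adm (𝕜 := 𝕜) f := by
  cases κ with
  | mod => trivial
  | imod => exact h fun h => by cases h
  | smod => exact ⟨1, one_pos, fun s v => by rw [h (fun h => by cases h), one_mul]⟩

namespace HilbertBundle

variable {𝕜 : Type w} [RCLike 𝕜] {X : Type u} [TopologicalSpace X] {p : HilbertBundle 𝕜 X}
  {κ : ModKind}

/-- The positive real by which an isomorphism of ratio `r` is multiplied: `r ^ (-t)`. -/
noncomputable def Arr.scalar (t : ℝ) (m : p.Arr κ) : ℝ := m.ratio ^ (-t)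

theorem Arr.scalar_pos (t : ℝ) (m : p.Arr κ) : 0 < m.scalar t := Real.rpow_pos_of_pos m.ratio_pos _

theorem Arr.scalar_ne_zero (t : ℝ) (m : p.Arr κ) : (m.scalar t : 𝕜) ≠ 0 :=
  RCLike.ofReal_ne_zero.2 (m.scalar_pos t).ne'

theorem Arr.norm_scalar_smul (hκ : κ ≠ .mod) (t : ℝ) (m : p.Arr κ) (v : p.fiber m.src) :
    ‖(m.scalar t : 𝕜) • m.iso v‖ = m.ratio ^ (1 - t) * ‖v‖ := by
  rw [norm_smul, RCLike.norm_ofReal, abs_of_pos (m.scalar_pos t), m.norm_iso hκ, ← mul_assoc,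
    scalar, sub_eq_neg_add, Real.rpow_add m.ratio_pos, Real.rpow_one]

end HilbertBundle

namespace FibObj

variable {𝕜 : Type w} [RCLike 𝕜] {S T U : Type} {κ : ModKind}
variable {Y : Type*} [TopologicalSpace Y]

section Scale

variable {φ : FibObj.{u} 𝕜 S}

/-- The family obtained from a family of similarities of ratio `r` by multiplication with
`r ^ (-t)`. It is unitary for `t = 1`. Families of isomorphisms of the other kinds are not
changed. -/
noncomputable def Arr.scale (t : ℝ) (m : φ.Arr κ) : φ.Arr κ where
  src := m.src
  tgt := m.tgt
  iso s := (m.iso s).trans (LinearEquiv.smulOfNeZero 𝕜 _ _ ((m.component s).scalar_ne_zero t))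
  adm := by
    by_cases hκ : κ = .smod
    · subst hκ
      have hn := fun s => (m.component s).norm_scalar_smul (by simp) t
      by_cases hex : ∃ s, ¬ Subsingleton ((φ.bundle s).fiber m.src)
      · obtain ⟨s, hs⟩ := hex
        refine ⟨_, Real.rpow_pos_of_pos (m.component s).ratio_pos (1 - t), fun s' v => ?_⟩
        by_cases hs' : Subsingleton ((φ.bundle s').fiber m.src)
        · rw [Subsingleton.elim v 0]
          simp
        · rw [m.ratio_component_eq s s' hs hs']
          exact hn s' v
      · push Not at hex
        refine ⟨1, one_pos, fun s v => ?_⟩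
        have := hex s
        rw [Subsingleton.elim v 0]
        simp
    · refine ModKind.adm_of_norm_eq fun hm s v => ?_
      refine ((m.component s).norm_scalar_smul hm t v).trans ?_
      rw [HilbertBundle.Arr.ratio_of_ne hκ, Real.one_rpow, one_mul]
      rfl

theorem Arr.norm_scale_one (hκ : κ ≠ .mod) (m : φ.Arr κ) (s : S)
    (v : (φ.bundle s).fiber m.src) : ‖(m.scale 1).iso s v‖ = ‖v‖ :=
  ((m.component s).norm_scalar_smul hκ 1 v).trans (by rw [sub_self, Real.rpow_zero, one_mul]; rfl)

/-- Ratios are multiplicative, which makes rescaling functorial. -/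
theorem Arr.ratio_comp (f g : φ.Arr κ) (h : f.tgt = g.src) (s : S) :
    ((f.comp g h).component s).ratio = (f.component s).ratio * (g.component s).ratio := by
  obtain ⟨x, y, f, hf⟩ := f
  obtain ⟨y', z, g, hg⟩ := g
  obtain rfl : y = y' := h
  by_cases hκ : κ = .smod
  · by_cases hs : Subsingleton ((φ.bundle s).fiber x)
    · have hs' : Subsingleton ((φ.bundle s).fiber y) := (f s).symm.injective.subsingleton
      rw [HilbertBundle.Arr.ratio_of_subsingleton _ hs,
        HilbertBundle.Arr.ratio_of_subsingleton _ hs,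
        HilbertBundle.Arr.ratio_of_subsingleton _ hs', one_mul]
    · rw [not_subsingleton_iff_nontrivial] at hs
      obtain ⟨v, hv⟩ := exists_ne (0 : (φ.bundle s).fiber x)
      refine HilbertBundle.Arr.ratio_eq hκ _ hv ?_
      have h1 := (Arr.component (κ := κ) ⟨x, y, f, hf⟩ s).norm_iso (by simp [hκ]) v
      have h2 := (Arr.component (κ := κ) ⟨y, z, g, hg⟩ s).norm_iso (by simp [hκ]) (f s v)
      have h3 : ∀ {r₁ r₂ r₃ r₄ r₅ : ℝ}, r₁ = r₂ * r₃ → r₃ = r₄ * r₅ → r₁ = r₄ * r₂ * r₅ := by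
        rintro _ r₂ _ r₄ r₅ rfl rfl
        ring
      exact h3 h2 h1
  · simp only [HilbertBundle.Arr.ratio_of_ne hκ, one_mul]

theorem Arr.scalar_comp (t : ℝ) (f g : φ.Arr κ) (h : f.tgt = g.src) (s : S) :
    ((f.comp g h).component s).scalar t = (f.component s).scalar t * (g.component s).scalar t := by
  simp only [HilbertBundle.Arr.scalar, ratio_comp]
  exact Real.mul_rpow (HilbertBundle.Arr.ratio_pos _).le (HilbertBundle.Arr.ratio_pos _).le

theorem Arr.ratio_id (x : φ.base) (s : S) : ((Arr.id κ φ x).component s).ratio = 1 := by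
  by_cases hκ : κ = .smod
  · by_cases hs : Subsingleton ((φ.bundle s).fiber x)
    · exact HilbertBundle.Arr.ratio_of_subsingleton _ hs
    · rw [not_subsingleton_iff_nontrivial] at hs
      obtain ⟨v, hv⟩ := exists_ne (0 : (φ.bundle s).fiber x)
      exact HilbertBundle.Arr.ratio_eq hκ _ hv (one_mul _).symm
  · exact HilbertBundle.Arr.ratio_of_ne hκ _

variable (φ κ) in
/-- Rescaling of similarities, as a functor. -/
noncomputable def scaleFun (t : ℝ) : TCat.Fun (φ.cat κ) (φ.cat κ) where
  ob x := x
  mor m := Arr.scale t m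
  src_mor _ := rfl
  tgt_mor _ := rfl
  mor_id := fun (x : φ.base) => by
    refine Arr.ext_iso fun s v => ?_
    change (((Arr.id κ φ x).component s).scalar t : 𝕜) • v = v
    rw [HilbertBundle.Arr.scalar, Arr.ratio_id, Real.one_rpow, RCLike.ofReal_one, one_smul]
  mor_comp := fun (f g : φ.Arr κ) h => by
    have hr := Arr.scalar_comp t f g h
    obtain ⟨x, y, f, hf⟩ := f
    obtain ⟨y', z, g, hg⟩ := g
    obtain rfl : y = y' := h
    refine Arr.ext_iso fun s v => ?_
    have h1 : ∀ r r' : ℝ, ((r * r' : ℝ) : 𝕜) • g s (f s v) = (r' : 𝕜) • g s ((r : 𝕜) • f s v) := by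
      intro r r'
      rw [map_smul, smul_smul, RCLike.ofReal_mul, mul_comm]
    exact (congrArg (fun r : ℝ => (r : 𝕜) • g s (f s v)) (hr s)).trans (h1 _ _)

theorem Arr.continuous_scale (hφ : IsKSpace φ.base) :
    Continuous fun q : φ.Arr κ × unitInterval => q.1.scale (q.2 : ℝ) := by
  have hA : IsKSpace (φ.Arr κ) := Arr.isKSpace hφ
  have := hA.t2
  have := hA.coherent
  refine Arr.continuous_of_contSec
    (show Continuous fun q : φ.Arr κ × unitInterval => q.1.src from
      Arr.continuous_src.comp continuous_fst)
    (show Continuous fun q : φ.Arr κ × unitInterval => q.1.tgt from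
      Arr.continuous_tgt.comp continuous_fst) fun s W v hv => ?_
  have h1 : Continuous fun q : W => q.1.1 := continuous_fst.comp continuous_subtype_val
  have h2 : Continuous fun q : W => (q.1.2 : ℝ) :=
    continuous_subtype_val.comp (continuous_snd.comp continuous_subtype_val)
  have h3 : Continuous fun q : W => (q.1.1.component s).scalar (q.1.2 : ℝ) :=
    (HilbertBundle.Arr.continuous_ratio.comp ((Arr.continuous_component s).comp h1)).rpow h2.neg
      fun q => Or.inl (HilbertBundle.Arr.ratio_pos _).ne'
  exact (Arr.contSec h1 hv).smul (RCLike.continuous_ofReal.comp h3)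

theorem scaleFun_isCont (hφ : IsKSpace φ.base) (t : unitInterval) :
    (φ.scaleFun κ (t : ℝ)).IsCont := by
  have h : Continuous fun m : φ.Arr κ => m.scale (t : ℝ) :=
    (Arr.continuous_scale hφ).comp (Continuous.prodMk_left t)
  exact ⟨continuous_id, h⟩

theorem scaleFun_zero : φ.scaleFun κ 0 = TCat.Fun.refl (φ.cat κ) := by
  refine TCat.Fun.ext_mor (funext ?_)
  rintro ⟨x, y, f, hf⟩
  refine Arr.ext_iso fun s v => ?_
  change (HilbertBundle.Arr.scalar 0 (Arr.component _ s) : 𝕜) • f s v = f s v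
  rw [HilbertBundle.Arr.scalar, neg_zero, Real.rpow_zero, RCLike.ofReal_one, one_smul]

end Scale

/-! ### Comparison of `φ(𝐧)` with `n.φ(𝟏)` -/

section Single

variable {γ : GammaHom S T} {φ : FibObj.{u} 𝕜 T} {ψ : FibObj.{u} 𝕜 S} (a : Hom γ φ ψ)

/-- The isomorphism `(E_t)_x → (E'_s)_{a(x)}` given by a morphism over `γ`, if `γ(s) = {t}`. -/
noncomputable def Hom.single (s : S) (t : T) (h : γ.toFun s = {t}) (x : φ.base) :
    (φ.bundle t).fiber x ≃ₗ[𝕜] (ψ.bundle s).fiber (a.base x) :=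
  have ht : t ∈ γ.toFun s := by rw [h]; rfl
  let _ : Unique (γ.toFun s) := ⟨⟨⟨t, ht⟩⟩, fun t' => Subtype.ext (h ▸ t'.2 : t'.1 ∈ ({t} : Set T))⟩
  (LinearEquiv.piUnique 𝕜 fun t : γ.toFun s => (φ.bundle t).fiber x).symm.trans (a.linEquiv s x)

variable {a} {s : S} {t : T} (h : γ.toFun s = {t})

theorem Hom.single_apply (x : φ.base) (v : ∀ t : γ.toFun s, (φ.bundle t).fiber x) :
    a.single s t h x (v ⟨t, by rw [h]; rfl⟩) = a.linEquiv s x v := by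
  refine congrArg (a.linEquiv s x) (funext fun t' => ?_)
  obtain ⟨t', ht'⟩ := t'
  obtain rfl : t' = t := by rw [h] at ht'; exact ht'
  rfl

/-- As `γ(s) = {t}`, a vector of `(E_t)_x` is the same as a family of vectors indexed by `γ(s)`. -/
theorem Hom.exists_family_eq (x : φ.base) (v : (φ.bundle t).fiber x) :
    ∃ v' : ∀ t : γ.toFun s, (φ.bundle t).fiber x, v' ⟨t, by rw [h]; rfl⟩ = v :=
  have ht : t ∈ γ.toFun s := by rw [h]; rfl
  let _ : Unique (γ.toFun s) := ⟨⟨⟨t, ht⟩⟩, fun t' => Subtype.ext (h ▸ t'.2 : t'.1 ∈ ({t} : Set T))⟩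
  ⟨(LinearEquiv.piUnique 𝕜 fun t : γ.toFun s => (φ.bundle t).fiber x).symm v, rfl⟩

theorem Hom.norm_single (x : φ.base) (v : (φ.bundle t).fiber x) :
    ‖a.single s t h x v‖ = ‖v‖ := by
  obtain ⟨v, rfl⟩ := Hom.exists_family_eq h x v
  refine (pow_left_inj₀ (norm_nonneg _) (norm_nonneg _) two_ne_zero).1 ?_
  rw [single_apply]
  refine (a.isometry s x v).trans (finsum_eq_single _ _ ?_)
  rintro ⟨t', ht'⟩ hne
  rw [h] at ht'
  exact absurd (Subtype.ext (Set.mem_singleton_iff.1 ht')) hne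

theorem Hom.contSec_single {x : Y → φ.base} (hx : Continuous x)
    {v : ∀ y, (φ.bundle t).fiber (x y)} (hv : (φ.bundle t).ContSec x v) :
    (ψ.bundle s).ContSec (fun y => a.base (x y)) fun y => a.single s t h (x y) (v y) := by
  choose v' hv' using fun y => Hom.exists_family_eq h (x y) (v y)
  obtain rfl := funext hv'
  simp only [single_apply]
  refine a.contSec hx fun t' => ?_
  obtain ⟨t', ht'⟩ := t'
  obtain rfl : t' = t := by rw [h] at ht'; exact ht'
  exact hv

/-- If `γ(s) = {t}`, the `s`-component of the image of a morphism is conjugate to its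
`t`-component. -/
theorem Hom.mapArr_single [Finite T] (m : φ.Arr κ) (v : (φ.bundle t).fiber m.src) :
    (a.mapArr κ m).iso s (a.single s t h m.src v) = a.single s t h m.tgt (m.iso t v) := by
  obtain ⟨v, rfl⟩ := Hom.exists_family_eq h m.src v
  rw [single_apply]
  refine Eq.trans ?_ (single_apply h m.tgt fun t' => m.iso t' (v t')).symm
  change a.linEquiv s m.tgt (fun t' => m.iso t' ((a.linEquiv s m.src).symm
    (a.linEquiv s m.src v) t')) = _
  rw [LinearEquiv.symm_apply_apply]

/-- A morphism preserves the ratios of similarities. -/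
theorem Hom.ratio_mapArr [Finite T] (h : γ.toFun s = {t}) (m : φ.Arr κ) :
    ((a.mapArr κ m).component s).ratio = (m.component t).ratio := by
  by_cases hκ : κ = .smod
  · by_cases hs : Subsingleton ((φ.bundle t).fiber m.src)
    · have hs' : Subsingleton ((ψ.bundle s).fiber (a.base m.src)) :=
        (a.single s t h m.src).symm.injective.subsingleton
      rw [HilbertBundle.Arr.ratio_of_subsingleton (m.component t) hs]
      exact HilbertBundle.Arr.ratio_of_subsingleton _ hs'
    · rw [not_subsingleton_iff_nontrivial] at hs
      obtain ⟨v, hv⟩ := exists_ne (0 : (φ.bundle t).fiber m.src)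
      refine HilbertBundle.Arr.ratio_eq hκ _ (v := a.single s t h m.src v) ?_ ?_
      · exact (a.single s t h m.src).map_ne_zero_iff.2 hv
      · refine (congrArg norm (mapArr_single h m v)).trans ((norm_single h _ _).trans ?_)
        exact ((m.component t).norm_iso (by simp [hκ]) v).trans
          (congrArg (_ * ·) (norm_single h m.src v).symm)
  · rw [HilbertBundle.Arr.ratio_of_ne hκ, HilbertBundle.Arr.ratio_of_ne hκ]

theorem Hom.scalar_mapArr [Finite T] (t₀ : ℝ) (h : γ.toFun s = {t}) (m : φ.Arr κ) :
    ((a.mapArr κ m).component s).scalar t₀ = (m.component t).scalar t₀ := by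
  rw [HilbertBundle.Arr.scalar, ratio_mapArr h, HilbertBundle.Arr.scalar]

end Single

section Sum

variable {φ₁ : FibObj.{u} 𝕜 (Fin 1)} {n : ℕ}

/-- The pull-back of a bundle is a fibre product, so its sections along `b` are those of the bundle
along the composite with `f`. -/
theorem _root_.HilbertBundle.contSec_pullback {X X' : Type u} [TopologicalSpace X]
    [TopologicalSpace X'] {p : HilbertBundle 𝕜 X} {f : X' → X} {hf : Continuous f} {b : Y → X'}
    {v : ∀ y, p.fiber (f (b y))} : (p.pullback f hf).ContSec b v ↔
      Continuous b ∧ p.ContSec (fun y => f (b y)) v := by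
  refine Iff.trans (continuous_induced_rng
    (f := fun v : Bundle.TotalSpace 𝕜 (fun y => p.fiber (f y)) =>
      ((v.proj, ⟨f v.proj, v.snd⟩) : X' × p.Total))) ?_
  exact continuous_prodMk

theorem contSec_nsum {b : Y → Fin n → φ₁.base} {i : Fin n}
    {v : ∀ y, (φ₁.bundle 0).fiber (b y i)} : ((φ₁.nsum n).bundle i).ContSec b v ↔
      Continuous b ∧ (φ₁.bundle 0).ContSec (fun y => b y i) v :=
  HilbertBundle.contSec_pullback (f := fun x : Fin n → φ₁.base => x i) (hf := continuous_apply i)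

/-- The morphism of `n.φ₁` given by a family of `n` unitary morphisms of `φ₁`. -/
def assemble (M : Fin n → φ₁.Arr κ) (hM : κ ≠ .mod → ∀ i v, ‖(M i).iso 0 v‖ = ‖v‖) :
    (φ₁.nsum n).Arr κ where
  src i := (M i).src
  tgt i := (M i).tgt
  iso i := (M i).iso 0
  adm := ModKind.adm_of_norm_eq (V := fun i => (φ₁.bundle 0).fiber (M i).src)
    (W := fun i => (φ₁.bundle 0).fiber (M i).tgt) hM

theorem assemble_comp (M M' : Fin n → φ₁.Arr κ) (h : ∀ i, (M i).tgt = (M' i).src)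
    (hM : κ ≠ .mod → ∀ i v, ‖(M i).iso 0 v‖ = ‖v‖) (hM' : κ ≠ .mod → ∀ i v, ‖(M' i).iso 0 v‖ = ‖v‖)
    (hMM' : κ ≠ .mod → ∀ i v, ‖((M i).comp (M' i) (h i)).iso 0 v‖ = ‖v‖) :
    assemble (fun i => (M i).comp (M' i) (h i)) hMM' =
      (assemble M hM).comp (assemble M' hM') (funext h) := by
  choose x y f hf hm using fun i => (⟨_, _, _, _, rfl⟩ : ∃ a b f h,
    M i = (⟨a, b, f, h⟩ : φ₁.Arr κ))
  choose x' y' f' hf' hm' using fun i => (⟨_, _, _, _, rfl⟩ : ∃ a b f h,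
    M' i = (⟨a, b, f, h⟩ : φ₁.Arr κ))
  obtain rfl : M = fun i => ⟨x i, y i, f i, hf i⟩ := funext hm
  obtain rfl : M' = fun i => ⟨x' i, y' i, f' i, hf' i⟩ := funext hm'
  obtain rfl : y = x' := funext h
  rfl

theorem continuous_assemble [T2Space Y] [CompactlyCoherentSpace Y] {M : Y → Fin n → φ₁.Arr κ}
    (hMc : ∀ i, Continuous fun y => M y i)
    (hM : ∀ y, κ ≠ .mod → ∀ i v, ‖(M y i).iso 0 v‖ = ‖v‖) :
    Continuous fun y => assemble (M y) (hM y) := by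
  refine Arr.continuous_of_contSec
    (show Continuous fun y i => (M y i).src from
      continuous_pi fun i => Arr.continuous_src.comp (hMc i))
    (show Continuous fun y i => (M y i).tgt from
      continuous_pi fun i => Arr.continuous_tgt.comp (hMc i)) fun i W v hv => ?_
  have hW : Continuous (Subtype.val : W → Y) := continuous_subtype_val
  refine (contSec_nsum (b := fun y : W => fun i => (M y i).tgt)).2
    ⟨continuous_pi fun i => Arr.continuous_tgt.comp ((hMc i).comp hW), ?_⟩
  exact Arr.contSec ((hMc i).comp hW)
    ((contSec_nsum (b := fun y : W => fun i => (M y i).src)).1 hv).2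

theorem assemble_congr {M M' : Fin n → φ₁.Arr κ} (h : M = M')
    (hM : κ ≠ .mod → ∀ i v, ‖(M i).iso 0 v‖ = ‖v‖)
    (hM' : κ ≠ .mod → ∀ i v, ‖(M' i).iso 0 v‖ = ‖v‖) : assemble M hM = assemble M' hM' := by
  subst h
  rfl

variable (φ₁ κ n) in
/-- The functor from the `n`-th power of the category associated to `φ₁` to the category associated
to `n.φ₁`. Similarities with different ratios do not form an admissible family, therefore they are
made unitary before. -/
noncomputable def combine :
    TCat.Fun (TCat.pi fun _ : Fin n => φ₁.cat κ) ((φ₁.nsum n).cat κ) where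
  ob x i := (TCat.piProj (fun _ : Fin n => φ₁.cat κ) i).ob x
  mor m := assemble (fun i => Arr.scale 1 ((TCat.piProj (fun _ : Fin n => φ₁.cat κ) i).mor m))
    fun hκ _ _ => Arr.norm_scale_one hκ _ _ _
  src_mor m := funext fun i => (TCat.piProj (fun _ : Fin n => φ₁.cat κ) i).src_mor m
  tgt_mor m := funext fun i => (TCat.piProj (fun _ : Fin n => φ₁.cat κ) i).tgt_mor m
  mor_id x := assemble_congr (M' := fun i => Arr.id κ φ₁
    ((TCat.piProj (fun _ : Fin n => φ₁.cat κ) i).ob x)) (funext fun i =>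
    ((TCat.piProj (fun _ : Fin n => φ₁.cat κ) i).comp (φ₁.scaleFun κ 1)).mor_id x)
    (fun hκ _ _ => Arr.norm_scale_one hκ _ _ _) fun _ _ _ => rfl
  mor_comp f g h := by
    let F := fun i => (TCat.piProj (fun _ : Fin n => φ₁.cat κ) i).comp (φ₁.scaleFun κ 1)
    have hc : ∀ i, ((F i).mor f : φ₁.Arr κ).tgt = ((F i).mor g : φ₁.Arr κ).src := fun i =>
      ((F i).tgt_mor f).trans ((congrArg (F i).ob h).trans ((F i).src_mor g).symm)
    refine (assemble_congr (M' := fun i => Arr.comp ((F i).mor f) ((F i).mor g) (hc i))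
      (funext fun i => (F i).mor_comp f g h) _ ?_).trans
        (assemble_comp (fun i => (F i).mor f) (fun i => (F i).mor g) hc
          (fun hκ _ _ => Arr.norm_scale_one hκ _ _ _) (fun hκ _ _ => Arr.norm_scale_one hκ _ _ _) _)
    intro hκ i v
    have : Arr.comp ((F i).mor f) ((F i).mor g) (hc i) = (F i).mor (TCat.comp _ f g h) :=
      ((F i).mor_comp f g h).symm
    revert v
    rw [this]
    exact fun v => Arr.norm_scale_one hκ _ _ _

end Sum

section Segal

variable {φ₁ : FibObj.{u} 𝕜 (Fin 1)} {n : ℕ} {φₙ : FibObj.{u} 𝕜 (Fin n)}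
  (j : Hom (GammaHom.id (Fin n)) (φ₁.nsum n) φₙ) (q : ∀ i, Hom (GammaHom.point i) φₙ φ₁)

variable (κ) in
/-- The functor from the `n`-th power of the category of `φ₁` to the category of `φₙ`. -/
noncomputable def joinFun : TCat.Fun (TCat.pi fun _ : Fin n => φ₁.cat κ) (φₙ.cat κ) :=
  (combine κ φ₁ n).comp (j.functor κ)

variable (κ) in
/-- The functor from the category of `φₙ` to the `n`-th power of the category of `φ₁`. -/
noncomputable def splitFun : TCat.Fun (φₙ.cat κ) (TCat.pi fun _ : Fin n => φ₁.cat κ) :=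
  TCat.piLift fun i => (q i).functor κ

variable {j q}

theorem joinFun_isCont (h₁ : IsKSpace φ₁.base) : (joinFun κ j).IsCont := by
  have hk : (TCat.pi fun _ : Fin n => φ₁.cat κ).IsKCat := TCat.pi_isKCat fun _ => isKCat_cat h₁
  have := hk.mor.t2
  have := hk.mor.coherent
  have hp := fun i => TCat.piProj_isCont (E := fun _ : Fin n => φ₁.cat κ) i
  have hob : Continuous fun x i => (TCat.piProj (fun _ : Fin n => φ₁.cat κ) i).ob x :=
    continuous_pi fun i => (hp i).ob
  have hmor : Continuous (combine κ φ₁ n).mor :=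
    continuous_assemble (M := fun m i =>
        Arr.scale 1 ((TCat.piProj (fun _ : Fin n => φ₁.cat κ) i).mor m))
      (fun i => (scaleFun_isCont h₁ 1).mor.comp (hp i).mor)
      fun _ hκ _ _ => Arr.norm_scale_one hκ _ _ _
  exact ⟨j.continuous_base.comp hob, j.continuous_mapArr hmor⟩

theorem splitFun_isCont (hₙ : IsKSpace φₙ.base) : (splitFun κ q).IsCont :=
  TCat.piLift_isCont (isKCat_cat hₙ) fun i => (q i).functor_isCont hₙ

variable (j q) in
/-- The canonical unitary isomorphism from the `i`-th fibre of `φₙ` at `x` to the `i`-th fibre at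
the point obtained by splitting and joining again. -/
noncomputable def joinSplitIso (x : φₙ.base) (i : Fin n) :
    (φₙ.bundle i).fiber x ≃ₗ[𝕜] (φₙ.bundle i).fiber (j.base fun i => (q i).base x) :=
  ((q i).single 0 i rfl x).trans (j.single i i rfl fun i => (q i).base x)

variable (j q κ) in
/-- The canonical unitary isomorphisms, as a morphism of the category of `φₙ`. -/
noncomputable def joinSplitArr (x : φₙ.base) : φₙ.Arr κ where
  src := x
  tgt := j.base fun i => (q i).base x
  iso := joinSplitIso j q x
  adm := ModKind.adm_of_norm_eq fun _ i v =>
    (Hom.norm_single (a := j) (s := i) (t := i) rfl (fun i => (q i).base x) _).trans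
      (Hom.norm_single (a := q i) (s := 0) (t := i) rfl x v)

theorem continuous_joinSplitArr (hₙ : IsKSpace φₙ.base) : Continuous (joinSplitArr κ j q) := by
  have := hₙ.t2
  have := hₙ.coherent
  have hb : Continuous fun (x : φₙ.base) i => (q i).base x :=
    continuous_pi fun i => (q i).continuous_base
  refine Arr.continuous_of_contSec continuous_id (j.continuous_base.comp hb) fun i W v hv => ?_
  have hW : Continuous (Subtype.val : W → φₙ.base) := continuous_subtype_val
  exact Hom.contSec_single (a := j) (s := i) (t := i) rfl (hb.comp hW)
    (contSec_nsum.2 ⟨hb.comp hW, Hom.contSec_single (a := q i) (s := 0) (t := i) rfl hW hv⟩)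

/-- Naturality of the canonical isomorphisms: splitting, unitarization and joining act on each
component by conjugation with canonical isomorphisms, apart from the scalar factor. -/
theorem scale_comp_joinSplitArr (m : φₙ.Arr κ) :
    Arr.comp (m.scale 1) (joinSplitArr κ j q m.tgt) rfl =
      Arr.comp (joinSplitArr κ j q m.src) (j.mapArr κ ((combine κ φ₁ n).mor ((splitFun κ q).mor m)))
        rfl := by
  refine Arr.comp_eq_comp fun i v => ?_
  have h1 := Hom.mapArr_single (a := q i) (κ := κ) (s := 0) (t := i) rfl m v
  have h2 := Hom.scalar_mapArr (a := q i) (κ := κ) (s := 0) (t := i) 1 rfl m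
  refine Eq.trans ?_ (Hom.mapArr_single (a := j) (κ := κ) (s := i) (t := i) rfl
    ((combine κ φ₁ n).mor ((splitFun κ q).mor m)) ((q i).single 0 i rfl m.src v)).symm
  refine congrArg (j.single i i rfl fun i => (q i).base m.tgt) ?_
  change (q i).single 0 i rfl m.tgt (((m.component i).scalar 1 : 𝕜) • m.iso i v) =
    ((((q i).mapArr κ m).component 0).scalar 1 : 𝕜) •
      ((q i).mapArr κ m).iso 0 ((q i).single 0 i rfl m.src v)
  rw [h1, h2, map_smul]
  rfl

/-- The canonical unitary transformation from the rescaling functor to the functor obtained by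
splitting and joining again. -/
noncomputable def joinSplit (h₁ : IsKSpace φ₁.base) (hₙ : IsKSpace φₙ.base) :
    TCat.FuncMor (φₙ.cat κ) (φₙ.cat κ) where
  dom := ⟨φₙ.scaleFun κ (1 : unitInterval), scaleFun_isCont hₙ 1⟩
  cod := ⟨(splitFun κ q).comp (joinFun κ j), (splitFun_isCont hₙ).comp (joinFun_isCont h₁)⟩
  app := joinSplitArr κ j q
  cont := continuous_joinSplitArr hₙ
  src_app _ := rfl
  tgt_app _ := rfl
  natural := scale_comp_joinSplitArr

variable (j q) in
/-- The canonical unitary isomorphism from the fibre of `φ₁` at the `i`-th one of `n` points to the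
fibre at the `i`-th point obtained by joining and splitting again. -/
noncomputable def splitJoinIso (x : Fin n → φ₁.base) (i : Fin n) (s : Fin 1) :
    (φ₁.bundle s).fiber (x i) ≃ₗ[𝕜] (φ₁.bundle s).fiber ((q i).base (j.base x)) :=
  have e : (φ₁.bundle 0).fiber (x i) ≃ₗ[𝕜] (φₙ.bundle i).fiber (j.base x) := j.single i i rfl x
  Fin.cases (motive := fun s =>
      (φ₁.bundle s).fiber (x i) ≃ₗ[𝕜] (φ₁.bundle s).fiber ((q i).base (j.base x)))
    (e.trans ((q i).single 0 i rfl (j.base x))) finZeroElim s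

variable (j q κ) in
/-- The canonical unitary isomorphism, as a morphism of the category of `φ₁`. -/
noncomputable def splitJoinArr (i : Fin n) (x : Fin n → φ₁.base) : φ₁.Arr κ where
  src := x i
  tgt := (q i).base (j.base x)
  iso := splitJoinIso j q x i
  adm := ModKind.adm_of_norm_eq fun _ s v => by
    obtain rfl : s = 0 := Subsingleton.elim _ _
    exact (Hom.norm_single (a := q i) (s := 0) (t := i) rfl (j.base x) _).trans
      (Hom.norm_single (a := j) (s := i) (t := i) rfl x v)

theorem continuous_splitJoinArr [T2Space Y] [CompactlyCoherentSpace Y] {x : Y → Fin n → φ₁.base}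
    (hx : Continuous x) (i : Fin n) : Continuous fun y => splitJoinArr κ j q i (x y) := by
  refine Arr.continuous_of_contSec
    (show Continuous fun y => x y i from (continuous_apply i).comp hx)
    (show Continuous fun y => (q i).base (j.base (x y)) from
      (q i).continuous_base.comp (j.continuous_base.comp hx)) fun s W v hv => ?_
  obtain rfl : s = 0 := Subsingleton.elim _ _
  have hW : Continuous fun y : W => x y := hx.comp continuous_subtype_val
  exact Hom.contSec_single (a := q i) (s := 0) (t := i) rfl (j.continuous_base.comp hW)
    (Hom.contSec_single (a := j) (s := i) (t := i) rfl hW (contSec_nsum.2 ⟨hW, hv⟩))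

/-- Naturality of the canonical isomorphisms `splitJoinArr`. -/
theorem scale_comp_splitJoinArr (i : Fin n) (m : (TCat.pi fun _ : Fin n => φ₁.cat κ).Mor) :
    Arr.comp (Arr.scale 1 ((TCat.piProj (fun _ : Fin n => φ₁.cat κ) i).mor m))
        (splitJoinArr κ j q i ((combine κ φ₁ n).mor m).tgt) rfl =
      Arr.comp (splitJoinArr κ j q i ((combine κ φ₁ n).mor m).src)
        ((q i).mapArr κ (j.mapArr κ ((combine κ φ₁ n).mor m))) rfl := by
  refine Arr.comp_eq_comp fun s v => ?_
  obtain rfl : s = 0 := Subsingleton.elim _ _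
  have h1 := Hom.mapArr_single (a := j) (κ := κ) (s := i) (t := i) rfl ((combine κ φ₁ n).mor m) v
  refine Eq.trans ?_ (Hom.mapArr_single (a := q i) (κ := κ) (s := 0) (t := i) rfl
    (j.mapArr κ ((combine κ φ₁ n).mor m))
    (j.single i i rfl ((combine κ φ₁ n).mor m).src v)).symm
  exact congrArg ((q i).single 0 i rfl (j.base ((combine κ φ₁ n).mor m).tgt)) h1.symm

/-- The canonical unitary transformation from rescaling of the `i`-th component to the functor
obtained by joining and splitting again. -/
noncomputable def splitJoin (h₁ : IsKSpace φ₁.base) (hₙ : IsKSpace φₙ.base) (i : Fin n) :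
    TCat.FuncMor (TCat.pi fun _ : Fin n => φ₁.cat κ) (φ₁.cat κ) where
  dom := ⟨(TCat.piProj _ i).comp (φ₁.scaleFun κ (1 : unitInterval)),
    (TCat.piProj_isCont i).comp (scaleFun_isCont h₁ 1)⟩
  cod := ⟨(joinFun κ j).comp ((q i).functor κ), (joinFun_isCont h₁).comp ((q i).functor_isCont hₙ)⟩
  app x := splitJoinArr κ j q i fun i => (TCat.piProj (fun _ : Fin n => φ₁.cat κ) i).ob x
  cont := by
    have hk : (TCat.pi fun _ : Fin n => φ₁.cat κ).IsKCat := TCat.pi_isKCat fun _ => isKCat_cat h₁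
    have := hk.ob.t2
    have := hk.ob.coherent
    exact continuous_splitJoinArr (continuous_pi fun i =>
      (TCat.piProj_isCont (E := fun _ : Fin n => φ₁.cat κ) i).ob) i
  src_app _ := rfl
  tgt_app _ := rfl
  natural := scale_comp_splitJoinArr i

end Segal

end FibObj

/-! ### Equivariant homotopies -/

namespace EquivariantlyHomotopic

variable {G : Type*} [Group G] {X Y Z : Type*} [TopologicalSpace X] [TopologicalSpace Y]
  [TopologicalSpace Z] [MulAction G X] [MulAction G Y] [MulAction G Z]

theorem symm {f₀ f₁ : X → Y} (h : EquivariantlyHomotopic G f₀ f₁) :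
    EquivariantlyHomotopic G f₁ f₀ := by
  obtain ⟨H, hc, hg, h0, h1⟩ := h
  refine ⟨fun p => H (p.1, unitInterval.symm p.2), by fun_prop, fun g x t => hg g x _, fun x => ?_,
    fun x => ?_⟩
  · simp [h1]
  · simp [h0]

theorem trans {f₀ f₁ f₂ : X → Y} (h : EquivariantlyHomotopic G f₀ f₁)
    (h' : EquivariantlyHomotopic G f₁ f₂) : EquivariantlyHomotopic G f₀ f₂ := by
  obtain ⟨H, hc, hg, h0, h1⟩ := h
  obtain ⟨H', hc', hg', h0', h1'⟩ := h'
  have e0 : f₀ = fun x => H (x, 0) := funext fun x => (h0 x).symm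
  have e1 : f₁ = fun x => H (x, 1) := funext fun x => (h1 x).symm
  have e2 : f₂ = fun x => H' (x, 1) := funext fun x => (h1' x).symm
  let F₀ : C(X, Y) := ⟨f₀, by rw [e0]; fun_prop⟩
  let F₁ : C(X, Y) := ⟨f₁, by rw [e1]; fun_prop⟩
  let F₂ : C(X, Y) := ⟨f₂, by rw [e2]; fun_prop⟩
  let K : F₀.Homotopy F₁ := ⟨⟨fun p => H (p.2, p.1), by fun_prop⟩, h0, h1⟩
  let K' : F₁.Homotopy F₂ := ⟨⟨fun p => H' (p.2, p.1), by fun_prop⟩, h0', h1'⟩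
  refine ⟨fun p => K.trans K' (p.2, p.1), by fun_prop, fun g x t => ?_,
    fun x => (K.trans K').apply_zero x, fun x => (K.trans K').apply_one x⟩
  simp only [ContinuousMap.Homotopy.trans_apply]
  split_ifs
  · exact hg g x _
  · exact hg' g x _

theorem comp {f₀ f₁ : Y → Z} (h : EquivariantlyHomotopic G f₀ f₁) {k : X → Y} (hk : Continuous k)
    (hkg : ∀ (g : G) x, k (g • x) = g • k x) :
    EquivariantlyHomotopic G (fun x => f₀ (k x)) (fun x => f₁ (k x)) := by
  obtain ⟨H, hc, hg, h0, h1⟩ := h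
  refine ⟨fun p => H (k p.1, p.2), by fun_prop, fun g x t => ?_, fun x => h0 _, fun x => h1 _⟩
  exact (congrArg (fun y => H (y, t)) (hkg g x)).trans (hg g (k x) t)

/-- Homotopies can be given componentwise. -/
theorem kifyPi [CompactlyCoherentSpace X] {ι : Type*} {E : ι → Type*} [∀ i, TopologicalSpace (E i)]
    [∀ i, MulAction G (E i)] {f₀ f₁ : ∀ i, X → E i}
    (h : ∀ i, EquivariantlyHomotopic G (f₀ i) (f₁ i)) :
    EquivariantlyHomotopic G (fun x => CompactCoherentification.mk (∀ i, E i) fun i => f₀ i x)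
      (fun x => CompactCoherentification.mk (∀ i, E i) fun i => f₁ i x) := by
  choose H hc hg h0 h1 using h
  refine ⟨fun p => CompactCoherentification.mk (∀ i, E i) fun i => H i p,
    CompactlyCoherentSpace.continuous_toKify (continuous_pi hc), fun g x t => ?_, fun x => ?_,
    fun x => ?_⟩
  · exact funext fun i => hg i g x t
  · exact funext fun i => h0 i x
  · exact funext fun i => h1 i x

end EquivariantlyHomotopic

namespace TCat

/-! ### The Segal map of functor categories -/

section Tuple

variable {C : TCat.{w, w}} {hC : C.IsKCat} {D D' : TCat.{u, v}} {hD : D.IsKCat} {hD' : D'.IsKCat}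

open Realization

theorem map_postcomp_refl (x : Realization (Func C D hC hD)) (h : (Fun.refl D).IsCont) :
    map (Func.postcomp hC hD hD (Fun.refl D) h) x = x :=
  map_refl x

theorem map_postcomp_comp {D'' : TCat.{u, v}} {hD'' : D''.IsKCat} {H : Fun D D'} (hH : H.IsCont)
    {K : Fun D' D''} (hK : K.IsCont) (x : Realization (Func C D hC hD)) :
    map (Func.postcomp hC hD hD'' (H.comp K) (hH.comp hK)) x =
      map (Func.postcomp hC hD' hD'' K hK) (map (Func.postcomp hC hD hD' H hH) x) := by
  rw [map_map]
  rfl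

variable {ι : Type} [Finite ι] {E : ι → TCat.{u, v}} {hE : ∀ i, (E i).IsKCat}

/-- The map from the product of the `|Func(C, Eᵢ)|` to `|Func(C, ∏ᵢ Eᵢ)|`. -/
noncomputable def tuple (y : 𝐤 (∀ i, Realization (Func C (E i) hC (hE i)))) :
    Realization (Func C (pi E) hC (pi_isKCat hE)) :=
  map (funcPi hC hE) (prodMk ((CompactCoherentification.mk
    (∀ i, Realization (Func C (E i) hC (hE i)))).symm y))

theorem map_postcomp_tuple {H : Fun (pi E) D} (hH : H.IsCont) (i : ι) {H' : Fun (E i) D}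
    (hH' : H'.IsCont) (h : H = (piProj E i).comp H')
    (y : 𝐤 (∀ i, Realization (Func C (E i) hC (hE i)))) :
    map (Func.postcomp hC (pi_isKCat hE) hD H hH) (tuple y) =
      map (Func.postcomp hC (hE i) hD H' hH') ((CompactCoherentification.mk _).symm y i) := by
  subst h
  rw [← map_piProj_prodMk ((CompactCoherentification.mk _).symm y) i, tuple, map_map, map_map]
  rfl

theorem tuple_map_postcomp {P : ∀ i, Fun D (E i)} (hP : ∀ i, (P i).IsCont)
    (hP' : (piLift P).IsCont) (x : Realization (Func C D hC hD)) :
    tuple (CompactCoherentification.mk (∀ i, Realization (Func C (E i) hC (hE i)))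
      fun i => map (Func.postcomp hC hD (hE i) (P i) (hP i)) x) =
      map (Func.postcomp hC hD (pi_isKCat hE) (piLift P) hP') x := by
  have h1 : (prodMk fun i => map (Func.postcomp hC hD (hE i) (P i) (hP i)) x) =
      map (piLift fun i => Func.postcomp hC hD (hE i) (P i) (hP i)) x := by
    refine ext_piProj fun i => ?_
    rw [map_piProj_prodMk, map_map]
    rfl
  refine (congrArg (map (funcPi hC hE)) h1).trans ?_
  rw [map_map]
  rfl

variable [LocallyCompactSpace C.Ob] [LocallyCompactSpace C.Mor]

theorem continuous_map_postcomp {H : Fun D D'} (hH : H.IsCont) :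
    Continuous (map (Func.postcomp hC hD hD' H hH)) :=
  continuous_map (Func.isKCat hC hD) (Func.postcomp_isCont hC hD hD' H hH)

theorem continuous_tuple : Continuous (tuple (hC := hC) (hE := hE)) :=
  (continuous_map (pi_isKCat fun i => Func.isKCat hC (hE i)) (funcPi_isCont hC hE)).comp
    (continuous_prodMk fun i => Func.isKCat hC (hE i))

end Tuple

section Segal

variable {G : Type w} [Group G] [TopologicalSpace G] [IsTopologicalGroup G]
  {hG : (perfect G).IsKCat}
variable {D D' : TCat.{u, v}} {hD : D.IsKCat} {hD' : D'.IsKCat}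

open Realization

theorem Realization.smul_def (g : G) (x : Realization (Func (perfect G) D hG hD)) :
    g • x = map (Func.precomp hG hG hD (perfectMap fun x : G => x * g)
      (perfectMap_isCont (continuous_mul_const g))) x :=
  rfl

/-- `G` acts by precomposition, which commutes with postcomposition. -/
theorem map_postcomp_smul {H : Fun D D'} (hH : H.IsCont) (g : G)
    (x : Realization (Func (perfect G) D hG hD)) :
    map (Func.postcomp hG hD hD' H hH) (g • x) = g • map (Func.postcomp hG hD hD' H hH) x := by
  rw [Realization.smul_def, Realization.smul_def, map_map, map_map]
  rfl

variable {ι : Type} [Finite ι] {E : ι → TCat.{u, v}} {hE : ∀ i, (E i).IsKCat}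

theorem tuple_smul (g : G) (y : 𝐤 (∀ i, Realization (Func (perfect G) (E i) hG (hE i)))) :
    tuple (g • y) = g • tuple y := by
  let R : ∀ i, Fun (Func (perfect G) (E i) hG (hE i)) (Func (perfect G) (E i) hG (hE i)) := fun i =>
    Func.precomp hG hG (hE i) (perfectMap fun x : G => x * g)
      (perfectMap_isCont (continuous_mul_const g))
  have h1 : prodMk ((CompactCoherentification.mk
      (∀ i, Realization (Func (perfect G) (E i) hG (hE i)))).symm (g • y)) =
      map (piLift fun i => (piProj _ i).comp (R i)) (prodMk ((CompactCoherentification.mk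
      (∀ i, Realization (Func (perfect G) (E i) hG (hE i)))).symm y)) := by
    refine ext_piProj fun i => ?_
    rw [map_piProj_prodMk, map_map]
    change map (R i) ((CompactCoherentification.mk _).symm y i) = _
    rw [← map_piProj_prodMk ((CompactCoherentification.mk _).symm y) i, map_map]
    rfl
  rw [tuple, h1, tuple, Realization.smul_def, map_map, map_map]
  rfl

variable [LocallyCompactSpace (perfect G).Ob] [LocallyCompactSpace (perfect G).Mor]

/-- A continuous family of functors induces an equivariant homotopy. -/
theorem equivariantlyHomotopic_of_family {F : unitInterval → Fun D D'} (hF : ∀ t, (F t).IsCont)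
    (hc : Continuous fun q : D.Mor × unitInterval => (F q.2).mor q.1) :
    EquivariantlyHomotopic G (map (Func.postcomp hG hD hD' (F 0) (hF 0)))
      (map (Func.postcomp hG hD hD' (F 1) (hF 1))) := by
  refine ⟨fun p => map (Func.postcomp hG hD hD' (F p.2) (hF p.2)) p.1, ?_,
    fun g x t => map_postcomp_smul (hF t) g x, fun _ => rfl, fun _ => rfl⟩
  refine continuous_map_family (Func.isKCat hG hD)
    (F := fun t => Func.postcomp hG hD hD' (F t) (hF t)) ?_
  have hO := FuncOb.isKSpace hG hD
  have hM := FuncMor.isKSpace hG hD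
  have := hO.coherent
  have := hM.coherent
  have hid := FuncMor.continuous_iff.1 (continuous_id (X := FuncMor (perfect G) D))
  have hob : Continuous fun q : FuncOb (perfect G) D × unitInterval =>
      ((Func.postcomp hG hD hD' (F q.2) (hF q.2)).ob q.1 : FuncOb (perfect G) D') := by
    refine FuncOb.continuous_iff.2 ?_
    have h1 := FuncOb.continuous_iff.1 (continuous_id (X := FuncOb (perfect G) D))
    exact hc.comp ((h1.comp (by fun_prop : Continuous
      fun p : (FuncOb (perfect G) D × unitInterval) × (perfect G).Mor => (p.1.1, p.2))).prodMk
        (by fun_prop : Continuous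
          fun p : (FuncOb (perfect G) D × unitInterval) × (perfect G).Mor => p.1.2))
  have hmor : Continuous fun q : FuncMor (perfect G) D × unitInterval =>
      ((Func.postcomp hG hD hD' (F q.2) (hF q.2)).mor q.1 : FuncMor (perfect G) D') := by
    refine FuncMor.continuous_iff.2 ⟨?_, ?_, ?_⟩
    · exact hob.comp ((hid.1.comp continuous_fst).prodMk continuous_snd)
    · exact hob.comp ((hid.2.1.comp continuous_fst).prodMk continuous_snd)
    · exact hc.comp ((hid.2.2.comp (by fun_prop : Continuous
        fun p : (FuncMor (perfect G) D × unitInterval) × (perfect G).Ob => (p.1.1, p.2))).prodMk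
          (by fun_prop : Continuous
            fun p : (FuncMor (perfect G) D × unitInterval) × (perfect G).Ob => p.1.2))
  exact hmor.comp continuous_swap

/-- A continuous natural transformation induces an equivariant homotopy. -/
theorem equivariantlyHomotopic_of_funcMor (a : FuncMor D D') :
    EquivariantlyHomotopic G (map (Func.postcomp hG hD hD' a.dom.toFun a.dom.cont))
      (map (Func.postcomp hG hD hD' a.cod.toFun a.cod.cont)) := by
  obtain ⟨H, hc, h0, h1, hR⟩ := exists_homotopy (Func.isKCat hG hD) (Func.isKCat hG hD')
    (a.whisker hG hD hD')
  exact ⟨H, hc, fun g x t => hR _ _ (fun _ => rfl) (fun _ => rfl) (fun _ => rfl) x t, h0, h1⟩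

/-- Functors `Pᵢ : D → Eᵢ` induce an equivariant homotopy equivalence from `|Func(𝓔 G, D)|` to the
product of the `|Func(𝓔 G, Eᵢ)|`, if there is a functor `J` in the opposite direction such that the
composites of `P` and `J` are related to the identity functors by a continuous family of functors,
followed by a natural transformation. -/
theorem isEquivariantHomotopyEquiv_of_funcMor {P : ∀ i, Fun D (E i)} (hP : ∀ i, (P i).IsCont)
    {J : Fun (pi E) D} (hJ : J.IsCont) {F : unitInterval → Fun D D} (hF : ∀ t, (F t).IsCont)
    (hFc : Continuous fun q : D.Mor × unitInterval => (F q.2).mor q.1) (hF0 : F 0 = Fun.refl D)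
    {F' : ∀ i, unitInterval → Fun (E i) (E i)} (hF' : ∀ i t, (F' i t).IsCont)
    (hFc' : ∀ i, Continuous fun q : (E i).Mor × unitInterval => (F' i q.2).mor q.1)
    (hF0' : ∀ i, F' i 0 = Fun.refl (E i)) (a : FuncMor D D) (ha : a.dom.toFun = F 1)
    (ha' : a.cod.toFun = (piLift P).comp J) (b : ∀ i, FuncMor (pi E) (E i))
    (hb : ∀ i, (b i).dom.toFun = (piProj E i).comp (F' i 1))
    (hb' : ∀ i, (b i).cod.toFun = J.comp (P i)) :
    IsEquivariantHomotopyEquiv G fun x : Realization (Func (perfect G) D hG hD) =>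
      CompactCoherentification.mk (∀ i, Realization (Func (perfect G) (E i) hG (hE i)))
        fun i => map (Func.postcomp hG hD (hE i) (P i) (hP i)) x := by
  have hk := isKSpace (Func.isKCat hG hD)
  have := hk.coherent
  have hP' := piLift_isCont hD hP
  have hproj : ∀ i, Continuous fun y : 𝐤 (∀ i, Realization (Func (perfect G) (E i) hG (hE i))) =>
      (CompactCoherentification.mk _).symm y i := fun i =>
    (continuous_apply i).comp CompactCoherentification.continuous_mk_symm
  refine ⟨CompactlyCoherentSpace.continuous_toKify (continuous_pi fun i =>
      continuous_map_postcomp (hP i)), fun g x => funext fun i => map_postcomp_smul (hP i) g x,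
    fun y => map (Func.postcomp hG (pi_isKCat hE) hD J hJ) (tuple y),
    (continuous_map_postcomp hJ).comp continuous_tuple, fun g y => ?_, ?_, ?_⟩
  · exact (congrArg _ (tuple_smul g y)).trans (map_postcomp_smul hJ g _)
  -- `id = F 0 ≃ F 1 ≃ J ∘ P`
  · have h1 := equivariantlyHomotopic_of_family (G := G) (hG := hG) (hD := hD) (hD' := hD) hF hFc
    have h2 := equivariantlyHomotopic_of_funcMor (G := G) (hG := hG) (hD := hD) (hD' := hD) a
    simp only [ha, ha', hF0] at h1 h2
    have h3 := (h1.trans h2).symm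
    refine (congrArg₂ (EquivariantlyHomotopic G) (funext fun x => ?_) (funext fun x => ?_)).mp h3
    · rw [Function.comp_apply, tuple_map_postcomp hP hP', map_map]
      rfl
    · exact map_postcomp_refl x _
  -- in the `i`-th component, `prᵢ = F' i 0 ∘ prᵢ ≃ F' i 1 ∘ prᵢ ≃ P i ∘ J`
  · refine EquivariantlyHomotopic.kifyPi (f₀ := fun i y =>
      map (Func.postcomp hG hD (hE i) (P i) (hP i))
        (map (Func.postcomp hG (pi_isKCat hE) hD J hJ) (tuple y)))
      (f₁ := fun i y => (CompactCoherentification.mk _).symm y i) fun i => ?_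
    have h1 := equivariantlyHomotopic_of_family (G := G) (hG := hG) (hD := hE i) (hD' := hE i)
      (hF' i) (hFc' i)
    have h2 := equivariantlyHomotopic_of_funcMor (G := G) (hG := hG) (hD := pi_isKCat hE)
      (hD' := hE i) (b i)
    have h1' := h1.comp (hproj i) fun g y => rfl
    have h2' := h2.comp (continuous_tuple (hE := hE)) tuple_smul
    simp only [hb, hb', hF0'] at h1' h2'
    simp only [map_postcomp_tuple _ i (hF' i 1) rfl] at h2'
    have h3 := (h1'.trans h2').symm
    refine (congrArg₂ (EquivariantlyHomotopic G) (funext fun x => ?_) (funext fun x => ?_)).mp h3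
    · rw [map_map]
      rfl
    · exact map_postcomp_refl _ _

end Segal

end TCat

/-! ### The category `𝓔 G` of a locally compact group -/

namespace TCat

section Perfect

theorem continuous_perfect_symm {X : Type u} [TopologicalSpace X] :
    Continuous fun m : (perfect X).Mor => (CompactCoherentification.mk (X × X)).symm m :=
  CompactCoherentification.continuous_mk_symm

variable {X : Type u} [TopologicalSpace X] [T2Space X] [LocallyCompactSpace X]

instance : LocallyCompactSpace (perfect X).Ob := inferInstanceAs (LocallyCompactSpace X)

/-- The square of a locally compact Hausdorff space is compactly generated, so that its
k-ification is homeomorphic to it. -/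
instance : LocallyCompactSpace (perfect X).Mor :=
  (CompactCoherentification.homeo (X := X × X)).symm.isClosedEmbedding.locallyCompactSpace

theorem continuous_perfect_mk :
    Continuous fun p : X × X => (CompactCoherentification.mk (X × X) p : (perfect X).Mor) :=
  (CompactCoherentification.homeo (X := X × X)).continuous

theorem perfect_isKCat : (perfect X).IsKCat where
  ob := ⟨inferInstanceAs (T2Space X), inferInstanceAs (CompactlyCoherentSpace X)⟩
  mor := show IsKSpace (𝐤 (X × X)) from isKSpace_kify
  continuous_src := continuous_fst.comp continuous_perfect_symm
  continuous_tgt := continuous_snd.comp continuous_perfect_symm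
  continuous_id := continuous_perfect_mk.comp (continuous_id.prodMk continuous_id)
  continuous_comp := by
    have h := continuous_subtype_val.comp (CompactCoherentification.continuous_mk_symm
      (X := {p : (perfect X).Mor × (perfect X).Mor // (perfect X).tgt p.1 = (perfect X).src p.2}))
    exact continuous_perfect_mk.comp
      ((continuous_fst.comp (continuous_perfect_symm.comp (continuous_fst.comp h))).prodMk
        (continuous_snd.comp (continuous_perfect_symm.comp (continuous_snd.comp h))))

end Perfect

section Action

variable {G : Type w} [Group G] [TopologicalSpace G] [IsTopologicalGroup G] [T2Space G]
  [LocallyCompactSpace G] {hG : (perfect G).IsKCat} {D : TCat.{u, v}} {hD : D.IsKCat}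

theorem continuous_perfectMap_mul :
    Continuous fun p : G × (perfect G).Mor => (perfectMap fun x : G => x * p.1).mor p.2 := by
  have h : Continuous fun p : G × (perfect G).Mor =>
      (CompactCoherentification.mk (G × G)).symm p.2 := continuous_perfect_symm.comp continuous_snd
  exact continuous_perfect_mk.comp (((continuous_fst.comp h).mul continuous_fst).prodMk
    ((continuous_snd.comp h).mul continuous_fst))

/-- The functors by which the elements of `G` act form a continuous family, parametrized by the
locally compact space `G`. -/
theorem Realization.continuousSMul :
    ContinuousSMul G (Realization (Func (perfect G) D hG hD)) := by
  have hO := (FuncOb.isKSpace hG hD).coherent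
  have hM := (FuncMor.isKSpace hG hD).coherent
  let R : G → Fun (Func (perfect G) D hG hD) (Func (perfect G) D hG hD) := fun g =>
    Func.precomp hG hG hD (perfectMap fun x : G => x * g)
      (perfectMap_isCont (continuous_mul_const g))
  have hid := FuncMor.continuous_iff.1 (continuous_id (X := FuncMor (perfect G) D))
  have hob : Continuous fun q : FuncOb (perfect G) D × G =>
      ((R q.2).ob q.1 : FuncOb (perfect G) D) := by
    have h1 := FuncOb.continuous_iff.1 (continuous_id (X := FuncOb (perfect G) D))
    refine FuncOb.continuous_iff.2 ?_
    exact h1.comp ((by fun_prop : Continuous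
      fun p : (FuncOb (perfect G) D × G) × (perfect G).Mor => p.1.1).prodMk
        (continuous_perfectMap_mul.comp (by fun_prop : Continuous
          fun p : (FuncOb (perfect G) D × G) × (perfect G).Mor => (p.1.2, p.2))))
  have hmor : Continuous fun q : FuncMor (perfect G) D × G =>
      ((R q.2).mor q.1 : FuncMor (perfect G) D) := by
    refine FuncMor.continuous_iff.2 ⟨?_, ?_, ?_⟩
    · exact hob.comp ((hid.1.comp continuous_fst).prodMk continuous_snd)
    · exact hob.comp ((hid.2.1.comp continuous_fst).prodMk continuous_snd)
    · have h2 : Continuous fun p : (FuncMor (perfect G) D × G) × G => p.2 * p.1.2 := by fun_prop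
      exact hid.2.2.comp ((by fun_prop : Continuous
        fun p : (FuncMor (perfect G) D × G) × G => p.1.1).prodMk h2)
  exact ⟨(continuous_map_family (Func.isKCat hG hD) (F := R)
    (hmor.comp continuous_swap)).comp continuous_swap⟩

end Action

/-! ### Categories with a single morphism -/

section Point

variable {A : TCat.{u, v}}

/-- If there is only one morphism, there is only one step functor. -/
theorem Realization.subsingleton [Subsingleton A.Mor] : Subsingleton (Realization A) :=
  ⟨fun _ _ => step_injective (funext fun _ => Subsingleton.elim _ _)⟩

/-- The constant functor with value `x`. -/
def Fun.const (C : TCat) (x : A.Ob) : Fun C A where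
  ob _ := x
  mor _ := A.id x
  src_mor _ := A.src_id x
  tgt_mor _ := A.tgt_id x
  mor_id _ := rfl
  mor_comp _ _ _ := by rw [A.comp_congr (congrArg A.id (A.src_id x).symm) rfl, A.id_comp]

theorem Realization.nonempty [Nonempty A.Ob] : Nonempty (Realization A) :=
  ⟨mk (m := 0) (Fun.const (ordinal 0) (Classical.arbitrary A.Ob)) (Classical.arbitrary _)⟩

end Point

end TCat

section Equivariant

variable {G : Type v} [Group G] {X : Type u} [TopologicalSpace X] [MulAction G X] [Subsingleton X]
  [Nonempty X]

theorem IsEquivariantlyContractible.of_subsingleton : IsEquivariantlyContractible G X :=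
  ⟨Classical.arbitrary X, fun _ => Subsingleton.elim _ _, fun p => p.1, continuous_fst,
    fun _ _ _ => rfl, fun _ => rfl, fun _ => Subsingleton.elim _ _⟩

theorem IsEquivariantlyWellPointed.of_subsingleton [TopologicalSpace G] :
    IsEquivariantlyWellPointed G X := by
  have x₀ := Classical.arbitrary X
  refine ⟨x₀, (Set.subsingleton_of_subsingleton (s := {x₀})).isClosed,
    fun _ => Subsingleton.elim _ _, ?_⟩
  intro Y _ _ _ f h _ _ hh hg h0
  refine ⟨fun p => h p.2, hh.comp continuous_snd, fun g _ t => (hg g t).symm, fun x => ?_,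
    fun _ => rfl⟩
  exact h0.trans (congrArg f (Subsingleton.elim x₀ x))

end Equivariant


/-! ### Hilbert `Γ`-bundles -/

namespace HilbertGammaBundle

variable {𝕜 : Type w} [RCLike 𝕜] (φ : HilbertGammaBundle.{u} 𝕜) (κ : ModKind)

theorem isKSpace_base (S : Type) [Finite S] : IsKSpace (φ.obj S).base :=
  (φ.locallyCountableCW S).isKSpace

/-- Over a point, a `𝟎`-object has no morphisms but the identity. -/
theorem subsingleton_arr_zero : Subsingleton ((φ.obj (Fin 0)).Arr κ) := by
  have := φ.base_zero.2
  refine ⟨fun ⟨x, y, f, hf⟩ ⟨x', y', f', hf'⟩ => ?_⟩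
  obtain rfl := Subsingleton.elim x x'
  obtain rfl := Subsingleton.elim y y'
  exact FibObj.Arr.ext_iso fun s => s.elim0

variable {κ} {G : Type v} [Group G] [TopologicalSpace G] [IsTopologicalGroup G]
  {hG : (TCat.perfect G).IsKCat}
  {hob : ∀ (S : Type) [Finite S], ((φ.obj S).cat κ).IsKCat}
  {hmap : ∀ {S T : Type} [Finite S] [Finite T] (γ : GammaHom S T), ((φ.map γ).functor κ).IsCont}

theorem subsingleton_vec_zero : Subsingleton ((φ.vec κ G hG hob hmap).space (Fin 0)) := by
  have h : Subsingleton ((φ.obj (Fin 0)).cat κ).Mor := φ.subsingleton_arr_zero κ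
  have h' : Subsingleton ((φ.obj (Fin 0)).cat κ).Ob := φ.base_zero.2
  have : Subsingleton (TCat.Func (TCat.perfect G) ((φ.obj (Fin 0)).cat κ) hG (hob (Fin 0))).Mor :=
    ⟨fun _ _ => TCat.FuncMor.ext (TCat.FuncOb.ext_mor (Subsingleton.elim _ _))
      (TCat.FuncOb.ext_mor (Subsingleton.elim _ _)) (Subsingleton.elim _ _)⟩
  exact TCat.Realization.subsingleton

theorem nonempty_vec_zero : Nonempty ((φ.vec κ G hG hob hmap).space (Fin 0)) := by
  obtain ⟨x⟩ := φ.base_zero.1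
  have : Nonempty (TCat.Func (TCat.perfect G) ((φ.obj (Fin 0)).cat κ) hG (hob (Fin 0))).Ob := by
    exact ⟨⟨TCat.Fun.const (A := (φ.obj (Fin 0)).cat κ) _ x, continuous_const, continuous_const⟩⟩
  exact TCat.Realization.nonempty

variable [T2Space G] [LocallyCompactSpace G]

/-- The functors `φ(𝐧)-mod → φ(𝟏)-mod` split the bundles, and a morphism `n.φ(𝟏) → φ(𝐧)` joins them
again; up to rescaling, these operations are mutually inverse up to canonical unitary
isomorphisms. -/
theorem isEquivariantHomotopyEquiv_segal {n : ℕ} (hn : 1 ≤ n) :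
    IsEquivariantHomotopyEquiv G ((φ.vec κ G hG hob hmap).segal n) := by
  obtain ⟨j⟩ := φ.exists_sum n hn
  have h₁ := φ.isKSpace_base (Fin 1)
  have hₙ := φ.isKSpace_base (Fin n)
  exact TCat.isEquivariantHomotopyEquiv_of_funcMor (hG := hG) (hD := hob (Fin n))
    (hE := fun _ => hob (Fin 1)) (P := fun i => (φ.map (GammaHom.point i)).functor κ)
    (fun i => hmap _) (FibObj.joinFun_isCont (j := j) h₁)
    (F := fun t => (φ.obj (Fin n)).scaleFun κ (t : ℝ)) (FibObj.scaleFun_isCont hₙ)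
    (FibObj.Arr.continuous_scale hₙ) FibObj.scaleFun_zero
    (F' := fun _ t => (φ.obj (Fin 1)).scaleFun κ (t : ℝ)) (fun _ => FibObj.scaleFun_isCont h₁)
    (fun _ => FibObj.Arr.continuous_scale h₁) (fun _ => FibObj.scaleFun_zero)
    (FibObj.joinSplit h₁ hₙ) rfl rfl (FibObj.splitJoin h₁ hₙ) (fun _ => rfl) fun _ => rfl

theorem isGammaGSpace_vec : (φ.vec κ G hG hob hmap).IsGammaGSpace where
  isKSpace S _ := TCat.Realization.isKSpace (TCat.Func.isKCat hG (hob S))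
  continuous_smul S _ := TCat.Realization.continuousSMul
  continuous_map γ := TCat.continuous_map_postcomp (hmap γ)
  map_smul γ g a := TCat.map_postcomp_smul (hmap γ) g a
  map_id S _ a := by
    have h : (φ.map (GammaHom.id S)).functor κ = TCat.Fun.refl _ := by
      rw [φ.map_id, FibObj.Hom.functor_id]
    change TCat.Realization.map (TCat.Func.postcomp hG (hob S) (hob S) _ (hmap _)) a = a
    simp only [h]
    exact TCat.map_postcomp_refl a _
  map_comp {S T U} _ _ _ γ δ a := by
    have h : (φ.map (γ.comp δ)).functor κ =
        ((φ.map δ).functor κ).comp ((φ.map γ).functor κ) := by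
      rw [φ.map_comp, FibObj.Hom.functor_comp]
    change TCat.Realization.map (TCat.Func.postcomp hG (hob U) (hob S) _ (hmap _)) a =
      TCat.Realization.map (TCat.Func.postcomp hG (hob T) (hob S) _ (hmap γ))
        (TCat.Realization.map (TCat.Func.postcomp hG (hob U) (hob T) _ (hmap δ)) a)
    simp only [h]
    exact TCat.map_postcomp_comp (hmap δ) (hmap γ) a
  wellPointed_zero := by
    have := φ.subsingleton_vec_zero (hG := hG) (hob := hob) (hmap := hmap)
    have := φ.nonempty_vec_zero (hG := hG) (hob := hob) (hmap := hmap)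
    exact IsEquivariantlyWellPointed.of_subsingleton
  contractible_zero := by
    have := φ.subsingleton_vec_zero (hG := hG) (hob := hob) (hmap := hmap)
    have := φ.nonempty_vec_zero (hG := hG) (hob := hob) (hmap := hmap)
    exact IsEquivariantlyContractible.of_subsingleton
  segal_equiv _ hn := φ.isEquivariantHomotopyEquiv_segal hn

end HilbertGammaBundle

theorem mainTheorem8 {𝕜 : Type w} [RCLike 𝕜] (φ : HilbertGammaBundle.{u} 𝕜) {d : ℕ}
    (G : Type v) [Group G] [TopologicalSpace G] [IsTopologicalGroup G] [T2Space G]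
    [ChartedSpace (EuclideanSpace ℝ (Fin d)) G] [LieGroup (𝓡 d) ∞ G] (κ : ModKind) :
    ∃ (hG : (TCat.perfect G).IsKCat)
      (hob : ∀ (S : Type) [Finite S], ((φ.obj S).cat κ).IsKCat)
      (hmap : ∀ {S T : Type} [Finite S] [Finite T] (γ : GammaHom S T),
        ((φ.map γ).functor κ).IsCont),
      (φ.vec κ G hG hob hmap).IsGammaGSpace := by
  have := ChartedSpace.locallyCompactSpace (EuclideanSpace ℝ (Fin d)) G
  exact ⟨TCat.perfect_isKCat, fun S _ => FibObj.isKCat_cat (φ.isKSpace_base S),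
    fun γ => (φ.map γ).functor_isCont (φ.isKSpace_base _), φ.isGammaGSpace_vec⟩
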